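/- **Odd form rings.** An *odd form ring* $(R,\Delta)$ consists of a (not necessarily unital) ring $R$ with involution $x\mapsto\bar x$ (additive, $\overline{xy}=\bar y\bar x$, $\bar{\bar x}=x$), a (not necessarily commutative) group $(\Delta,\dotplus)$ with a right action $u\cdot x$ of the multiplicative semigroup of $R$ by endomorphisms, and maps $\phi\colon R\to\Delta$, $\pi\colon\Delta\to R$, $\rho\colon\Delta\to R$ such that $\phi$, $\pi$ are homomorphisms, $\pi(u\cdot x)=\pi(u)x$, $\phi(\bar xyx)=\phi(y)\cdot x$, $\phi(x)=\dot 0$ if $x=\bar x$, $u\dotplus\phi(x)=\phi(x)\dotplus u$, $u\dotplus v=v\dotplus u\dotplus\phi(-\overline{\pi(u)}\pi(v))$, $\rho(u\dotplus v)=\rho(u)-\overline{\pi(u)}\pi(v)+\rho(v)$, $\overline{\rho(u)}=\rho(\dot-u)$, $\rho(u\cdot x)=\bar x\rho(u)x$, $\pi(\phi(x))=0$, $\rho(\phi(x))=x-\bar x$, and $u\cdot(x+y)=u\cdot x\dotplus\phi(\bar y\rho(u)x)\dotplus u\cdot y$. The last rule together with $u\cdot 1=u$ also defines $u\cdot(1+x)$.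 Morphisms are pairs of homomorphisms that preserve all operations; $\mathrm{Hom}(S,\Theta;R,\Delta)$ is the set of morphisms, ${}^fx$ is the image of $x$ under $f$, and $PU(R,\Delta)$ is the automorphism group of $(R,\Delta)$. An *odd form ideal* $(I,\Gamma)\trianglelefteq(R,\Delta)$ is a two-sided ideal $I=\bar I$ with a normal subgroup $\Gamma\trianglelefteq\Delta$ such that $\Gamma\cdot R\subseteq\Gamma$, $\Delta\cdot I\dotplus\phi(I)\subseteq\Gamma$ and $\pi(\Gamma),\rho(\Gamma)\subseteq I$. **Unitary groups.** $U(R,\Delta)$ is the group of pairs $g=(\beta(g),\gamma(g))\in R\times\Delta$ such that $\alpha(g)=1+\beta(g)$ satisfies $\alpha(g)^{-1}=\overline{\alpha(g)}$, $\pi(\gamma(g))=\beta(g)$, $\rho(\gamma(g))=\overline{\beta(g)}$, with $\alpha(gh)=\alpha(g)\alpha(h)$ and $\gamma(gh)=\gamma(g)\cdot\alpha(h)\dotplus\gamma(h)$. It maps to $PU(R,\Delta)$ by ${}^gx=\alpha(g)x\alpha(g)^{-1}$, ${}^gu=(\gamma(g)\cdot\pi(u)\dotplus u)\cdot\alpha(g)^{-1}$,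 and acts on $\mathrm{Hom}(S,\Theta;R,\Delta)$ by composition. $U(I,\Gamma)$ is the subgroup of all $g\in U(R,\Delta)$ with $\beta(g)\in I$, $\gamma(g)\in\Gamma$, and $PU(R,\Delta;I,\Gamma)$ is the subgroup of all $\sigma\in PU(R,\Delta)$ with ${}^\sigma x-x\in I$ and ${}^\sigma u\,\dot-\,u\in\Gamma$ for all $x\in R$, $u\in\Delta$. It embeds by $\sigma\mapsto\sigma\times\mathrm{id}$ into $PU(I\rtimes R,\Gamma\rtimes\Delta)$, where $(I\rtimes R,\Gamma\rtimes\Delta)\cong(R\times_IR,\Delta\times_\Gamma\Delta)$ is the double, i.e. the odd form ring of pairs congruent modulo $(I,\Gamma)$; $(R,\Delta)$ embeds in the double diagonally. For an odd form overring $(R,\Delta)\subseteq(T,\Xi)$ let $GU(T,\Xi;R,\Delta)=\{g\in U(T,\Xi)\mid{}^g(R,\Delta)=(R,\Delta)\}$; it maps to $PU(R,\Delta)$ by restriction. For a hermitian idempotent $e=e^2=\bar e$ of $R$ let $\Delta_e=\Delta\cdot e$, $R_e=eRe$, $\Delta^e_e=\{u\in\Delta_e\mid\pi(u)\in R_e\}$,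 and similarly for $e'=1-e\in R\rtimes\mathbb Z$ and for $(I,\Gamma)$; $(R_e,\Delta_e^e)$ and $(R_{e'},\Delta_{e'}^{e'})$ are odd form rings. For hermitian idempotents $e,f$ of $R$ let $U(e,f;R,\Delta)$ be the set of pairs $(\alpha,\gamma)$ with $\alpha\in eRf$, $\bar\alpha\alpha=f$, $\alpha\bar\alpha=e$, $\gamma\in\Delta\cdot f$, $\pi(\gamma)=\alpha-f$, $\rho(\gamma)=\overline{(\alpha-f)}f$. **Hyperbolic families.** A *hyperbolic pair* $\eta=(e_-,e_+,q_-,q_+)$ consists of orthogonal idempotents $e_\pm\in R$ with $\overline{e_+}=e_-$ and elements $q_\pm\in\Delta$ with $\pi(q_\pm)=e_\pm$, $\rho(q_\pm)=0$, $q_\pm\cdot e_\pm=q_\pm$. For pairs $\eta_i=(e_{-i},e_i,q_{-i},q_i)$ put $e_{|i|}=e_{-i}+e_i$. A *free orthogonal hyperbolic family of rank $n$* is a family $\eta_1,\dots,\eta_n$ with $e_{|i|}e_{|j|}=0$ for $i\ne j$, together with $e_{ij}\in R$ ($1\le i,j\le n$) with $e_{ii}=e_i$ and $e_{ij}e_{jk}=e_{ik}$.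 For $n\ge1$ it gives a free orthogonal hyperbolic family $\eta_1,\dots,\eta_{n-1}$ of rank $n-1$ in $(R_{|n|'},\Delta_{|n|'}^{|n|'})$, the corner for the idempotent $e_{|n|'}=1-e_{|n|}$; the objects below with $n-1$ in place of $n$ are those of this corner (with $(T,\Xi)$ and $(I,\Gamma)$ replaced by their corners for $e_{|n|'}$). In particular $U(n;R,\Delta)=U(R,\Delta)$, $U(n-1;R,\Delta)=U(R_{|n|'},\Delta_{|n|'}^{|n|'})$, and likewise for $(I,\Gamma)$. **Stable ranks.** Let $R_1=e_1Re_1$, $R_{-1,1}=e_{-1}Re_1$, $R_{1,-1}=e_1Re_{-1}$, and $\Delta^{\mathrm{ev}}=\rho(\{u\in\Delta\cdot e_{0'}\mid\pi(u)=0\})$ with $e_{0'}=\sum_ie_{|i|}$. For $k\ge0$, $\mathrm{sr}(R_1)\le k$ means: if $x_1,\dots,x_{k+1}\in R_1$ satisfy $\sum y_ix_i=e_1$ for some $y_i\in R_1$, then there are $a_1,\dots,a_k\in R_1$ such that $\sum_{i\le k}z_i(x_i+a_ix_{k+1})=e_1$ for some $z_i\in R_1$. And $\Lambda\mathrm{sr}(\eta_1;R,\Delta)\le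 k$ means: $\mathrm{sr}(R_1)\le k$, and if $x_i\in R_1$, $x_{-i}\in R_{-1,1}$ ($1\le i\le k+1$) satisfy $\sum_{i}y_{-i}x_{-i}+\sum_iy_ix_i=e_1$ for some $y_i\in R_1$, $y_{-i}\in R_{1,-1}$, then there are $a_{i,-j}\in R_{1,-1}$ ($1\le i,j\le k+1$) with $a_{i,-j}=-\overline{a_{j,-i}}$, $a_{i,-i}\in\Delta^{\mathrm{ev}}$, such that $\sum_iz_i\bigl(x_i+\sum_ja_{i,-j}x_{-j}\bigr)=e_1$ for some $z_i\in R_1$. **Theorem.** Let $(S,\Theta)$ and $(R,\Delta)$ be odd form rings with free orthogonal hyperbolic families of ranks $m\ge1$ and $n\ge1$, let $(R,\Delta)\subseteq(T,\Xi)$ be an odd form overring, and let $(I,\Gamma)\trianglelefteq(R,\Delta)$ be an odd form ideal. Put $$\mathrm{Hom}^*(m;S,\Theta;n;R,\Delta)=\{f\mid U({}^fe_{|m|},e_{|n|};R,\Delta)\ne\varnothing\},\qquad \mathrm{Hom}_{mn}(m;S,\Theta;n;R,\Delta)=\{f\mid{}^fe_{|m|}=e_{|n|}\}$$ (subsets of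 $\mathrm{Hom}(S,\Theta;R,\Delta)$), $PU^*(n;R,\Delta)=\mathrm{Hom}^*(n;R,\Delta;n;R,\Delta)\cap PU(R,\Delta)$, $PU_n(n;R,\Delta)=\mathrm{Hom}_{nn}(n;R,\Delta;n;R,\Delta)\cap PU(R,\Delta)$, and let $PU^*(n;R,\Delta;I,\Gamma)$ and $PU_n(n;R,\Delta;I,\Gamma)$ be the intersections of $PU(R,\Delta;I,\Gamma)$ with $PU^*(n;I\rtimes R,\Gamma\rtimes\Delta)$ and $PU_n(n;I\rtimes R,\Gamma\rtimes\Delta)$. Let $GU^*(n;T,\Xi;R,\Delta)$, $GU_n(n;T,\Xi;R,\Delta)$, $GU^*(n;T,\Xi;R,\Delta;I,\Gamma)$, $GU_n(n;T,\Xi;R,\Delta;I,\Gamma)$ be the preimages of these groups under $GU(T,\Xi;R,\Delta)\to PU(R,\Delta)$. Finally let $$U'_{|n|}=U(R_{|n|},\Delta^{|n|}_{|n|})\times U(n-1;R,\Delta)=\{g\in U(R,\Delta)\mid e_{|n|}\beta(g)=\beta(g)e_{|n|}\},\qquad U'_{|n|}(I,\Gamma)=U'_{|n|}\cap U(I,\Gamma)=U(I_{|n|},\Gamma^{|n|}_{|n|})\times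 U(n-1;I,\Gamma).$$ Quotients of $PU$-groups by unitary groups are quotients by the images of the latter; all subgroups by which $PU$- or $GU$-groups are divided below are normal. 1. The canonical maps $$U'_{|n|}\backslash\mathrm{Hom}_{mn}(m;S,\Theta;n;R,\Delta)\to U(n;R,\Delta)\backslash\mathrm{Hom}^*(m;S,\Theta;n;R,\Delta),$$ $$PU_n(n;R,\Delta)/U'_{|n|}\to PU^*(n;R,\Delta)/U(n;R,\Delta),\qquad GU_n(n;T,\Xi;R,\Delta)/U'_{|n|}\to GU^*(n;T,\Xi;R,\Delta)/U(n;R,\Delta)$$ are well defined and injective. They are bijective if $\Lambda\mathrm{sr}(\eta_1;R,\Delta)\le n-1$. 2. If $m,n\ge2$ (only $n\geq 2$ is needed for the last two maps), then the canonical (restriction) maps $$U'_{|n|}\backslash\mathrm{Hom}_{mn}(m;S,\Theta;n;R,\Delta)\to U(n-1;R,\Delta)\backslash\mathrm{Hom}^*(m-1;S,\Theta;n-1;R,\Delta),$$ $$PU_n(n;R,\Delta)/U'_{|n|}\to PU^*(n-1;R,\Delta)/U(n-1;R,\Delta),\qquad GU_n(n;T,\Xi;R,\Delta)/U'_{|n|}\to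 GU^*(n-1;T,\Xi;R,\Delta)/U(n-1;R,\Delta)$$ are well defined and injective. They are bijective if $\Lambda\mathrm{sr}(\eta_1;R,\Delta)\le n-2$. 3. The relative maps $$PU_n(n;R,\Delta;I,\Gamma)/U'_{|n|}(I,\Gamma)\to PU^*(n;R,\Delta;I,\Gamma)/U(n;I,\Gamma),$$ $$GU_n(n;T,\Xi;R,\Delta;I,\Gamma)/U'_{|n|}(I,\Gamma)\to GU^*(n;T,\Xi;R,\Delta;I,\Gamma)/U(n;I,\Gamma)$$ are well defined and injective. They are bijective if $\Lambda\mathrm{sr}(\eta_1;I\rtimes R,\Gamma\rtimes\Delta)\le n-1$. 4. If $n\ge2$, then the relative maps $$PU_n(n;R,\Delta;I,\Gamma)/U'_{|n|}(I,\Gamma)\to PU^*(n-1;R,\Delta;I,\Gamma)/U(n-1;I,\Gamma),$$ $$GU_n(n;T,\Xi;R,\Delta;I,\Gamma)/U'_{|n|}(I,\Gamma)\to GU^*(n-1;T,\Xi;R,\Delta;I,\Gamma)/U(n-1;I,\Gamma)$$ are well defined and injective. They are bijective if $\Lambda\mathrm{sr}(\eta_1;I\rtimes R,\Gamma\rtimes\Delta)\le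 n-2$. Consequently, for $n\ge2$ there are group isomorphisms $$PU^*(n-1;R,\Delta)/U(n-1;R,\Delta)\cong PU^*(n;R,\Delta)/U(n;R,\Delta)\quad\text{if }\Lambda\mathrm{sr}(\eta_1;R,\Delta)\le n-2,$$ $$PU^*(n-1;R,\Delta;I,\Gamma)/U(n-1;I,\Gamma)\cong PU^*(n;R,\Delta;I,\Gamma)/U(n;I,\Gamma)\quad\text{if }\Lambda\mathrm{sr}(\eta_1;I\rtimes R,\Gamma\rtimes\Delta)\le n-2,$$ which are canonical: for $\sigma\in PU_n$ the class of the restriction of $\sigma$ to the corner corresponds to the class of $\sigma$. -/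

import Mathlib

universe u v u₁ v₁ u₂ v₂

namespace OddForm

/-- An odd form ring `(R, Δ)`: a (not necessarily unital) ring `R` with involution and a (not
necessarily commutative, additively written) group `D = Δ` on which the multiplicative semigroup of
`R` acts from the right by endomorphisms, with maps `φ : R → Δ`, `π : Δ → R`, `ρ : Δ → R`. -/
structure OddFormRing where
  R : Type u
  D : Type v
  [ringR : NonUnitalRing R]
  [starR : StarRing R]
  [grpD : AddGroup D]
  /-- the action `u · x` -/
  act : D → R → D
  phi : R → D
  pi : D → R
  rho : D → R
  add_act : ∀ u v x, act (u + v) x = act u x + act v x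
  act_act : ∀ u x y, act (act u x) y = act u (x * y)
  pi_add : ∀ u v, pi (u + v) = pi u + pi v
  pi_act : ∀ u x, pi (act u x) = pi u * x
  phi_add : ∀ x y, phi (x + y) = phi x + phi y
  phi_conj : ∀ x y, phi (star x * y * x) = act (phi y) x
  phi_herm : ∀ x, star x = x → phi x = 0
  add_phi : ∀ u x, u + phi x = phi x + u
  add_swap : ∀ u v, u + v = v + u + phi (-(star (pi u)) * pi v)
  rho_add : ∀ u v, rho (u + v) = rho u - star (pi u) * pi v + rho v
  star_rho : ∀ u, star (rho u) = rho (-u)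
  rho_act : ∀ u x, rho (act u x) = star x * rho u * x
  pi_phi : ∀ x, pi (phi x) = 0
  rho_phi : ∀ x, rho (phi x) = x - star x
  act_add : ∀ u x y, act u (x + y) = act u x + phi (star y * rho u * x) + act u y

attribute [instance] OddFormRing.ringR OddFormRing.starR OddFormRing.grpD

namespace OddFormRing

variable (X : OddFormRing.{u, v})

attribute [simp] pi_add pi_act pi_phi rho_phi rho_act

@[simp] theorem pi_zero : X.pi 0 = 0 := by
  have h := X.pi_add 0 0
  simpa using h

@[simp] theorem phi_zero : X.phi 0 = 0 := X.phi_herm 0 (star_zero _)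

@[simp] theorem zero_act (x : X.R) : X.act 0 x = 0 := by
  have h := X.add_act 0 0 x
  simpa using h

@[simp] theorem act_zero (u : X.D) : X.act u 0 = 0 := by
  have h := X.act_add u 0 0
  simpa using h

@[simp] theorem rho_zero : X.rho 0 = 0 := by
  have h := X.rho_add 0 0
  simpa using h

@[simp] theorem phi_neg (x : X.R) : X.phi (-x) = -X.phi x := by
  have h := X.phi_add (-x) x
  rw [neg_add_cancel, phi_zero] at h
  exact eq_neg_of_add_eq_zero_left h.symm

@[simp] theorem pi_neg (u : X.D) : X.pi (-u) = -X.pi u := by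
  have h := X.pi_add (-u) u
  rw [neg_add_cancel, pi_zero] at h
  exact eq_neg_of_add_eq_zero_left h.symm

@[simp] theorem neg_act (u : X.D) (x : X.R) : X.act (-u) x = -X.act u x := by
  have h := X.add_act (-u) u x
  rw [neg_add_cancel, zero_act] at h
  exact eq_neg_of_add_eq_zero_left h.symm

theorem phi_star (x : X.R) : X.phi (star x) = -X.phi x := by
  have h := X.phi_herm (x + star x) (by rw [star_add, star_star, add_comm])
  rw [phi_add] at h
  exact eq_neg_of_add_eq_zero_right h

theorem star_rho_eq (u : X.D) : star (X.rho u) = -X.rho u - star (X.pi u) * X.pi u := by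
  have h := X.rho_add u (-u)
  rw [add_neg_cancel, rho_zero, ← star_rho, pi_neg] at h
  have h2 : star (X.rho u) = -(X.rho u - star (X.pi u) * -X.pi u) :=
    (neg_eq_of_add_eq_zero_right h.symm).symm
  rw [h2]; simp only [mul_neg]; abel

/-- The action `u · (1 + x)` of an element `1 + x` of the unital ring `R ⋊ ℤ`; its value is forced
by the rules `u · 1 = u` and `u · (x + y) = u · x + φ(ȳ ρ(u) x) + u · y`. -/
def act1 (u : X.D) (x : X.R) : X.D := u + X.phi (star x * X.rho u) + X.act u x

theorem phi_left (x : X.R) (u v : X.D) : u + (X.phi x + v) = X.phi x + (u + v) := by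
  rw [← add_assoc, add_phi, add_assoc]

@[simp] theorem act1_zero (u : X.D) : X.act1 u 0 = u := by simp [act1]

@[simp] theorem zero_act1 (x : X.R) : X.act1 0 x = 0 := by simp [act1]

theorem phi_phi_left (x y : X.R) (u : X.D) : X.phi x + (X.phi y + u) = X.phi (x + y) + u := by
  rw [phi_add, add_assoc]

theorem add_act1 (u v : X.D) (x : X.R) : X.act1 (u + v) x = X.act1 u x + X.act1 v x := by
  unfold act1
  have h (w : X.D) : X.act u x + (v + w) =
      X.phi (-(star x * (star (X.pi u) * X.pi v))) + (v + (X.act u x + w)) := by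
    rw [← add_assoc, X.add_swap (X.act u x) v, add_assoc, add_assoc, X.phi_left _ (X.act u x),
      X.phi_left _ v]
    simp [mul_assoc]
  rw [add_act, rho_add]
  simp only [add_assoc, fun z => X.phi_left z u, fun z => X.phi_left z v,
    fun z => X.phi_left z (X.act u x), h, phi_phi_left]
  congr 2
  simp only [mul_add, mul_sub]
  abel

theorem phi_act1 (z y : X.R) : X.act1 (X.phi z) y =
    X.phi (z + star y * z + z * y + star y * z * y) := by
  unfold act1
  have h : X.phi (star y * star z) = -X.phi (z * y) := by
    rw [← phi_star, star_mul]
  rw [rho_phi, mul_sub, sub_eq_add_neg, phi_add, phi_neg, h, neg_neg, ← phi_conj, phi_add, phi_add,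
    phi_add]
  simp only [add_assoc]

theorem act_act1 (u : X.D) (x y : X.R) : X.act1 (X.act u x) y = X.act u (x + x * y) := by
  unfold act1
  rw [act_add, rho_act, act_act, star_mul]
  simp only [mul_assoc]

theorem act1_act (u : X.D) (x y : X.R) : X.act (X.act1 u x) y = X.act u (y + x * y) := by
  unfold act1
  rw [act_add, add_act, add_act, act_act, ← phi_conj, star_mul]
  simp only [mul_assoc]

theorem act1_act1 (u : X.D) (x y : X.R) :
    X.act1 (X.act1 u x) y = X.act1 u (x + y + x * y) := by
  have h0 : X.act1 u x = u + X.phi (star x * X.rho u) + X.act u x := rfl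
  have h : X.act1 (X.act1 u x) y = X.act1 u y + X.act1 (X.phi (star x * X.rho u)) y
      + X.act1 (X.act u x) y := by
    rw [h0, add_act1, add_act1]
  have h' : X.act1 u y = u + X.phi (star y * X.rho u) + X.act u y := rfl
  rw [h, act_act1, phi_act1, h']
  have e : x + y + x * y = y + (x + x * y) := by abel
  rw [e, act1, X.act_add u y]
  simp only [add_assoc, fun z => X.phi_left z u, fun z => X.phi_left z (X.act u y), phi_phi_left]
  congr 2
  simp only [star_add, star_mul, add_mul, mul_assoc]
  abel

@[simp] theorem neg_act1 (u : X.D) (x : X.R) : X.act1 (-u) x = -X.act1 u x := by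
  have h := X.add_act1 (-u) u x
  rw [neg_add_cancel, zero_act1] at h
  exact eq_neg_of_add_eq_zero_left h.symm

@[simp] theorem pi_act1 (u : X.D) (x : X.R) : X.pi (X.act1 u x) = X.pi u + X.pi u * x := by
  simp [act1]

theorem rho_act1 (u : X.D) (x : X.R) : X.rho (X.act1 u x) =
    X.rho u + star x * X.rho u + X.rho u * x + star x * X.rho u * x := by
  simp only [act1, rho_add, rho_phi, rho_act, pi_add, pi_phi, pi_act, add_zero, mul_zero, sub_zero,
    star_mul, star_star, star_rho_eq]
  simp only [sub_mul, neg_mul, mul_assoc]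
  abel

end OddFormRing

/-! ### Unitary groups -/

/-- The unitary group `U(R, Δ)`: pairs `g = (β, γ) ∈ R × Δ` such that `α = β + 1` satisfies
`α⁻¹ = ᾱ`, `π(γ) = β` and `ρ(γ) = β̄`. -/
@[ext] structure U (X : OddFormRing.{u, v}) where
  beta : X.R
  gamma : X.D
  mul_star : beta * star beta + beta + star beta = 0
  star_mul : star beta * beta + beta + star beta = 0
  pi_gamma : X.pi gamma = beta
  rho_gamma : X.rho gamma = star beta

namespace U

variable {X : OddFormRing.{u, v}}

attribute [simp] pi_gamma rho_gamma

theorem star_mul_eq (g : U X) : star g.beta * g.beta = -g.beta - star g.beta := by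
  have h := g.star_mul
  rw [add_assoc] at h
  rw [eq_neg_of_add_eq_zero_left h]; abel

theorem mul_star_eq (g : U X) : g.beta * star g.beta = -g.beta - star g.beta := by
  have h := g.mul_star
  rw [add_assoc] at h
  rw [eq_neg_of_add_eq_zero_left h]; abel

theorem star_mul_left (g : U X) (x : X.R) :
    star g.beta * (g.beta * x) = -(g.beta * x) - star g.beta * x := by
  rw [← mul_assoc, star_mul_eq, sub_mul, neg_mul]

theorem mul_star_left (g : U X) (x : X.R) :
    g.beta * (star g.beta * x) = -(g.beta * x) - star g.beta * x := by
  rw [← mul_assoc, mul_star_eq, sub_mul, neg_mul]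

/-- `α(gh) = α(g) α(h)` and `γ(gh) = γ(g) · α(h) + γ(h)`. -/
instance : Mul (U X) where
  mul g h :=
    { beta := g.beta * h.beta + g.beta + h.beta
      gamma := X.act1 g.gamma h.beta + h.gamma
      mul_star := by
        simp only [star_add, StarMul.star_mul, mul_add, add_mul, mul_assoc, mul_star_left, mul_sub,
          mul_neg, mul_star_eq]
        abel
      star_mul := by
        simp only [star_add, StarMul.star_mul, mul_add, add_mul, mul_assoc, star_mul_left, mul_sub,
          mul_neg, star_mul_eq]
        abel
      pi_gamma := by simp; abel
      rho_gamma := by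
        simp only [OddFormRing.rho_add, OddFormRing.rho_act1, OddFormRing.pi_act1, pi_gamma,
          rho_gamma, star_add, StarMul.star_mul, mul_assoc, add_mul]
        abel }

instance : One (U X) where
  one := ⟨0, 0, by simp, by simp, by simp, by simp⟩

instance : Inv (U X) where
  inv g :=
    { beta := star g.beta
      gamma := -X.act1 g.gamma (star g.beta)
      mul_star := by rw [star_star, star_mul_eq]; abel
      star_mul := by rw [star_star, mul_star_eq]; abel
      pi_gamma := by simp [mul_star_eq]
      rho_gamma := by
        rw [← OddFormRing.star_rho, OddFormRing.rho_act1]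
        simp only [rho_gamma, star_add, StarMul.star_mul, star_star, mul_star_eq]
        simp [mul_sub, mul_star_eq] }

@[simp] theorem beta_mul (g h : U X) :
    (g * h).beta = g.beta * h.beta + g.beta + h.beta := rfl
@[simp] theorem gamma_mul (g h : U X) :
    (g * h).gamma = X.act1 g.gamma h.beta + h.gamma := rfl
@[simp] theorem beta_one : (1 : U X).beta = 0 := rfl
@[simp] theorem gamma_one : (1 : U X).gamma = 0 := rfl
@[simp] theorem beta_inv (g : U X) : (g⁻¹).beta = star g.beta := rfl
@[simp] theorem gamma_inv (g : U X) : (g⁻¹).gamma = -X.act1 g.gamma (star g.beta) := rfl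

instance : Group (U X) :=
  Group.ofLeftAxioms
    (fun g h k => by
      ext
      · simp only [beta_mul, mul_add, add_mul, mul_assoc]; abel
      · simp only [gamma_mul, beta_mul, OddFormRing.add_act1, OddFormRing.act1_act1, add_assoc]
        congr 2; abel)
    (fun g => by ext <;> simp)
    (fun g => by
      ext
      · simp [star_mul_eq]
      · have e : star g.beta + g.beta + star g.beta * g.beta = 0 := by rw [star_mul_eq]; abel
        simp [OddFormRing.act1_act1, e])

end U

/-! ### Morphisms, projective unitary groups -/

/-- Morphisms of odd form rings. -/
structure OddFormHom (X : OddFormRing.{u, v}) (Y : OddFormRing.{u₁, v₁}) where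
  onR : X.R →ₙ+* Y.R
  onD : X.D →+ Y.D
  map_star : ∀ x, onR (star x) = star (onR x)
  map_act : ∀ u x, onD (X.act u x) = Y.act (onD u) (onR x)
  map_phi : ∀ x, onD (X.phi x) = Y.phi (onR x)
  map_pi : ∀ u, onR (X.pi u) = Y.pi (onD u)
  map_rho : ∀ u, onR (X.rho u) = Y.rho (onD u)

namespace OddFormHom

variable {X : OddFormRing.{u, v}} {Y : OddFormRing.{u₁, v₁}} {Z : OddFormRing.{u₂, v₂}}

@[ext] theorem ext {f g : OddFormHom X Y} (h : ∀ x, f.onR x = g.onR x)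
    (hD : ∀ u, f.onD u = g.onD u) : f = g := by
  cases f; cases g
  congr
  · exact NonUnitalRingHom.ext h
  · exact AddMonoidHom.ext hD

/-- A morphism is an embedding if it is injective on both components. -/
def Injective (f : OddFormHom X Y) : Prop :=
  Function.Injective f.onR ∧ Function.Injective f.onD

def comp (f : OddFormHom Y Z) (g : OddFormHom X Y) : OddFormHom X Z where
  onR := f.onR.comp g.onR
  onD := f.onD.comp g.onD
  map_star := by simp [f.map_star, g.map_star]
  map_act := by simp [f.map_act, g.map_act]
  map_phi := by simp [f.map_phi, g.map_phi]
  map_pi := by simp [f.map_pi, g.map_pi]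
  map_rho := by simp [f.map_rho, g.map_rho]

@[simp] theorem comp_onR (f : OddFormHom Y Z) (g : OddFormHom X Y) (x : X.R) :
    (f.comp g).onR x = f.onR (g.onR x) := rfl
@[simp] theorem comp_onD (f : OddFormHom Y Z) (g : OddFormHom X Y) (x : X.D) :
    (f.comp g).onD x = f.onD (g.onD x) := rfl

instance : Monoid (OddFormHom X X) where
  mul := comp
  one := ⟨NonUnitalRingHom.id _, AddMonoidHom.id _, by simp, by simp, by simp, by simp, by simp⟩
  mul_assoc _ _ _ := rfl
  one_mul _ := rfl
  mul_one _ := rfl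

@[simp] theorem mul_onR (f g : OddFormHom X X) (x : X.R) : (f * g).onR x = f.onR (g.onR x) := rfl
@[simp] theorem mul_onD (f g : OddFormHom X X) (x : X.D) : (f * g).onD x = f.onD (g.onD x) := rfl
@[simp] theorem one_onR (x : X.R) : (1 : OddFormHom X X).onR x = x := rfl
@[simp] theorem one_onD (x : X.D) : (1 : OddFormHom X X).onD x = x := rfl

theorem map_act1 (f : OddFormHom X Y) (u : X.D) (x : X.R) :
    f.onD (X.act1 u x) = Y.act1 (f.onD u) (f.onR x) := by
  simp [OddFormRing.act1, f.map_act, f.map_phi, f.map_star, f.map_rho]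

/-- The homomorphism of unitary groups induced by a morphism. -/
def mapU (f : OddFormHom X Y) : U X →* U Y where
  toFun g :=
    { beta := f.onR g.beta
      gamma := f.onD g.gamma
      mul_star := by
        rw [← f.map_star, ← _root_.map_mul, ← map_add, ← map_add, g.mul_star, map_zero]
      star_mul := by
        rw [← f.map_star, ← _root_.map_mul, ← map_add, ← map_add, g.star_mul, map_zero]
      pi_gamma := by rw [← f.map_pi, g.pi_gamma]
      rho_gamma := by rw [← f.map_rho, g.rho_gamma, f.map_star] }
  map_one' := by ext <;> simp
  map_mul' g h := by
    ext
    · simp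
    · simp [map_act1]

@[simp] theorem mapU_beta (f : OddFormHom X Y) (g : U X) : (f.mapU g).beta = f.onR g.beta := rfl
@[simp] theorem mapU_gamma (f : OddFormHom X Y) (g : U X) : (f.mapU g).gamma = f.onD g.gamma := rfl

end OddFormHom

/-- The projective unitary group `PU(R, Δ)`, i.e. the automorphism group of `(R, Δ)`, realized as
the group of invertible endomorphisms. -/
abbrev PU (X : OddFormRing.{u, v}) := (OddFormHom X X)ˣ

namespace U

variable {X : OddFormRing.{u, v}}

/-- The ring automorphism `x ↦ α(g) x α(g)⁻¹`, where `α(g) = 1 + β(g)` and `α(g)⁻¹ = 1 + β̄(g)`. -/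
def innR (g : U X) : X.R →ₙ+* X.R where
  toFun := fun x => x + g.beta * x + x * star g.beta + g.beta * x * star g.beta
  map_zero' := by simp
  map_add' := fun x y => by simp only [mul_add, add_mul]; abel
  map_mul' := fun x y => by
    simp only [mul_add, add_mul, mul_assoc, star_mul_left, mul_sub, mul_neg]
    abel

/-- The group automorphism `u ↦ (γ(g) · π(u) + u) · α(g)⁻¹`. -/
def innD (g : U X) : X.D →+ X.D where
  toFun := fun u => X.act1 (X.act g.gamma (X.pi u) + u) (star g.beta)
  map_zero' := by simp
  map_add' := fun u v => by
    rw [← OddFormRing.add_act1]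
    congr 1
    rw [OddFormRing.pi_add, OddFormRing.act_add, rho_gamma]
    have h : u + (X.act g.gamma (X.pi v) + v) =
        X.phi (star (X.pi v) * star g.beta * X.pi u) + (X.act g.gamma (X.pi v) + (u + v)) := by
      rw [← add_assoc, X.add_swap u, add_assoc, add_assoc, X.phi_left _ u, X.phi_left]
      congr 1
      rw [neg_mul, OddFormRing.phi_neg, ← OddFormRing.phi_star]
      simp [mul_assoc]
    simp only [add_assoc]
    rw [h, X.phi_left]

theorem innR_apply (g : U X) (x : X.R) :
    g.innR x = x + g.beta * x + x * star g.beta + g.beta * x * star g.beta := rfl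
theorem innD_apply (g : U X) (u : X.D) :
    g.innD u = X.act1 (X.act g.gamma (X.pi u) + u) (star g.beta) := rfl

/-- The endomorphism of `(R, Δ)` given by `g ∈ U(R, Δ)`: it maps `x ∈ R` to `α(g) x α(g)⁻¹` and
`u ∈ Δ` to `(γ(g) · π(u) + u) · α(g)⁻¹`. -/
def innHom (g : U X) : OddFormHom X X where
  onR := g.innR
  onD := g.innD
  map_star x := by
    simp only [innR_apply, star_add, StarMul.star_mul, star_star, mul_assoc]
    abel
  map_act u x := by
    rw [innD_apply, innD_apply, innR_apply]
    rw [OddFormRing.act1_act, OddFormRing.pi_act, ← OddFormRing.act_act, ← OddFormRing.add_act,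
      OddFormRing.act_act1]
    congr 1
    simp only [mul_add, mul_assoc, star_mul_left]
    abel
  map_phi x := by
    simp [innD_apply, innR_apply, OddFormRing.phi_act1]
  map_pi u := by
    simp [innD_apply, innR_apply, add_mul]
    abel
  map_rho u := by
    simp only [innD_apply, innR_apply, OddFormRing.rho_act1, OddFormRing.rho_add,
      OddFormRing.rho_act, rho_gamma, OddFormRing.pi_act, pi_gamma, StarMul.star_mul, star_star,
      mul_assoc, sub_self, zero_add]

@[simp] theorem innHom_onR (g : U X) (x : X.R) :
    g.innHom.onR x = x + g.beta * x + x * star g.beta + g.beta * x * star g.beta := rfl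
@[simp] theorem innHom_onD (g : U X) (u : X.D) :
    g.innHom.onD u = X.act1 (X.act g.gamma (X.pi u) + u) (star g.beta) := rfl

/-- The homomorphism `U(R, Δ) → PU(R, Δ)`. -/
def inn : U X →* PU X :=
  MonoidHom.toHomUnits
    { toFun := innHom
      map_one' := by ext <;> simp
      map_mul' := fun g h => by
        ext x
        · simp only [innHom_onR, OddFormHom.mul_onR, beta_mul, star_add, StarMul.star_mul, mul_add,
            add_mul, mul_assoc]
          abel
        · have e (u : X.D) : X.pi (h.innHom.onD u) = h.innHom.onR (X.pi u) :=
            (h.innHom.map_pi u).symm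
          rw [OddFormHom.mul_onD, innHom_onD g, e]
          have e2 : X.act g.gamma (h.innHom.onR (X.pi x)) =
              X.act1 (X.act g.gamma (X.pi x + h.beta * X.pi x)) (star h.beta) := by
            rw [OddFormRing.act_act1, innHom_onR]
            congr 1
            simp only [add_mul]; abel
          rw [e2, innHom_onD h, ← OddFormRing.add_act1, OddFormRing.act1_act1, innHom_onD,
            gamma_mul, beta_mul, OddFormRing.add_act, OddFormRing.act1_act]
          congr 1
          · simp only [add_assoc]
          · simp only [star_add, StarMul.star_mul]; abel }

@[simp] theorem coe_inn (g : U X) : ((inn g : PU X) : OddFormHom X X) = g.innHom := rfl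

end U

/-- `σ g σ⁻¹ = ᶠg` in `PU(R, Δ)`: the image of `U(R, Δ)` is stable under conjugation. -/
theorem conj_inn {X : OddFormRing.{u, v}} (σ : PU X) (g : U X) :
    σ * U.inn g * σ⁻¹ = U.inn (σ.val.mapU g) := by
  rw [mul_inv_eq_iff_eq_mul]
  apply Units.ext
  ext x
  · simp [OddFormHom.map_star]
  · simp [OddFormHom.map_star, OddFormHom.map_act, OddFormHom.map_act1, OddFormHom.map_pi]

instance {X : OddFormRing.{u, v}} : (U.inn (X := X)).range.Normal where
  conj_mem := by
    rintro _ ⟨g, rfl⟩ σ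
    exact ⟨σ.val.mapU g, (conj_inn σ g).symm⟩

/-- The left action of `U(R, Δ)` on `Hom(S, Θ; R, Δ)`. -/
instance {Y : OddFormRing.{u₁, v₁}} {X : OddFormRing.{u, v}} :
    MulAction (U X) (OddFormHom Y X) where
  smul g f := (U.inn g).val.comp f
  one_smul f := by
    change (U.inn 1).val.comp f = f
    rw [map_one]; rfl
  mul_smul g h f := by
    change (U.inn (g * h)).val.comp f = (U.inn g).val.comp ((U.inn h).val.comp f)
    rw [map_mul]; rfl

/-! ### Subrings, corners, products, ideals, doubles -/

/-- An odd form subring. -/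
structure OddFormSubring (X : OddFormRing.{u, v}) where
  ring : NonUnitalSubring X.R
  grp : AddSubgroup X.D
  star_mem : ∀ {x}, x ∈ ring → star x ∈ ring
  act_mem : ∀ {u x}, u ∈ grp → x ∈ ring → X.act u x ∈ grp
  phi_mem : ∀ {x}, x ∈ ring → X.phi x ∈ grp
  pi_mem : ∀ {u}, u ∈ grp → X.pi u ∈ ring
  rho_mem : ∀ {u}, u ∈ grp → X.rho u ∈ ring

instance {X : OddFormRing.{u, v}} (A : OddFormSubring X) : StarRing A.ring where
  star x := ⟨star x.1, A.star_mem x.2⟩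
  star_involutive x := Subtype.ext (star_star x.1)
  star_mul x y := Subtype.ext (star_mul x.1 y.1)
  star_add x y := Subtype.ext (star_add x.1 y.1)

/-- An odd form subring as an odd form ring. -/
@[reducible] def OddFormSubring.toOddFormRing {X : OddFormRing.{u, v}} (A : OddFormSubring X) :
    OddFormRing.{u, v} where
  R := A.ring
  D := A.grp
  act u x := ⟨X.act u.1 x.1, A.act_mem u.2 x.2⟩
  phi x := ⟨X.phi x.1, A.phi_mem x.2⟩
  pi u := ⟨X.pi u.1, A.pi_mem u.2⟩
  rho u := ⟨X.rho u.1, A.rho_mem u.2⟩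
  add_act u v x := Subtype.ext (X.add_act u.1 v.1 x.1)
  act_act u x y := Subtype.ext (X.act_act u.1 x.1 y.1)
  pi_add u v := Subtype.ext (X.pi_add u.1 v.1)
  pi_act u x := Subtype.ext (X.pi_act u.1 x.1)
  phi_add x y := Subtype.ext (X.phi_add x.1 y.1)
  phi_conj x y := Subtype.ext (X.phi_conj x.1 y.1)
  phi_herm x h := Subtype.ext (X.phi_herm x.1 (congrArg Subtype.val h))
  add_phi u x := Subtype.ext (X.add_phi u.1 x.1)
  add_swap u v := Subtype.ext (X.add_swap u.1 v.1)
  rho_add u v := Subtype.ext (X.rho_add u.1 v.1)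
  star_rho u := Subtype.ext (X.star_rho u.1)
  rho_act u x := Subtype.ext (X.rho_act u.1 x.1)
  pi_phi x := Subtype.ext (X.pi_phi x.1)
  rho_phi x := Subtype.ext (X.rho_phi x.1)
  act_add u x y := Subtype.ext (X.act_add u.1 x.1 y.1)

theorem proj_mul {X : OddFormRing.{u, v}} {e : X.R} (he : IsStarProjection e) : e * e = e :=
  he.isIdempotentElem

theorem proj_star {X : OddFormRing.{u, v}} {e : X.R} (he : IsStarProjection e) : star e = e :=
  he.isSelfAdjoint

/-- The corner `(R_{e'}, Δ_{e'}^{e'})` of `(R, Δ)`, where `e` is a hermitian idempotent and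
`e' = 1 - e ∈ R ⋊ ℤ`. Here `R_{e'} = e' R e'` consists of all `x ∈ R` with `e x = x e = 0`, the
group `Δ_{e'} = Δ · e'` consists of all `u` with `u · (1 - e) = u`, and
`Δ_{e'}^{e'} = {u ∈ Δ_{e'} | π(u) ∈ R_{e'}}`. -/
def cornerSub (X : OddFormRing.{u, v}) (e : X.R) (he : IsStarProjection e) : OddFormSubring X where
  ring :=
    { carrier := {x | e * x = 0 ∧ x * e = 0}
      zero_mem' := by simp
      add_mem' := fun ⟨h1, h2⟩ ⟨h3, h4⟩ => by
        constructor <;> simp only [mul_add, add_mul, h1, h2, h3, h4, add_zero]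
      neg_mem' := fun ⟨h1, h2⟩ => by
        constructor <;> simp only [mul_neg, neg_mul, h1, h2, neg_zero]
      mul_mem' := fun {a b} ⟨h1, h2⟩ ⟨h3, h4⟩ => by
        constructor
        · rw [← mul_assoc, h1, zero_mul]
        · rw [mul_assoc, h4, mul_zero] }
  grp :=
    { carrier := {u | X.act1 u (-e) = u ∧ (e * X.pi u = 0 ∧ X.pi u * e = 0)}
      zero_mem' := by simp
      add_mem' := fun ⟨h1, h2, h3⟩ ⟨h4, h5, h6⟩ => by
        refine ⟨?_, ?_, ?_⟩
        · rw [OddFormRing.add_act1, h1, h4]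
        · rw [X.pi_add, mul_add, h2, h5, add_zero]
        · rw [X.pi_add, add_mul, h3, h6, add_zero]
      neg_mem' := fun ⟨h1, h2, h3⟩ => by
        refine ⟨?_, ?_, ?_⟩
        · rw [OddFormRing.neg_act1, h1]
        · rw [X.pi_neg, mul_neg, h2, neg_zero]
        · rw [X.pi_neg, neg_mul, h3, neg_zero] }
  star_mem := fun {x} ⟨h1, h2⟩ => by
    constructor
    · rw [← proj_star he, ← star_mul, h2, star_zero]
    · rw [← proj_star he, ← star_mul, h1, star_zero]
  act_mem := fun {u x} ⟨h1, h2, _⟩ ⟨_, h5⟩ => by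
    refine ⟨?_, ?_, ?_⟩
    · rw [OddFormRing.act_act1, mul_neg, h5, neg_zero, add_zero]
    · rw [X.pi_act, ← mul_assoc, h2, zero_mul]
    · rw [X.pi_act, mul_assoc, h5, mul_zero]
  phi_mem := fun {x} ⟨h1, h2⟩ => by
    refine ⟨?_, ?_, ?_⟩
    · rw [OddFormRing.phi_act1, star_neg, proj_star he]
      congr 1
      simp [h1, h2]
    · simp
    · simp
  pi_mem := fun h => h.2
  rho_mem := fun {u} ⟨h1, _, _⟩ => by
    have h := X.rho_act1 u (-e)
    rw [h1, star_neg, proj_star he] at h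
    constructor
    · rw [h]
      simp only [neg_mul, mul_neg, mul_add, ← mul_assoc, proj_mul he]
      abel
    · rw [h]
      simp only [neg_mul, mul_neg, add_mul, mul_assoc, proj_mul he]
      abel

abbrev Corner (X : OddFormRing.{u, v}) (e : X.R) (he : IsStarProjection e) : OddFormRing.{u, v} :=
  (cornerSub X e he).toOddFormRing

/-- The product of two odd form rings. -/
@[reducible] def prod (X : OddFormRing.{u, v}) (Y : OddFormRing.{u₁, v₁}) :
    OddFormRing.{max u u₁, max v v₁} where
  R := X.R × Y.R
  D := X.D × Y.D
  act u x := (X.act u.1 x.1, Y.act u.2 x.2)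
  phi x := (X.phi x.1, Y.phi x.2)
  pi u := (X.pi u.1, Y.pi u.2)
  rho u := (X.rho u.1, Y.rho u.2)
  add_act _ _ _ := Prod.ext (X.add_act _ _ _) (Y.add_act _ _ _)
  act_act _ _ _ := Prod.ext (X.act_act _ _ _) (Y.act_act _ _ _)
  pi_add _ _ := Prod.ext (X.pi_add _ _) (Y.pi_add _ _)
  pi_act _ _ := Prod.ext (X.pi_act _ _) (Y.pi_act _ _)
  phi_add _ _ := Prod.ext (X.phi_add _ _) (Y.phi_add _ _)
  phi_conj _ _ := Prod.ext (X.phi_conj _ _) (Y.phi_conj _ _)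
  phi_herm _ h := Prod.ext (X.phi_herm _ (congrArg Prod.fst h)) (Y.phi_herm _ (congrArg Prod.snd h))
  add_phi _ _ := Prod.ext (X.add_phi _ _) (Y.add_phi _ _)
  add_swap _ _ := Prod.ext (X.add_swap _ _) (Y.add_swap _ _)
  rho_add _ _ := Prod.ext (X.rho_add _ _) (Y.rho_add _ _)
  star_rho _ := Prod.ext (X.star_rho _) (Y.star_rho _)
  rho_act _ _ := Prod.ext (X.rho_act _ _) (Y.rho_act _ _)
  pi_phi _ := Prod.ext (X.pi_phi _) (Y.pi_phi _)
  rho_phi _ := Prod.ext (X.rho_phi _) (Y.rho_phi _)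
  act_add _ _ _ := Prod.ext (X.act_add _ _ _) (Y.act_add _ _ _)

/-- An odd form ideal `(I, Γ)` of `(R, Δ)`. -/
structure OddFormIdeal (X : OddFormRing.{u, v}) where
  ideal : TwoSidedIdeal X.R
  grp : AddSubgroup X.D
  normal : grp.Normal
  star_mem : ∀ {x}, x ∈ ideal → star x ∈ ideal
  act_mem : ∀ {u}, u ∈ grp → ∀ x, X.act u x ∈ grp
  act_mem_of_mem : ∀ u {x}, x ∈ ideal → X.act u x ∈ grp
  phi_mem : ∀ {x}, x ∈ ideal → X.phi x ∈ grp
  pi_mem : ∀ {u}, u ∈ grp → X.pi u ∈ ideal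
  rho_mem : ∀ {u}, u ∈ grp → X.rho u ∈ ideal

namespace OddFormIdeal

variable {X : OddFormRing.{u, v}} (I : OddFormIdeal X)

theorem act1_mem {u : X.D} (hu : u ∈ I.grp) (x : X.R) : X.act1 u x ∈ I.grp :=
  I.grp.add_mem (I.grp.add_mem hu (I.phi_mem (I.ideal.mul_mem_left _ _ (I.rho_mem hu))))
    (I.act_mem hu x)

/-- The ideal `(I ∩ A, Γ ∩ B)` of an odd form subring `(A, B)`. For the corner defined by `e'` this
is the ideal `(I_{e'}, Γ_{e'}^{e'})`. -/
def restrict (A : OddFormSubring X) : OddFormIdeal A.toOddFormRing where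
  ideal := TwoSidedIdeal.mk' {x | (x : X.R) ∈ I.ideal} I.ideal.zero_mem
    (fun h h' => I.ideal.add_mem h h') (fun h => I.ideal.neg_mem h)
    (fun {x y} h => I.ideal.mul_mem_left x.1 y.1 h) (fun {x y} h => I.ideal.mul_mem_right x.1 y.1 h)
  grp := I.grp.comap A.grp.subtype
  normal := I.normal.comap _
  star_mem h := by
    rw [TwoSidedIdeal.mem_mk'] at h ⊢
    exact I.star_mem h
  act_mem h x := I.act_mem h x.1
  act_mem_of_mem u _ h := by
    rw [TwoSidedIdeal.mem_mk'] at h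
    exact I.act_mem_of_mem u.1 h
  phi_mem h := by
    rw [TwoSidedIdeal.mem_mk'] at h
    exact I.phi_mem h
  pi_mem h := by
    rw [TwoSidedIdeal.mem_mk']
    exact I.pi_mem h
  rho_mem h := by
    rw [TwoSidedIdeal.mem_mk']
    exact I.rho_mem h

/-- The subgroup `U(I, Γ)` of `U(R, Δ)`. -/
def unitary : Subgroup (U X) where
  carrier := {g | g.beta ∈ I.ideal ∧ g.gamma ∈ I.grp}
  one_mem' := ⟨I.ideal.zero_mem, I.grp.zero_mem⟩
  mul_mem' := fun hg hh =>
    ⟨I.ideal.add_mem (I.ideal.add_mem (I.ideal.mul_mem_left _ _ hh.1) hg.1) hh.1,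
      I.grp.add_mem (I.act1_mem hg.2 _) hh.2⟩
  inv_mem' := fun hg => ⟨I.star_mem hg.1, I.grp.neg_mem (I.act1_mem hg.2 _)⟩

/-- The relative projective unitary group `PU(R, Δ; I, Γ)`. -/
def pu : Subgroup (PU X) where
  carrier := {σ | (∀ x, σ.val.onR x - x ∈ I.ideal) ∧ ∀ u, σ.val.onD u - u ∈ I.grp}
  one_mem' := by
    constructor
    · intro x; simp
    · intro x; simp
  mul_mem' := fun {σ τ} hσ hτ => by
    constructor
    · intro x
      have h := I.ideal.add_mem (hσ.1 (τ.val.onR x)) (hτ.1 x)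
      simpa using h
    · intro x
      have h := I.grp.add_mem (hσ.2 (τ.val.onD x)) (hτ.2 x)
      simpa using h
  inv_mem' := fun {σ} hσ => by
    have e : σ.val * σ⁻¹.val = 1 := by simp
    constructor
    · intro x
      have h := I.ideal.neg_mem (hσ.1 (σ⁻¹.val.onR x))
      rw [← OddFormHom.mul_onR, e] at h
      simpa using h
    · intro x
      have h := I.grp.neg_mem (hσ.2 (σ⁻¹.val.onD x))
      rw [← OddFormHom.mul_onD, e] at h
      simpa using h

theorem inn_mem {g : U X} (hg : g ∈ I.unitary) : U.inn g ∈ I.pu := by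
  have hn := I.normal
  constructor
  · intro x
    rw [U.coe_inn, U.innHom_onR]
    have h := I.ideal.add_mem (I.ideal.add_mem (I.ideal.mul_mem_right _ x hg.1)
      (I.ideal.mul_mem_left x _ (I.star_mem hg.1)))
      (I.ideal.mul_mem_right _ (star g.beta) (I.ideal.mul_mem_right _ x hg.1))
    have e : x + g.beta * x + x * star g.beta + g.beta * x * star g.beta - x =
      g.beta * x + x * star g.beta + g.beta * x * star g.beta := by abel
    rw [e]; exact h
  · intro u
    rw [U.coe_inn, U.innHom_onD, OddFormRing.add_act1, sub_eq_add_neg, add_assoc]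
    refine I.grp.add_mem (I.act1_mem (I.act_mem hg.2 _) _) ?_
    unfold OddFormRing.act1
    rw [add_assoc u, add_assoc u, add_assoc, ← add_assoc, ← add_assoc, add_assoc u]
    refine hn.conj_mem _ (I.grp.add_mem (I.phi_mem ?_) (I.act_mem_of_mem _ (I.star_mem hg.1))) u
    rw [star_star]
    exact I.ideal.mul_mem_right _ _ hg.1

/-- The double `(R ×_I R, Δ ×_Γ Δ)`, which is canonically isomorphic to `(I ⋊ R, Γ ⋊ Δ)`. -/
def doubleSub : OddFormSubring (prod X X) where
  ring :=
    { carrier := {x | x.1 - x.2 ∈ I.ideal}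
      zero_mem' := by simp
      add_mem' := fun {x y} hx hy => by
        have h := I.ideal.add_mem hx hy
        have e : (x + y).1 - (x + y).2 = x.1 - x.2 + (y.1 - y.2) := by
          simp only [Prod.fst_add, Prod.snd_add]; abel
        exact (congrArg (· ∈ I.ideal) e).mpr h
      neg_mem' := fun {x} hx => by
        have h := I.ideal.neg_mem hx
        have e : (-x).1 - (-x).2 = -(x.1 - x.2) := by
          simp only [Prod.fst_neg, Prod.snd_neg]; abel
        exact (congrArg (· ∈ I.ideal) e).mpr h
      mul_mem' := fun {x y} hx hy => by
        have h := I.ideal.add_mem (I.ideal.mul_mem_right _ y.1 hx) (I.ideal.mul_mem_left x.2 _ hy)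
        have e : (x * y).1 - (x * y).2 = (x.1 - x.2) * y.1 + x.2 * (y.1 - y.2) := by
          simp only [Prod.fst_mul, Prod.snd_mul, mul_sub, sub_mul]; abel
        exact (congrArg (· ∈ I.ideal) e).mpr h }
  grp :=
    { carrier := {u | u.1 - u.2 ∈ I.grp}
      zero_mem' := by simp
      add_mem' := fun {u v} hu hv => by
        have hn := I.normal
        have h := I.grp.add_mem (hn.conj_mem _ hv u.1) hu
        have e : (u + v).1 - (u + v).2 = u.1 + (v.1 - v.2) + -u.1 + (u.1 - u.2) := by
          simp only [Prod.fst_add, Prod.snd_add, sub_eq_add_neg, neg_add_rev, add_assoc,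
            neg_add_cancel_left]
        exact (congrArg (· ∈ I.grp) e).mpr h
      neg_mem' := fun {u} hu => by
        have hn := I.normal
        have h := hn.conj_mem _ (I.grp.neg_mem hu) (-u.1)
        have e : (-u).1 - (-u).2 = -u.1 + -(u.1 - u.2) + - -u.1 := by
          simp only [Prod.fst_neg, Prod.snd_neg, sub_eq_add_neg, neg_add_rev, add_assoc, neg_neg,
            neg_add_cancel, add_zero]
        exact (congrArg (· ∈ I.grp) e).mpr h }
  star_mem := fun {x} hx => by
    have h := I.star_mem hx
    rw [star_sub] at h
    exact h
  act_mem := fun {u x} hu hx => by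
    have hn := I.normal
    change X.act u.1 x.1 - X.act u.2 x.2 ∈ I.grp
    have e1 : u.1 = (u.1 - u.2) + u.2 := by simp
    have e2 : x.1 = (x.1 - x.2) + x.2 := by simp
    rw [e1, OddFormRing.add_act, e2, X.act_add u.2, sub_eq_add_neg]
    simp only [add_assoc, add_neg_cancel, add_zero]
    exact I.grp.add_mem (I.act_mem hu _) (I.grp.add_mem (I.act_mem_of_mem _ hx)
      (I.phi_mem (I.ideal.mul_mem_left _ _ hx)))
  phi_mem := fun {x} hx => by
    have h := I.phi_mem hx
    rw [sub_eq_add_neg, X.phi_add, X.phi_neg, ← sub_eq_add_neg] at h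
    exact h
  pi_mem := fun {u} hu => by
    have h := I.pi_mem hu
    rw [sub_eq_add_neg, X.pi_add, X.pi_neg, ← sub_eq_add_neg] at h
    exact h
  rho_mem := fun {u} hu => by
    change X.rho u.1 - X.rho u.2 ∈ I.ideal
    have e1 : u.1 = (u.1 - u.2) + u.2 := by simp
    rw [e1, X.rho_add, add_sub_cancel_right]
    refine I.ideal.sub_mem (I.rho_mem hu) ?_
    exact I.ideal.mul_mem_right _ _ (I.star_mem (I.pi_mem hu))

abbrev Double : OddFormRing.{u, v} := I.doubleSub.toOddFormRing

/-- The diagonal embedding `d` of `(R, Δ)` into the double. -/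
def diag : OddFormHom X I.Double where
  onR :=
    { toFun := fun x => ⟨(x, x), by
        change x - x ∈ I.ideal
        rw [sub_self]; exact I.ideal.zero_mem⟩
      map_zero' := rfl
      map_add' := fun _ _ => rfl
      map_mul' := fun _ _ => rfl }
  onD :=
    { toFun := fun u => ⟨(u, u), by
        change u - u ∈ I.grp
        rw [sub_self]; exact I.grp.zero_mem⟩
      map_zero' := rfl
      map_add' := fun _ _ => rfl }
  map_star _ := rfl
  map_act _ _ := rfl
  map_phi _ := rfl
  map_pi _ := rfl
  map_rho _ := rfl

/-- The embedding `PU(R, Δ; I, Γ) → PU(R ×_I R, Δ ×_Γ Δ)`, `σ ↦ σ × id`. -/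
def puDouble : I.pu →* PU I.Double :=
  MonoidHom.toHomUnits
    { toFun := fun σ =>
        { onR :=
            { toFun := fun x => ⟨(σ.1.val.onR x.1.1, x.1.2), by
                have h := I.ideal.add_mem (σ.2.1 x.1.1) x.2
                rw [sub_add_sub_cancel] at h
                exact h⟩
              map_zero' := Subtype.ext (Prod.ext (map_zero _) rfl)
              map_add' := fun _ _ => Subtype.ext (Prod.ext (map_add _ _ _) rfl)
              map_mul' := fun _ _ => Subtype.ext (Prod.ext (map_mul _ _ _) rfl) }
          onD :=
            { toFun := fun u => ⟨(σ.1.val.onD u.1.1, u.1.2), by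
                have h := I.grp.add_mem (σ.2.2 u.1.1) u.2
                rw [sub_add_sub_cancel] at h
                exact h⟩
              map_zero' := Subtype.ext (Prod.ext (map_zero _) rfl)
              map_add' := fun _ _ => Subtype.ext (Prod.ext (map_add _ _ _) rfl) }
          map_star := fun _ => Subtype.ext (Prod.ext (σ.1.val.map_star _) rfl)
          map_act := fun _ _ => Subtype.ext (Prod.ext (σ.1.val.map_act _ _) rfl)
          map_phi := fun _ => Subtype.ext (Prod.ext (σ.1.val.map_phi _) rfl)
          map_pi := fun _ => Subtype.ext (Prod.ext (σ.1.val.map_pi _) rfl)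
          map_rho := fun _ => Subtype.ext (Prod.ext (σ.1.val.map_rho _) rfl) }
      map_one' := rfl
      map_mul' := fun _ _ => rfl }

/-- For a group `P ≤ PU(I ⋊ R, Γ ⋊ Δ)` this is the group `P ∩ PU(R, Δ; I, Γ)`, where
`PU(R, Δ; I, Γ)` is embedded into `PU(I ⋊ R, Γ ⋊ Δ)`. -/
def relative (P : Subgroup (PU I.Double)) : Subgroup (PU X) :=
  (P.comap I.puDouble).map I.pu.subtype

end OddFormIdeal

/-! ### Isometries between hermitian idempotents -/

/-- The set `U(e, e'; R, Δ)` for hermitian idempotents `e`, `e'`: pairs `(α, γ)` such that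
`α ∈ e R e'`, `ᾱ α = e'`, `α ᾱ = e`, `γ ∈ Δ · e'`, `π(γ) = β`, and `ρ(γ) = β̄ e'`, where
`β = α - e'`. -/
structure Isometry (X : OddFormRing.{u, v}) (e e' : X.R) where
  alpha : X.R
  gamma : X.D
  left_mul : e * alpha = alpha
  mul_right : alpha * e' = alpha
  star_mul : star alpha * alpha = e'
  mul_star : alpha * star alpha = e
  gamma_act : X.act gamma e' = gamma
  pi_gamma : X.pi gamma = alpha - e'
  rho_gamma : X.rho gamma = star (alpha - e') * e'

namespace Isometry

variable {X : OddFormRing.{u, v}} {Y : OddFormRing.{u₁, v₁}}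

theorem star_right {e e' : X.R} (g : Isometry X e e') : star e' = e' := by
  have h := congrArg star g.star_mul
  rw [StarMul.star_mul, star_star, g.star_mul] at h
  exact h.symm

theorem star_left {e e' : X.R} (g : Isometry X e e') : star e = e := by
  have h := congrArg star g.mul_star
  rw [StarMul.star_mul, star_star, g.mul_star] at h
  exact h.symm

theorem mul_self_right {e e' : X.R} (g : Isometry X e e') : e' * e' = e' := by
  have h := congrArg (star g.alpha * ·) g.mul_right
  simp only [← mul_assoc] at h
  rwa [g.star_mul] at h

theorem mul_self_left {e e' : X.R} (g : Isometry X e e') : e * e = e := by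
  have h := congrArg (· * star g.alpha) g.left_mul
  simp only [mul_assoc] at h
  rwa [g.mul_star] at h

theorem right_mul_star {e e' : X.R} (g : Isometry X e e') : e' * star g.alpha = star g.alpha := by
  have h := congrArg star g.mul_right
  rwa [StarMul.star_mul, g.star_right] at h

theorem star_mul_left {e e' : X.R} (g : Isometry X e e') : star g.alpha * e = star g.alpha := by
  have h := congrArg star g.left_mul
  rwa [StarMul.star_mul, g.star_left] at h

/-- The image of an isometry under a morphism. -/
def map (f : OddFormHom X Y) {e e' : X.R} (g : Isometry X e e') :
    Isometry Y (f.onR e) (f.onR e') where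
  alpha := f.onR g.alpha
  gamma := f.onD g.gamma
  left_mul := by rw [← map_mul, g.left_mul]
  mul_right := by rw [← map_mul, g.mul_right]
  star_mul := by rw [← f.map_star, ← map_mul, g.star_mul]
  mul_star := by rw [← f.map_star, ← map_mul, g.mul_star]
  gamma_act := by rw [← f.map_act, g.gamma_act]
  pi_gamma := by rw [← f.map_pi, g.pi_gamma, map_sub]
  rho_gamma := by rw [← f.map_rho, g.rho_gamma, map_mul, f.map_star, map_sub]

/-- The identity of `e`. -/
def refl {e : X.R} (he : IsStarProjection e) : Isometry X e e where
  alpha := e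
  gamma := 0
  left_mul := proj_mul he
  mul_right := proj_mul he
  star_mul := by rw [proj_star he, proj_mul he]
  mul_star := by rw [proj_star he, proj_mul he]
  gamma_act := by simp
  pi_gamma := by simp
  rho_gamma := by simp

/-- The multiplication `α(gh) = α(g) α(h)`, `γ(gh) = γ(g) · α(h) + γ(h)`. -/
def trans {e e' e'' : X.R} (g : Isometry X e e') (h : Isometry X e' e'') : Isometry X e e'' where
  alpha := g.alpha * h.alpha
  gamma := X.act g.gamma h.alpha + h.gamma
  left_mul := by rw [← mul_assoc, g.left_mul]
  mul_right := by rw [mul_assoc, h.mul_right]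
  star_mul := by
    rw [StarMul.star_mul, mul_assoc, ← mul_assoc (star g.alpha), g.star_mul, h.left_mul, h.star_mul]
  mul_star := by
    rw [StarMul.star_mul, mul_assoc, ← mul_assoc h.alpha, h.mul_star, ← mul_assoc, g.mul_right,
      g.mul_star]
  gamma_act := by rw [X.add_act, X.act_act, h.mul_right, h.gamma_act]
  pi_gamma := by
    rw [X.pi_add, X.pi_act, g.pi_gamma, h.pi_gamma, sub_mul, h.left_mul]; abel
  rho_gamma := by
    rw [X.rho_add, X.rho_act, X.pi_act, g.rho_gamma, h.rho_gamma, g.pi_gamma, h.pi_gamma]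
    simp only [star_sub, StarMul.star_mul, g.star_right, h.star_right, mul_sub, sub_mul,
      mul_assoc, h.left_mul, h.star_mul, h.mul_self_right]
    abel

/-- The inverse `α(g⁻¹) = ᾱ(g)`, `γ(g⁻¹) = -γ(g) · ᾱ(g)`. -/
def symm {e e' : X.R} (g : Isometry X e e') : Isometry X e' e where
  alpha := star g.alpha
  gamma := -X.act g.gamma (star g.alpha)
  left_mul := g.right_mul_star
  mul_right := g.star_mul_left
  star_mul := by rw [star_star, g.mul_star]
  mul_star := by rw [star_star, g.star_mul]
  gamma_act := by rw [X.neg_act, X.act_act, g.star_mul_left]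
  pi_gamma := by
    rw [X.pi_neg, X.pi_act, g.pi_gamma, sub_mul, g.mul_star, g.right_mul_star]; abel
  rho_gamma := by
    rw [← X.star_rho, X.rho_act, g.rho_gamma]
    simp only [star_sub, StarMul.star_mul, star_star, g.star_right, g.star_left, mul_sub, sub_mul,
      mul_assoc, g.right_mul_star, g.mul_self_left, g.mul_self_right, g.mul_star]

end Isometry

/-! ### Hyperbolic families -/

/-- A hyperbolic pair `η = (e₋, e₊, q₋, q₊)`. -/
structure HyperbolicPair (X : OddFormRing.{u, v}) where
  em : X.R
  ep : X.R
  qm : X.D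
  qp : X.D
  em_mul_em : em * em = em
  ep_mul_ep : ep * ep = ep
  em_mul_ep : em * ep = 0
  ep_mul_em : ep * em = 0
  star_ep : star ep = em
  pi_qm : X.pi qm = em
  rho_qm : X.rho qm = 0
  qm_act : X.act qm em = qm
  pi_qp : X.pi qp = ep
  rho_qp : X.rho qp = 0
  qp_act : X.act qp ep = qp

namespace HyperbolicPair

variable {X : OddFormRing.{u, v}} (η : HyperbolicPair X)

/-- The hermitian idempotent `e_{|η|} = e₋ + e₊`. -/
def abs : X.R := η.em + η.ep

theorem star_em : star η.em = η.ep := by rw [← η.star_ep, star_star]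

theorem abs_proj : IsStarProjection η.abs where
  isIdempotentElem := by
    change (η.em + η.ep) * (η.em + η.ep) = η.em + η.ep
    simp [mul_add, add_mul, η.em_mul_em, η.ep_mul_ep, η.em_mul_ep, η.ep_mul_em]
  isSelfAdjoint := by
    change star (η.em + η.ep) = η.em + η.ep
    rw [star_add, η.star_em, η.star_ep, add_comm]

theorem em_mul_abs : η.em * η.abs = η.em := by
  simp [abs, mul_add, η.em_mul_em, η.em_mul_ep]
theorem ep_mul_abs : η.ep * η.abs = η.ep := by
  simp [abs, mul_add, η.ep_mul_em, η.ep_mul_ep]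
theorem abs_mul_em : η.abs * η.em = η.em := by
  simp [abs, add_mul, η.em_mul_em, η.ep_mul_em]
theorem abs_mul_ep : η.abs * η.ep = η.ep := by
  simp [abs, add_mul, η.em_mul_ep, η.ep_mul_ep]

/-- Orthogonality of hyperbolic pairs. -/
def Orthogonal (η η' : HyperbolicPair X) : Prop := η.abs * η'.abs = 0 ∧ η'.abs * η.abs = 0

/-- The image of a hyperbolic pair under a morphism. -/
def map {Y : OddFormRing.{u₁, v₁}} (f : OddFormHom X Y) : HyperbolicPair Y where
  em := f.onR η.em
  ep := f.onR η.ep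
  qm := f.onD η.qm
  qp := f.onD η.qp
  em_mul_em := by rw [← map_mul, η.em_mul_em]
  ep_mul_ep := by rw [← map_mul, η.ep_mul_ep]
  em_mul_ep := by rw [← map_mul, η.em_mul_ep, map_zero]
  ep_mul_em := by rw [← map_mul, η.ep_mul_em, map_zero]
  star_ep := by rw [← f.map_star, η.star_ep]
  pi_qm := by rw [← f.map_pi, η.pi_qm]
  rho_qm := by rw [← f.map_rho, η.rho_qm, map_zero]
  qm_act := by rw [← f.map_act, η.qm_act]
  pi_qp := by rw [← f.map_pi, η.pi_qp]
  rho_qp := by rw [← f.map_rho, η.rho_qp, map_zero]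
  qp_act := by rw [← f.map_act, η.qp_act]

/-- A hyperbolic pair that is orthogonal to the hermitian idempotent `e` lies in the corner of
`1 - e`. -/
def toCorner {e : X.R} (he : IsStarProjection e) (h : e * η.abs = 0) (h' : η.abs * e = 0) :
    HyperbolicPair (Corner X e he) :=
  have h1 : e * η.em = 0 := by rw [← η.abs_mul_em, ← mul_assoc, h, zero_mul]
  have h2 : e * η.ep = 0 := by rw [← η.abs_mul_ep, ← mul_assoc, h, zero_mul]
  have h3 : η.em * e = 0 := by rw [← η.em_mul_abs, mul_assoc, h', mul_zero]
  have h4 : η.ep * e = 0 := by rw [← η.ep_mul_abs, mul_assoc, h', mul_zero]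
  { em := ⟨η.em, h1, h3⟩
    ep := ⟨η.ep, h2, h4⟩
    qm := ⟨η.qm, by
      rw [← η.qm_act, X.act_act1, mul_neg, h3, neg_zero, add_zero], by
      rw [η.pi_qm]; exact ⟨h1, h3⟩⟩
    qp := ⟨η.qp, by
      rw [← η.qp_act, X.act_act1, mul_neg, h4, neg_zero, add_zero], by
      rw [η.pi_qp]; exact ⟨h2, h4⟩⟩
    em_mul_em := Subtype.ext η.em_mul_em
    ep_mul_ep := Subtype.ext η.ep_mul_ep
    em_mul_ep := Subtype.ext η.em_mul_ep
    ep_mul_em := Subtype.ext η.ep_mul_em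
    star_ep := Subtype.ext η.star_ep
    pi_qm := Subtype.ext η.pi_qm
    rho_qm := Subtype.ext η.rho_qm
    qm_act := Subtype.ext η.qm_act
    pi_qp := Subtype.ext η.pi_qp
    rho_qp := Subtype.ext η.rho_qp
    qp_act := Subtype.ext η.qp_act }

/-- Morita equivalence of hyperbolic pairs: `e R e' R e = e R e` and `e' R e R e' = e' R e'` for
`e = e_{|η|}` and `e' = e_{|η'|}`. -/
def MoritaEquivalent (η η' : HyperbolicPair X) : Prop :=
  AddSubgroup.closure {x | ∃ r s, x = η.abs * r * η'.abs * s * η.abs} =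
    AddSubgroup.closure {x | ∃ r, x = η.abs * r * η.abs} ∧
  AddSubgroup.closure {x | ∃ r s, x = η'.abs * r * η.abs * s * η'.abs} =
    AddSubgroup.closure {x | ∃ r, x = η'.abs * r * η'.abs}

end HyperbolicPair

/-- A free orthogonal hyperbolic family `η_1, …, η_n` of rank `n`: pairwise orthogonal hyperbolic
pairs with coherent isomorphisms `e_{ij} ∈ R`. The conditions imply that `e_{ij} ∈ e_i R e_j` and
that the pairs are Morita equivalent. The pair `η_i` corresponds to the index `i - 1` of `Fin n`. -/
structure FreeHyperbolicFamily (X : OddFormRing.{u, v}) (n : ℕ) where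
  pair : Fin n → HyperbolicPair X
  orthogonal : ∀ i j, i ≠ j → (pair i).Orthogonal (pair j)
  unit : Fin n → Fin n → X.R
  unit_self : ∀ i, unit i i = (pair i).ep
  unit_mul : ∀ i j k, unit i j * unit j k = unit i k

namespace FreeHyperbolicFamily

variable {X : OddFormRing.{u, v}} {n : ℕ} (H : FreeHyperbolicFamily X n)

theorem ep_mul_unit (i j : Fin n) : (H.pair i).ep * H.unit i j = H.unit i j := by
  rw [← H.unit_self, H.unit_mul]

theorem unit_mul_ep (i j : Fin n) : H.unit i j * (H.pair j).ep = H.unit i j := by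
  rw [← H.unit_self, H.unit_mul]

/-- The element `e_{|i|,|j|}`, an isomorphism of `e_{|j|}` with `e_{|i|}`. -/
def absUnit (i j : Fin n) : X.R := H.unit i j + star (H.unit j i)

theorem em_mul_star_unit (i j : Fin n) :
    (H.pair i).em * star (H.unit j i) = star (H.unit j i) := by
  rw [← (H.pair i).star_ep, ← star_mul, H.unit_mul_ep]

theorem star_unit_mul_em (i j : Fin n) :
    star (H.unit j i) * (H.pair j).em = star (H.unit j i) := by
  rw [← (H.pair j).star_ep, ← star_mul, H.ep_mul_unit]

theorem abs_mul_absUnit (i j : Fin n) : (H.pair i).abs * H.absUnit i j = H.absUnit i j := by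
  unfold absUnit
  rw [mul_add, ← H.ep_mul_unit i j, ← H.em_mul_star_unit i j, ← mul_assoc, ← mul_assoc,
    HyperbolicPair.abs_mul_ep, HyperbolicPair.abs_mul_em]

theorem absUnit_mul_abs (i j : Fin n) : H.absUnit i j * (H.pair j).abs = H.absUnit i j := by
  unfold absUnit
  rw [add_mul, ← H.unit_mul_ep i j, ← H.star_unit_mul_em i j, mul_assoc, mul_assoc,
    HyperbolicPair.ep_mul_abs, HyperbolicPair.em_mul_abs]

theorem absUnit_mul_absUnit (i j : Fin n) :
    H.absUnit i j * H.absUnit j i = (H.pair i).abs := by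
  have h1 : H.unit i j * star (H.unit i j) = 0 := by
    conv_lhs => rw [← H.unit_mul_ep i j, star_mul, (H.pair j).star_ep, mul_assoc,
      ← mul_assoc (H.pair j).ep, (H.pair j).ep_mul_em, zero_mul, mul_zero]
  have h2 : star (H.unit j i) * H.unit j i = 0 := by
    conv_lhs => rw [← H.ep_mul_unit j i, star_mul, (H.pair j).star_ep, mul_assoc,
      ← mul_assoc (H.pair j).em, (H.pair j).em_mul_ep, zero_mul, mul_zero]
  unfold absUnit
  rw [mul_add, add_mul, add_mul, H.unit_mul, h1, h2, ← star_mul, H.unit_mul, H.unit_self,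
    HyperbolicPair.star_ep, zero_add, add_zero, add_comm]
  rfl

theorem morita (i j : Fin n) : (H.pair i).MoritaEquivalent (H.pair j) := by
  have key (i j : Fin n) :
      AddSubgroup.closure {x | ∃ r s, x = (H.pair i).abs * r * (H.pair j).abs * s * (H.pair i).abs} =
      AddSubgroup.closure {x | ∃ r, x = (H.pair i).abs * r * (H.pair i).abs} := by
    congr 1
    ext x
    constructor
    · rintro ⟨r, s, rfl⟩
      exact ⟨r * (H.pair j).abs * s, by simp only [mul_assoc]⟩
    · rintro ⟨r, rfl⟩
      refine ⟨H.absUnit i j, H.absUnit j i * r, ?_⟩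
      rw [H.abs_mul_absUnit, H.absUnit_mul_abs, ← mul_assoc (H.absUnit i j), H.absUnit_mul_absUnit]
  exact ⟨key i j, key j i⟩

/-- The index of `η_1`. -/
def first (_ : FreeHyperbolicFamily X n) (hn : 1 ≤ n) : Fin n := ⟨0, hn⟩

/-- The index of `η_n`. -/
def last (_ : FreeHyperbolicFamily X n) (hn : 1 ≤ n) : Fin n := ⟨n - 1, Nat.sub_one_lt_of_lt hn⟩

/-- The hermitian idempotent `e_{|n|}`. -/
def absLast (hn : 1 ≤ n) : X.R := (H.pair (H.last hn)).abs

theorem absLast_proj (hn : 1 ≤ n) : IsStarProjection (H.absLast hn) :=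
  (H.pair (H.last hn)).abs_proj

/-- The image of a free orthogonal hyperbolic family under a morphism. -/
def map {Y : OddFormRing.{u₁, v₁}} (f : OddFormHom X Y) : FreeHyperbolicFamily Y n where
  pair i := (H.pair i).map f
  orthogonal i j h := by
    have e (k : Fin n) : ((H.pair k).map f).abs = f.onR (H.pair k).abs := (map_add f.onR _ _).symm
    unfold HyperbolicPair.Orthogonal
    rw [e, e, ← map_mul, ← map_mul, (H.orthogonal i j h).1, (H.orthogonal i j h).2, map_zero]
    exact ⟨rfl, rfl⟩
  unit i j := f.onR (H.unit i j)
  unit_self i := congrArg f.onR (H.unit_self i)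
  unit_mul i j k := by rw [← map_mul, H.unit_mul]

/-- The free orthogonal hyperbolic family `η_1, …, η_{n-1}` of rank `n - 1` in the corner
`(R_{|n|'}, Δ_{|n|'}^{|n|'})`. -/
def corner (hn : 1 ≤ n) :
    FreeHyperbolicFamily (Corner X (H.absLast hn) (H.absLast_proj hn)) (n - 1) :=
  let c : Fin (n - 1) → Fin n := Fin.castLE (Nat.sub_le n 1)
  have hc : ∀ i, c i ≠ H.last hn := fun i h => by
    have h1 := congrArg Fin.val h
    have h2 := i.2
    simp only [c, last, Fin.val_castLE] at h1
    omega
  have hp : ∀ i j, (H.pair (H.last hn)).abs * H.unit (c i) (c j) = 0 := fun i j => by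
    rw [← H.ep_mul_unit, ← HyperbolicPair.abs_mul_ep, ← mul_assoc, ← mul_assoc,
      (H.orthogonal _ _ (hc i)).2, zero_mul, zero_mul]
  have hp' : ∀ i j, H.unit (c i) (c j) * (H.pair (H.last hn)).abs = 0 := fun i j => by
    rw [← H.unit_mul_ep, ← HyperbolicPair.ep_mul_abs, mul_assoc, mul_assoc,
      (H.orthogonal _ _ (hc j)).1, mul_zero, mul_zero]
  { pair := fun i => (H.pair (c i)).toCorner (H.absLast_proj hn) (H.orthogonal _ _ (hc i)).2
      (H.orthogonal _ _ (hc i)).1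
    orthogonal := fun i j h =>
      have hij : c i ≠ c j := fun h' => h (Fin.castLE_injective _ h')
      ⟨Subtype.ext (H.orthogonal _ _ hij).1, Subtype.ext (H.orthogonal _ _ hij).2⟩
    unit := fun i j => ⟨H.unit (c i) (c j), hp i j, hp' i j⟩
    unit_self := fun i => Subtype.ext (H.unit_self (c i))
    unit_mul := fun i j k => Subtype.ext (H.unit_mul (c i) (c j) (c k)) }

end FreeHyperbolicFamily

/-! ### Stable ranks -/

/-- The subgroup `e R f` of `R` for idempotents `e`, `f`. -/
def peirce (X : OddFormRing.{u, v}) (e f : X.R) : Set X.R := {x | e * x * f = x}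

/-- `sr(e R e) ≤ k` for an idempotent `e`. A sequence `x_i` in the unital ring `e R e` is unimodular
if `∑ y_i x_i = e` for some `y_i` in `e R e`. -/
def SrLE (X : OddFormRing.{u, v}) (e : X.R) (k : ℕ) : Prop :=
  ∀ x : Fin (k + 1) → X.R, (∀ i, x i ∈ peirce X e e) →
    (∃ y : Fin (k + 1) → X.R, (∀ i, y i ∈ peirce X e e) ∧ ∑ i, y i * x i = e) →
    ∃ a : Fin k → X.R, (∀ i, a i ∈ peirce X e e) ∧
      ∃ z : Fin k → X.R, (∀ i, z i ∈ peirce X e e) ∧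
        ∑ i, z i * (x i.castSucc + a i * x (Fin.last k)) = e

namespace FreeHyperbolicFamily

variable {X : OddFormRing.{u, v}} {n : ℕ} (H : FreeHyperbolicFamily X n)

/-- The even form parameter `Δ^{ev} = ρ(Ker(π|_{Δ_{0'}}))`, where `Δ_{0'} = Δ · e_{0'}` and
`e_{0'} = ∑ e_{|i|}`. -/
def evenParam : Set X.R :=
  {r | ∃ u, X.act u (∑ i, (H.pair i).abs) = u ∧ X.pi u = 0 ∧ X.rho u = r}

/-- The condition `Λsr(η_1; R, Δ) ≤ k`. Here `xp i`, `xm i` are the members with indices `i + 1` and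
`-(i + 1)` of a unimodular sequence of length `2 (k + 1)`, and `a i j` is the matrix element with
the indices `i + 1` and `-(j + 1)`. -/
def LambdaSrLE (hn : 1 ≤ n) (k : ℕ) : Prop :=
  let ep := (H.pair (H.first hn)).ep
  let em := (H.pair (H.first hn)).em
  SrLE X ep k ∧
  ∀ xp xm : Fin (k + 1) → X.R, (∀ i, xp i ∈ peirce X ep ep) → (∀ i, xm i ∈ peirce X em ep) →
    (∃ yp ym : Fin (k + 1) → X.R, (∀ i, yp i ∈ peirce X ep ep) ∧ (∀ i, ym i ∈ peirce X ep em) ∧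
      ∑ i, ym i * xm i + ∑ i, yp i * xp i = ep) →
    ∃ a : Fin (k + 1) → Fin (k + 1) → X.R, (∀ i j, a i j ∈ peirce X ep em) ∧
      (∀ i j, a i j = -star (a j i)) ∧ (∀ i, a i i ∈ H.evenParam) ∧
      ∃ z : Fin (k + 1) → X.R, (∀ i, z i ∈ peirce X ep ep) ∧
        ∑ i, z i * (xp i + ∑ j, a i j * xm j) = ep

end FreeHyperbolicFamily

/-! ### The sets of morphisms and the groups of the stability theorem -/

section Sets

variable {Y : OddFormRing.{u₁, v₁}} {X : OddFormRing.{u, v}}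

/-- For `e = e_{|i|}` and `ε = e_{|j|}` this is the set `Hom_{ij}` of morphisms `f` with
`f(e_{|i|}) = e_{|j|}`. -/
def homFix (e : Y.R) (ε : X.R) : Set (OddFormHom Y X) := {f | f.onR e = ε}

/-- For `e = e_{|m|}` and `ε = e_{|n|}` this is the set `Hom^*` of morphisms `f` such that
`U(f(e_{|m|}), e_{|n|}; R, Δ)` is not empty. -/
def homStar (e : Y.R) (ε : X.R) : Set (OddFormHom Y X) := {f | Nonempty (Isometry X (f.onR e) ε)}

/-- The group `PU_n = Hom_{nn} ∩ PU` for `e = e_{|n|}`. -/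
def puFix (e : X.R) : Subgroup (PU X) where
  carrier := {σ | σ.val ∈ homFix e e}
  one_mem' := rfl
  mul_mem' := fun {σ τ} hσ hτ => by
    change σ.val.onR (τ.val.onR e) = e
    rw [show τ.val.onR e = e from hτ]; exact hσ
  inv_mem' := fun {σ} hσ => by
    have h : σ⁻¹.val.onR (σ.val.onR e) = e := by
      rw [← OddFormHom.mul_onR]; simp
    rw [show σ.val.onR e = e from hσ] at h
    exact h

/-- The group `PU^* = Hom^* ∩ PU` for `e = e_{|n|}`. -/
def puStar (e : X.R) (he : IsStarProjection e) : Subgroup (PU X) where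
  carrier := {σ | σ.val ∈ homStar e e}
  one_mem' := ⟨Isometry.refl he⟩
  mul_mem' := fun {σ _} ⟨g⟩ ⟨h⟩ => ⟨(h.map σ.val).trans g⟩
  inv_mem' := fun {σ} ⟨g⟩ => by
    have h : σ⁻¹.val.onR (σ.val.onR e) = e := by
      rw [← OddFormHom.mul_onR]; simp
    have k := g.symm.map σ⁻¹.val
    rw [h] at k
    exact ⟨k⟩

/-- The morphism of corners induced by a morphism `f` with `f(e) = e'`. -/
def OddFormHom.toCorner (f : OddFormHom Y X) {e : Y.R} {e' : X.R} (he : IsStarProjection e)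
    (he' : IsStarProjection e') (hf : f ∈ homFix e e') :
    OddFormHom (Corner Y e he) (Corner X e' he') :=
  have hf' : f.onR e = e' := hf
  { onR :=
      { toFun := fun x => ⟨f.onR x.1, by
          rw [← hf', ← map_mul, x.2.1, map_zero], by
          rw [← hf', ← map_mul, x.2.2, map_zero]⟩
        map_zero' := Subtype.ext (map_zero f.onR)
        map_add' := fun x y => Subtype.ext (map_add f.onR x.1 y.1)
        map_mul' := fun x y => Subtype.ext (map_mul f.onR x.1 y.1) }
    onD :=
      { toFun := fun x => ⟨f.onD x.1, by
          rw [← hf', ← map_neg, ← f.map_act1, x.2.1], by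
          rw [← hf', ← f.map_pi, ← map_mul, x.2.2.1, map_zero], by
          rw [← hf', ← f.map_pi, ← map_mul, x.2.2.2, map_zero]⟩
        map_zero' := Subtype.ext (map_zero f.onD)
        map_add' := fun x y => Subtype.ext (map_add f.onD x.1 y.1) }
    map_star := fun x => Subtype.ext (f.map_star x.1)
    map_act := fun u x => Subtype.ext (f.map_act u.1 x.1)
    map_phi := fun x => Subtype.ext (f.map_phi x.1)
    map_pi := fun x => Subtype.ext (f.map_pi x.1)
    map_rho := fun x => Subtype.ext (f.map_rho x.1) }

/-- The restriction homomorphism from `PU_n` to the projective unitary group of the corner. -/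
def resPU (e : X.R) (he : IsStarProjection e) : puFix e →* PU (Corner X e he) :=
  MonoidHom.toHomUnits
    { toFun := fun σ => σ.1.val.toCorner he he σ.2
      map_one' := rfl
      map_mul' := fun _ _ => rfl }

/-- For `e = e_{|n|}` this is the subgroup `U(R_{|n|}, Δ_{|n|}^{|n|}) × U(n - 1; R, Δ)` of
`U(n; R, Δ)`, i.e. the group of all `g` with `β_{|n|,|n|'}(g) = 0` and `β_{|n|',|n|}(g) = 0`.
See `mem_blockU_inf_iff` for the product decomposition. -/
def blockU (e : X.R) (he : IsStarProjection e) : Subgroup (U X) where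
  carrier := {g | e * g.beta = g.beta * e}
  one_mem' := by
    change e * 0 = 0 * e
    simp
  mul_mem' := fun {g h} hg hh => by
    change e * (g.beta * h.beta + g.beta + h.beta) = (g.beta * h.beta + g.beta + h.beta) * e
    have hg' : e * g.beta = g.beta * e := hg
    have hh' : e * h.beta = h.beta * e := hh
    rw [mul_add, mul_add, add_mul, add_mul, hg', hh', ← mul_assoc, hg', mul_assoc, hh', mul_assoc]
  inv_mem' := fun {g} hg => by
    change e * star g.beta = star g.beta * e
    have h := congrArg star (show e * g.beta = g.beta * e from hg)
    rw [star_mul, star_mul, proj_star he] at h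
    exact h.symm

/-- The subgroup `U(R_e, Δ_e^e)` of `U(R, Δ)` for a hermitian idempotent `e ∈ R`. -/
def unitOn (e : X.R) : Set (U X) :=
  {g | e * g.beta = g.beta ∧ g.beta * e = g.beta ∧ X.act g.gamma e = g.gamma}

/-- The subgroup `U(R_{e'}, Δ_{e'}^{e'})` of `U(R, Δ)`, where `e' = 1 - e`. -/
def unitOff (e : X.R) : Set (U X) :=
  {g | e * g.beta = 0 ∧ g.beta * e = 0 ∧ X.act1 g.gamma (-e) = g.gamma}

/-- The projection of block diagonal elements of `U(R, Δ)` to the unitary group of the corner. -/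
def resU (e : X.R) (he : IsStarProjection e) : blockU e he →* U (Corner X e he) where
  toFun g :=
    have hg : e * g.1.beta = g.1.beta * e := g.2
    have hs : star g.1.beta * e = e * star g.1.beta := by
      have h := congrArg star hg
      rwa [star_mul, star_mul, proj_star he] at h
    have ht (x : X.R) : star g.1.beta * (e * x) = e * (star g.1.beta * x) := by
      rw [← mul_assoc, hs, mul_assoc]
    have hu (x : X.R) : g.1.beta * (e * x) = e * (g.1.beta * x) := by
      rw [← mul_assoc, ← hg, mul_assoc]
    have hee (x : X.R) : e * (e * x) = e * x := by rw [← mul_assoc, proj_mul he]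
    { beta := ⟨g.1.beta - e * g.1.beta, by
        rw [mul_sub, hee, sub_self], by
        rw [sub_mul, mul_assoc, ← hg, hee, sub_self]⟩
      gamma := ⟨X.act1 g.1.gamma (-e), by
        rw [X.act1_act1]
        congr 1
        rw [mul_neg, neg_mul, neg_neg, proj_mul he, neg_add_cancel_right], by
        rw [X.pi_act1, g.1.pi_gamma, mul_add, mul_neg, mul_neg, ← hg, hee, add_neg_cancel], by
        rw [X.pi_act1, g.1.pi_gamma, add_mul, mul_neg, neg_mul, mul_assoc, proj_mul he,
          add_neg_cancel]⟩
      mul_star := Subtype.ext <| by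
        change (g.1.beta - e * g.1.beta) * star (g.1.beta - e * g.1.beta) +
          (g.1.beta - e * g.1.beta) + star (g.1.beta - e * g.1.beta) = 0
        simp only [star_sub, star_mul, proj_star he, hs, mul_sub, sub_mul, mul_assoc, hu, hee,
          U.mul_star_eq, mul_neg]
        abel
      star_mul := Subtype.ext <| by
        change star (g.1.beta - e * g.1.beta) * (g.1.beta - e * g.1.beta) +
          (g.1.beta - e * g.1.beta) + star (g.1.beta - e * g.1.beta) = 0
        simp only [star_sub, star_mul, proj_star he, hs, mul_sub, sub_mul, mul_assoc, ht, hee,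
          U.star_mul_eq, mul_neg]
        abel
      pi_gamma := Subtype.ext <| by
        change X.pi (X.act1 g.1.gamma (-e)) = g.1.beta - e * g.1.beta
        rw [X.pi_act1, g.1.pi_gamma, hg, mul_neg, sub_eq_add_neg]
      rho_gamma := Subtype.ext <| by
        change X.rho (X.act1 g.1.gamma (-e)) = star (g.1.beta - e * g.1.beta)
        rw [X.rho_act1, g.1.rho_gamma, star_neg, proj_star he, star_sub, star_mul, proj_star he]
        simp only [neg_mul, mul_neg, mul_assoc, hs, hee]
        abel }
  map_one' := by
    apply U.ext
    · exact Subtype.ext (by change (0 : X.R) - e * 0 = 0; simp)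
    · exact Subtype.ext (by change X.act1 0 (-e) = 0; simp)
  map_mul' g h := by
    have hg : e * g.1.beta = g.1.beta * e := g.2
    have hu (x : X.R) : g.1.beta * (e * x) = e * (g.1.beta * x) := by
      rw [← mul_assoc, ← hg, mul_assoc]
    have hh : e * h.1.beta = h.1.beta * e := h.2
    have hee (x : X.R) : e * (e * x) = e * x := by rw [← mul_assoc, proj_mul he]
    apply U.ext
    · apply Subtype.ext
      change (g.1.beta * h.1.beta + g.1.beta + h.1.beta) -
        e * (g.1.beta * h.1.beta + g.1.beta + h.1.beta) =
        (g.1.beta - e * g.1.beta) * (h.1.beta - e * h.1.beta) + (g.1.beta - e * g.1.beta) +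
          (h.1.beta - e * h.1.beta)
      simp only [mul_add, mul_sub, sub_mul, mul_assoc, hu, hee]
      abel
    · apply Subtype.ext
      change X.act1 (X.act1 g.1.gamma h.1.beta + h.1.gamma) (-e) =
        ((X.act1 (X.act1 g.1.gamma (-e)) (h.1.beta - e * h.1.beta) +
          X.act1 h.1.gamma (-e) : X.D))
      rw [X.add_act1, X.act1_act1, X.act1_act1]
      congr 2
      simp only [neg_mul, mul_neg, mul_sub, hee, ← hh]
      abel

/-- A block diagonal element of `U(R, Δ)` (or of `U(I, Γ)`) is a product of an element of
`U(R_e, Δ_e^e)` and an element of `U(R_{e'}, Δ_{e'}^{e'})` (both lying in `U(I, Γ)`). -/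
theorem mem_blockU_inf_iff (e : X.R) (he : IsStarProjection e) (I : OddFormIdeal X) (g : U X) :
    g ∈ blockU e he ⊓ I.unitary ↔
      ∃ a ∈ unitOn e, ∃ b ∈ unitOff e, a ∈ I.unitary ∧ b ∈ I.unitary ∧ a * b = g := by
  constructor
  · rintro ⟨hg, hI⟩
    have hg' : e * g.beta = g.beta * e := hg
    obtain ⟨b, hb1, hb2⟩ : ∃ b : U X, b.beta = g.beta - e * g.beta ∧
        b.gamma = X.act1 g.gamma (-e) :=
      ⟨(OddFormHom.mapU ⟨⟨⟨Subtype.val, fun _ _ => rfl⟩, rfl, fun _ _ => rfl⟩,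
        ⟨⟨Subtype.val, rfl⟩, fun _ _ => rfl⟩, fun _ => rfl, fun _ _ => rfl, fun _ => rfl,
        fun _ => rfl, fun _ => rfl⟩ (resU e he ⟨g, hg⟩) : U X), rfl, rfl⟩
    have hee : e * (e * g.beta) = e * g.beta := by rw [← mul_assoc, proj_mul he]
    have hb : b ∈ unitOff e := by
      refine ⟨?_, ?_, ?_⟩
      · rw [hb1, mul_sub, hee, sub_self]
      · rw [hb1, sub_mul, mul_assoc, ← hg', hee, sub_self]
      · rw [hb2, X.act1_act1]
        congr 1
        rw [mul_neg, neg_mul, neg_neg, proj_mul he, neg_add_cancel_right]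
    have hbI : b ∈ I.unitary :=
      ⟨by rw [hb1]; exact I.ideal.sub_mem hI.1 (I.ideal.mul_mem_left _ _ hI.1),
        by rw [hb2]; exact I.act1_mem hI.2 _⟩
    have hs : star g.beta * e = e * star g.beta := by
      have h := congrArg star hg'
      rwa [star_mul, star_mul, proj_star he] at h
    have hee' (x : X.R) : e * (e * x) = e * x := by rw [← mul_assoc, proj_mul he]
    obtain ⟨a, ha1, ha2⟩ : ∃ a : U X, a.beta = e * g.beta ∧ a.gamma = X.act g.gamma e := by
      refine ⟨⟨e * g.beta, X.act g.gamma e, ?_, ?_, ?_, ?_⟩, rfl, rfl⟩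
      · rw [star_mul, proj_star he, hs, mul_assoc, ← mul_assoc g.beta, ← hg', mul_assoc,
          U.mul_star_eq, hee', mul_sub, mul_neg]
        abel
      · rw [star_mul, proj_star he, hs, mul_assoc, ← mul_assoc (star g.beta), hs, mul_assoc,
          U.star_mul_eq, hee', mul_sub, mul_neg]
        abel
      · rw [X.pi_act, g.pi_gamma, hg']
      · rw [X.rho_act, g.rho_gamma, proj_star he, star_mul, proj_star he, mul_assoc, hs, hee']
    refine ⟨a, ⟨?_, ?_, ?_⟩, b, hb, ⟨?_, ?_⟩, hbI, ?_⟩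
    · rw [ha1, hee]
    · rw [ha1, mul_assoc, ← hg', hee]
    · rw [ha2, X.act_act, proj_mul he]
    · rw [ha1]; exact I.ideal.mul_mem_left _ _ hI.1
    · rw [ha2]; exact I.act_mem hI.2 _
    · apply U.ext
      · rw [U.beta_mul, ha1, hb1, mul_assoc, mul_sub, ← mul_assoc g.beta e, ← hg', mul_assoc e,
          mul_sub, hee', sub_self, zero_add]
        abel
      · rw [U.gamma_mul, ha2, X.act_act1, hb.1, add_zero, hb2]
        have h1 : X.act g.gamma (-e) = X.phi (e * star g.beta) + -X.act g.gamma e := by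
          have h := X.act_add g.gamma e (-e)
          rw [add_neg_cancel, X.act_zero, star_neg, proj_star he, g.rho_gamma, neg_mul, neg_mul,
            mul_assoc, hs, hee', X.phi_neg] at h
          have h' := eq_neg_of_add_eq_zero_right h.symm
          rw [h', neg_add_rev, neg_neg]
        have h2 : X.phi (-(star (X.pi (X.act g.gamma e)) * X.pi g.gamma)) = 0 := by
          apply X.phi_herm
          rw [X.pi_act, g.pi_gamma, star_mul, proj_star he, mul_assoc, U.star_mul_eq, star_neg,
            star_mul, star_sub, star_neg, star_star, proj_star he, sub_mul, neg_mul, hs, ← hg',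
            mul_sub, mul_neg]
          abel
        have h3 : X.act g.gamma e + g.gamma = g.gamma + X.act g.gamma e := by
          rw [X.add_swap, neg_mul, h2, add_zero]
        unfold OddFormRing.act1
        rw [h1, star_neg, proj_star he, g.rho_gamma, neg_mul, X.phi_neg, add_assoc g.gamma,
          neg_add_cancel_left, ← add_assoc, h3, add_neg_cancel_right]
  · rintro ⟨a, ha, b, hb, haI, hbI, rfl⟩
    refine ⟨mul_mem ?_ ?_, mul_mem haI hbI⟩
    · exact ha.1.trans ha.2.1.symm
    · exact hb.1.trans hb.2.1.symm

end Sets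

/-! ### General unitary groups -/

section General

variable {X : OddFormRing.{u, v}} {T : OddFormRing.{u₁, v₁}}

/-- The image of a hermitian idempotent under a morphism. -/
theorem OddFormHom.map_proj (f : OddFormHom X T) {e : X.R} (he : IsStarProjection e) :
    IsStarProjection (f.onR e) where
  isIdempotentElem := by
    change f.onR e * f.onR e = f.onR e
    rw [← map_mul, proj_mul he]
  isSelfAdjoint := by
    change star (f.onR e) = f.onR e
    rw [← f.map_star, proj_star he]

/-- The general unitary group `GU(T, Ξ; R, Δ)`, i.e. the stabilizer of `(R, Δ)` in `U(T, Ξ)`, where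
`(R, Δ)` is considered as an odd form subring of `(T, Ξ)` via an embedding `ι`. -/
def gunit (ι : OddFormHom X T) : Subgroup (U T) where
  carrier := {g | (U.inn g).val.onR '' Set.range ι.onR = Set.range ι.onR ∧
    (U.inn g).val.onD '' Set.range ι.onD = Set.range ι.onD}
  one_mem' := by
    constructor
    · rw [map_one]; exact Set.image_id _
    · rw [map_one]; exact Set.image_id _
  mul_mem' := fun {g h} hg hh => by
    constructor
    · have e : ((U.inn (g * h)).val.onR : T.R → T.R) =
          (U.inn g).val.onR ∘ (U.inn h).val.onR := by
        rw [map_mul]; rfl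
      rw [e, Set.image_comp, hh.1, hg.1]
    · have e : ((U.inn (g * h)).val.onD : T.D → T.D) =
          (U.inn g).val.onD ∘ (U.inn h).val.onD := by
        rw [map_mul]; rfl
      rw [e, Set.image_comp, hh.2, hg.2]
  inv_mem' := fun {g} hg => by
    have h : (U.inn g⁻¹).val * (U.inn g).val = 1 := by
      rw [← Units.val_mul, ← map_mul, inv_mul_cancel, map_one]; rfl
    have e : ((U.inn g⁻¹).val.onR : T.R → T.R) ∘ (U.inn g).val.onR = id := by
      funext x
      change ((U.inn g⁻¹).val * (U.inn g).val).onR x = x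
      rw [h]; rfl
    have e' : ((U.inn g⁻¹).val.onD : T.D → T.D) ∘ (U.inn g).val.onD = id := by
      funext x
      change ((U.inn g⁻¹).val * (U.inn g).val).onD x = x
      rw [h]; rfl
    constructor
    · conv_lhs => rw [← hg.1]
      rw [← Set.image_comp, e, Set.image_id]
    · conv_lhs => rw [← hg.2]
      rw [← Set.image_comp, e', Set.image_id]

/-- The preimage of a group `P ≤ PU(R, Δ)` under the canonical map
`GU(T, Ξ; R, Δ) → PU(R, Δ)`. -/
def gunitOver (ι : OddFormHom X T) (P : Subgroup (PU X)) : Subgroup (U T) where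
  carrier := {g | g ∈ gunit ι ∧ ∃ σ ∈ P, (U.inn g).val.comp ι = ι.comp σ.val}
  one_mem' := ⟨one_mem _, 1, one_mem _, by rw [map_one]; rfl⟩
  mul_mem' := by
    rintro g h ⟨hg, σ, hσ, es⟩ ⟨hh, τ, hτ, et⟩
    refine ⟨mul_mem hg hh, σ * τ, mul_mem hσ hτ, ?_⟩
    rw [map_mul]
    change (U.inn g).val.comp ((U.inn h).val.comp ι) = (ι.comp σ.val).comp τ.val
    rw [et, ← es]; rfl
  inv_mem' := by
    rintro g ⟨hg, σ, hσ, es⟩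
    refine ⟨inv_mem hg, σ⁻¹, inv_mem hσ, ?_⟩
    have h1 : ι.comp (σ.val * σ⁻¹.val) = ι := by rw [Units.mul_inv]; rfl
    have h2 : ((U.inn g⁻¹).val * (U.inn g).val).comp ι = ι := by
      rw [← Units.val_mul, ← map_mul, inv_mul_cancel, map_one]; rfl
    calc (U.inn g⁻¹).val.comp ι = (U.inn g⁻¹).val.comp (ι.comp (σ.val * σ⁻¹.val)) := by rw [h1]
      _ = (U.inn g⁻¹).val.comp ((ι.comp σ.val).comp σ⁻¹.val) := rfl
      _ = (((U.inn g⁻¹).val * (U.inn g).val).comp ι).comp σ⁻¹.val := by rw [← es]; rfl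
      _ = ι.comp σ⁻¹.val := by rw [h2]

theorem gunitOver_mono (ι : OddFormHom X T) {P Q : Subgroup (PU X)} (h : P ≤ Q) :
    gunitOver ι P ≤ gunitOver ι Q := fun _ ⟨hg, σ, hσ, e⟩ => ⟨hg, σ, h hσ, e⟩

/-- The elements of `GU_n` are block diagonal. -/
theorem gunitOver_le_blockU (ι : OddFormHom X T) {e : X.R} (he : IsStarProjection e) :
    gunitOver ι (puFix e) ≤ blockU (ι.onR e) (ι.map_proj he) := by
  rintro g ⟨-, σ, hσ, es⟩
  have h : (U.inn g).val.onR (ι.onR e) = ι.onR e := by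
    have h1 : ((U.inn g).val.comp ι).onR e = (ι.comp σ.val).onR e := by rw [es]
    rw [OddFormHom.comp_onR, OddFormHom.comp_onR, show σ.val.onR e = e from hσ] at h1
    exact h1
  rw [U.coe_inn, U.innHom_onR] at h
  have h2 := congrArg (fun z => z + z * g.beta) h
  simp only [add_mul, mul_assoc, U.star_mul_eq, mul_sub, mul_neg] at h2
  change ι.onR e * g.beta = g.beta * ι.onR e
  have h3 : ι.onR e + g.beta * ι.onR e = ι.onR e + ι.onR e * g.beta := by
    rw [← h2]; abel
  exact (add_left_cancel h3).symm

/-- `GU_n(n; R, Δ; R, Δ)` coincides with the group of block diagonal elements of `U(n; R, Δ)`. -/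
theorem gunitOver_one {e : X.R} (he : IsStarProjection e) :
    gunitOver (1 : OddFormHom X X) (puFix e) = blockU e he := by
  apply le_antisymm
  · exact gunitOver_le_blockU (1 : OddFormHom X X) he
  · intro g hg
    have hr : Set.range (1 : OddFormHom X X).onR = Set.univ :=
      Set.eq_univ_of_forall fun x => ⟨x, rfl⟩
    have hd : Set.range (1 : OddFormHom X X).onD = Set.univ :=
      Set.eq_univ_of_forall fun x => ⟨x, rfl⟩
    have h : (U.inn g).val * (U.inn g⁻¹).val = 1 := by
      rw [← Units.val_mul, ← map_mul, mul_inv_cancel, map_one]; rfl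
    refine ⟨⟨?_, ?_⟩, U.inn g, ?_, rfl⟩
    · rw [hr, Set.image_univ]
      exact Set.eq_univ_of_forall fun x => ⟨(U.inn g⁻¹).val.onR x, by
        rw [← OddFormHom.mul_onR, h]; rfl⟩
    · rw [hd, Set.image_univ]
      exact Set.eq_univ_of_forall fun x => ⟨(U.inn g⁻¹).val.onD x, by
        rw [← OddFormHom.mul_onD, h]; rfl⟩
    · change (U.inn g).val.onR e = e
      have hg' : e * g.beta = g.beta * e := hg
      rw [U.coe_inn, U.innHom_onR, ← hg', mul_assoc, U.mul_star_eq, mul_sub, mul_neg]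
      abel

/-- `PU_n(n; R, Δ; I, Γ)` is contained in `PU_n(n; R, Δ)`. -/
theorem OddFormIdeal.relative_le_puFix (I : OddFormIdeal X) (e : X.R) :
    I.relative (puFix (I.diag.onR e)) ≤ puFix e := by
  rintro _ ⟨σ, hσ, rfl⟩
  have h : (I.puDouble σ).val.onR (I.diag.onR e) = I.diag.onR e := hσ
  exact congrArg (fun z => z.1.1) h

theorem OddFormIdeal.relative_le_pu (I : OddFormIdeal X) (P : Subgroup (PU I.Double)) :
    I.relative P ≤ I.pu := by
  rintro _ ⟨σ, -, rfl⟩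
  exact σ.2

/-- The image of `U(I, Γ)` is a normal subgroup of the relative projective unitary groups. -/
instance (I : OddFormIdeal X) (P : Subgroup (PU I.Double)) :
    ((I.unitary.map U.inn).subgroupOf (I.relative P)).Normal where
  conj_mem := by
    rintro ⟨_, hτ⟩ ⟨g, hg, rfl⟩ σ
    refine ⟨σ.1.val.mapU g, ⟨?_, ?_⟩, (conj_inn σ.1 g).symm⟩
    · have h := I.ideal.add_mem ((I.relative_le_pu P σ.2).1 g.beta) hg.1
      rwa [sub_add_cancel] at h
    · have h := I.grp.add_mem ((I.relative_le_pu P σ.2).2 g.gamma) hg.2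
      rwa [sub_add_cancel] at h

theorem FreeHyperbolicFamily.absLast_map {n : ℕ} (H : FreeHyperbolicFamily X n)
    (f : OddFormHom X T) (hn : 1 ≤ n) : (H.map f).absLast hn = f.onR (H.absLast hn) :=
  (map_add f.onR _ _).symm

theorem FreeHyperbolicFamily.relative_le_puFix {n : ℕ} (H : FreeHyperbolicFamily X n)
    (I : OddFormIdeal X) (hn : 1 ≤ n) :
    I.relative (puFix ((H.map I.diag).absLast hn)) ≤ puFix (H.absLast hn) := by
  rw [H.absLast_map I.diag hn]
  exact I.relative_le_puFix _

end General

/-! ### Stability of orbits and cosets -/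

/-- The set of orbits `K \ Y`, where `Y` is a set stable under a group `K` of transformations. -/
abbrev OrbitSet {G : Type u} {A : Type v} [Group G] [MulAction G A] (K : Subgroup G) (Y : Set A) :=
  Quotient ((MulAction.orbitRel K A).comap (Subtype.val : Y → A))

/-- The map `r` induces a well defined map `K \ Y → L \ Z`, it is injective, and it is bijective if
`cond` holds. -/
def OrbitStability {G : Type u} {A : Type v} [Group G] [MulAction G A] {G' : Type u₁} {A' : Type v₁}
    [Group G'] [MulAction G' A'] (K : Subgroup G) (Y : Set A) (L : Subgroup G') (Z : Set A')
    (r : Y → A') (cond : Prop) : Prop :=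
  ∃ Φ : OrbitSet K Y → OrbitSet L Z,
    (∀ y : Y, ∃ h : r y ∈ Z, Φ (Quotient.mk _ y) = Quotient.mk _ ⟨r y, h⟩) ∧
    Function.Injective Φ ∧ (cond → Function.Bijective Φ)

/-- `N` and `M` are normal subgroups of `P` and `Q`, the homomorphism `r` induces a well defined map
`P / N → Q / M`, it is injective, and it is bijective if `cond` holds. -/
def CosetStability {G : Type u} [Group G] {G' : Type u₁} [Group G'] (P N : Subgroup G)
    (Q M : Subgroup G') (r : P →* G') (cond : Prop) : Prop :=
  (N ≤ P ∧ (N.subgroupOf P).Normal) ∧ (M ≤ Q ∧ (M.subgroupOf Q).Normal) ∧ ∃ Φ : P ⧸ N.subgroupOf P → Q ⧸ M.subgroupOf Q,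
    (∀ p : P, ∃ h : r p ∈ Q, Φ (QuotientGroup.mk p) = QuotientGroup.mk ⟨r p, h⟩) ∧
    Function.Injective Φ ∧ (cond → Function.Bijective Φ)

end OddForm

open OddForm

/-! Two facts carry the theorem.

The first is transitivity: if Λsr(η_1) ≤ n - 1, every hermitian idempotent isometric to e_{|n|} is
conjugate to e_{|n|} under U(R, Δ) (`FreeHyperbolicFamily.uconj_of_LambdaSrLE`). An isometry α
produces the isotropic column x = α e_n, and the adjoint of α e_{-n} is a left inverse of x. The
column is improved by transvections. The stable rank of R_1 makes its hyperbolic part left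
invertible; the Λ-condition does the same for the part with positive indices; a second use of the
stable rank reaches the first n - 1 positive coordinates. One more transvection then turns the n-th
coordinate into e_n, and two opposite transvections move α e_n and α e_{-n} back to e_n and e_{-n}
(`UConj.of_component`).

The second is that for n ≥ 2 the pair (R, Δ) is generated by the corner of 1 - e_{|n|} together with
an isometry between e_{|n|} and the idempotent e_{|n-1|} of that corner
(`OddFormSubring.eq_top_of_isometry`): up to this isometry, elements of R are 2 by 2 matrices with
entries in the corner. Hence a morphism is determined by its restriction to the corner and the image
of the isometry (`OddFormHom.ext_of_isometry`); every compatible choice of these data extends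
(`exists_extension`); and two extensions of the same restriction differ by a unitary element
supported on the target idempotent (`exists_smul_eq_of_eq_on_corner`).

In rank n, a unitary g that relates two morphisms sending e_{|m|} to e_{|n|} commutes with e_{|n|},
which gives injectivity; surjectivity is transitivity. For the restriction maps, injectivity is the
uniqueness of extensions up to block diagonal elements. For surjectivity, transitivity inside the
corner moves the image of e_{|m-1|} to e_{|n-1|}, after which the morphism extends. The corner has
rank n - 1, whence the bound n - 2.

The relative statements use transitivity in the double: a unitary pair (h, g) there is replaced by
g⁻¹h, which lies in U(I, Γ) (`OddFormIdeal.exists_inn_mul_mem_relative`). The general unitary groups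
reduce to automorphisms of (R, Δ), except that elements acting trivially on (R, Δ) must be
controlled in addition (`eq_one_of_resU_eq_one`). The final isomorphisms join two bijections with
the common source PU_n. -/

namespace OddForm

/-! ### Sums of hyperbolic pairs and unitary transvections -/

section Transvections

variable {X : OddFormRing.{u, v}}

namespace HyperbolicPair

/-- The hyperbolic pair with the two isotropic idempotents interchanged. -/
def swap (η : HyperbolicPair X) : HyperbolicPair X where
  em := η.ep
  ep := η.em
  qm := η.qp
  qp := η.qm
  em_mul_em := η.ep_mul_ep
  ep_mul_ep := η.em_mul_em
  em_mul_ep := η.ep_mul_em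
  ep_mul_em := η.em_mul_ep
  star_ep := η.star_em
  pi_qm := η.pi_qp
  rho_qm := η.rho_qp
  qm_act := η.qp_act
  pi_qp := η.pi_qm
  rho_qp := η.rho_qm
  qp_act := η.qm_act

theorem swap_abs (η : HyperbolicPair X) : η.swap.abs = η.abs := add_comm _ _

theorem Orthogonal.mul_eq_zero {η η' : HyperbolicPair X} (h : η.Orthogonal η') :
    η.ep * η'.ep = 0 ∧ η.ep * η'.em = 0 ∧ η.em * η'.ep = 0 ∧ η.em * η'.em = 0 := by
  have key (a b : X.R) (ha : a * η.abs = a) (hb : η'.abs * b = b) : a * b = 0 := by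
    rw [← ha, ← hb, mul_assoc, ← mul_assoc η.abs, h.1, zero_mul, mul_zero]
  exact ⟨key _ _ η.ep_mul_abs η'.abs_mul_ep, key _ _ η.ep_mul_abs η'.abs_mul_em,
    key _ _ η.em_mul_abs η'.abs_mul_ep, key _ _ η.em_mul_abs η'.abs_mul_em⟩

/-- The orthogonal sum of two hyperbolic pairs. -/
def add (η η' : HyperbolicPair X) (h : η.Orthogonal η') : HyperbolicPair X :=
  have h1 := h.mul_eq_zero
  have h2 := Orthogonal.mul_eq_zero (η := η') (η' := η) h.symm
  -- The φ-term in q · (a + b) vanishes because ρ(q) = 0, and q · b = q · (ab) = 0.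
  have act_sum (η η' : HyperbolicPair X) (q : X.D) (a b : X.R) (hq : X.act q a = q)
      (hr : X.rho q = 0) (hab : a * b = 0) : X.act q (a + b) = q := by
    have hb : X.act q b = 0 := by
      rw [← hq, X.act_act, hab, X.act_zero]
    rw [X.act_add, hq, hr, hb]; simp
  { em := η.em + η'.em
    ep := η.ep + η'.ep
    qm := η.qm + η'.qm
    qp := η.qp + η'.qp
    em_mul_em := by simp [mul_add, add_mul, η.em_mul_em, η'.em_mul_em, h1, h2]
    ep_mul_ep := by simp [mul_add, add_mul, η.ep_mul_ep, η'.ep_mul_ep, h1, h2]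
    em_mul_ep := by simp [mul_add, add_mul, η.em_mul_ep, η'.em_mul_ep, h1, h2]
    ep_mul_em := by simp [mul_add, add_mul, η.ep_mul_em, η'.ep_mul_em, h1, h2]
    star_ep := by rw [star_add, η.star_ep, η'.star_ep]
    pi_qm := by rw [X.pi_add, η.pi_qm, η'.pi_qm]
    pi_qp := by rw [X.pi_add, η.pi_qp, η'.pi_qp]
    rho_qm := by
      rw [X.rho_add, η.rho_qm, η'.rho_qm, η.pi_qm, η'.pi_qm, η.star_em, h1.2.1]; simp
    rho_qp := by
      rw [X.rho_add, η.rho_qp, η'.rho_qp, η.pi_qp, η'.pi_qp, η.star_ep, h1.2.2.1]; simp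
    qm_act := by
      rw [X.add_act, act_sum η η' _ _ _ η.qm_act η.rho_qm h1.2.2.2, add_comm η.em,
        act_sum η' η _ _ _ η'.qm_act η'.rho_qm h2.2.2.2]
    qp_act := by
      rw [X.add_act, act_sum η η' _ _ _ η.qp_act η.rho_qp h1.1, add_comm η.ep,
        act_sum η' η _ _ _ η'.qp_act η'.rho_qp h2.1] }

theorem em_mul_em_assoc (η : HyperbolicPair X) (x : X.R) : η.em * (η.em * x) = η.em * x := by
  rw [← mul_assoc, η.em_mul_em]
theorem ep_mul_ep_assoc (η : HyperbolicPair X) (x : X.R) : η.ep * (η.ep * x) = η.ep * x := by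
  rw [← mul_assoc, η.ep_mul_ep]

/-- The relations between the components of an element defining a transvection. -/
theorem transvection_relations (η : HyperbolicPair X) {u : X.D} (h1 : X.act u η.em = u)
    (h2 : η.abs * X.pi u = 0) :
    X.pi u * η.em = X.pi u ∧ η.em * X.pi u = 0 ∧ η.ep * X.pi u = 0 ∧
      η.ep * star (X.pi u) = star (X.pi u) ∧ star (X.pi u) * η.em = 0 ∧
      star (X.pi u) * η.ep = 0 ∧ η.ep * X.rho u = X.rho u ∧ X.rho u * η.em = X.rho u := by
  have a1 : X.pi u * η.em = X.pi u := by rw [← X.pi_act, h1]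
  have a2 : η.em * X.pi u = 0 := by rw [← η.em_mul_abs, mul_assoc, h2, mul_zero]
  have a3 : η.ep * X.pi u = 0 := by rw [← η.ep_mul_abs, mul_assoc, h2, mul_zero]
  have r : X.rho u = η.ep * X.rho u * η.em := by
    conv_lhs => rw [← h1]
    rw [X.rho_act, η.star_em]
  refine ⟨a1, a2, a3, ?_, ?_, ?_, ?_, ?_⟩
  · rw [← η.star_em, ← star_mul, a1]
  · rw [← η.star_ep, ← star_mul, a3, star_zero]
  · rw [← η.star_em, ← star_mul, a2, star_zero]
  · rw [r]; simp only [mul_assoc, ep_mul_ep_assoc]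
  · rw [r]; simp only [mul_assoc, η.em_mul_em]

/-- The transvection given by a hyperbolic pair `η` and an element `u ∈ Δ · e₋` such that `π(u)` is
annihilated by `e_{|η|}` from the left. -/
def transvection (η : HyperbolicPair X) (u : X.D) (h1 : X.act u η.em = u)
    (h2 : η.abs * X.pi u = 0) : U X :=
  have h := η.transvection_relations h1 h2
  have hr : star (X.rho u) = -X.rho u - star (X.pi u) * X.pi u := X.star_rho_eq u
  have zero_of (a b c d : X.R) (hc : a * c = a) (hd : c * b = 0) : a * b = 0 := by
    rw [← hc, mul_assoc, hd, mul_zero]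
  have zero_of' (a b c : X.R) (hc : a * c = 0) (hd : c * b = b) : a * b = 0 := by
    rw [← hd, ← mul_assoc, hc, zero_mul]
  have zero_mid (a b : X.R) (hc : a * η.em = a) (hd : η.ep * b = b) : a * b = 0 := by
    rw [← hc, ← hd, mul_assoc, ← mul_assoc η.em, η.em_mul_ep, zero_mul, mul_zero]
  have pp : X.pi u * X.pi u = 0 := zero_of _ _ _ 0 h.1 h.2.1
  have ps : X.pi u * star (X.pi u) = 0 := zero_mid _ _ h.1 h.2.2.2.1
  have pr : X.pi u * X.rho u = 0 := zero_mid _ _ h.1 h.2.2.2.2.2.2.1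
  have ss : star (X.pi u) * star (X.pi u) = 0 := zero_of' _ _ _ h.2.2.2.2.2.1 h.2.2.2.1
  have sr : star (X.pi u) * X.rho u = 0 := zero_of' _ _ _ h.2.2.2.2.2.1 h.2.2.2.2.2.2.1
  have rp : X.rho u * X.pi u = 0 := zero_of _ _ _ 0 h.2.2.2.2.2.2.2 h.2.1
  have rs : X.rho u * star (X.pi u) = 0 := zero_mid _ _ h.2.2.2.2.2.2.2 h.2.2.2.1
  have rr : X.rho u * X.rho u = 0 := zero_mid _ _ h.2.2.2.2.2.2.2 h.2.2.2.2.2.2.1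
  { beta := X.pi u - star (X.pi u) + X.rho u
    gamma := X.act η.qp (X.rho u - star (X.pi u)) + u + X.phi (star (X.pi u) - X.rho u)
    mul_star := by
      simp only [star_add, star_sub, star_star, hr, mul_add, add_mul, mul_sub, sub_mul, mul_neg,
        ← mul_assoc, pp, ps, pr, ss, sr, rp, rs, rr, zero_mul]
      abel
    star_mul := by
      simp only [star_add, star_sub, star_star, hr, mul_add, add_mul, mul_sub, sub_mul, neg_mul,
        mul_assoc, pp, ps, pr, ss, sr, rp, rs, rr, mul_zero]
      abel
    pi_gamma := by
      simp only [X.pi_add, X.pi_act, X.pi_phi, η.pi_qp, mul_sub, h]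
      abel
    rho_gamma := by
      simp only [X.rho_add, X.pi_add, X.pi_act, X.pi_phi, X.rho_act, X.rho_phi, η.pi_qp, η.rho_qp,
        mul_zero, zero_mul, star_mul, star_sub, star_star, η.star_ep, sub_mul, mul_assoc, h,
        star_add, hr, neg_mul, pp, rp]
      simp
      abel }

theorem transvection_beta (η : HyperbolicPair X) (u : X.D) (h1 : X.act u η.em = u)
    (h2 : η.abs * X.pi u = 0) :
    (η.transvection u h1 h2).beta = X.pi u - star (X.pi u) + X.rho u := rfl

end HyperbolicPair

end Transvections

end OddForm

namespace OddForm

/-! ### Isometries, conjugacy under the unitary group, and the case of a normalised component -/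

section Conjugation

variable {X : OddFormRing.{u, v}}

theorem proj_mul_assoc {e : X.R} (he : IsStarProjection e) (x : X.R) : e * (e * x) = e * x := by
  rw [← mul_assoc, proj_mul he]

/-- The isometry between a hermitian idempotent and its conjugate by an element of `U(R, Δ)`. -/
def Isometry.ofUnit (g : U X) {e : X.R} (he : IsStarProjection e) :
    Isometry X (g.innHom.onR e) e where
  alpha := e + g.beta * e
  gamma := X.act g.gamma e
  left_mul := by
    simp only [U.innHom_onR, mul_add, add_mul, mul_assoc, U.star_mul_left, mul_sub, mul_neg,
      proj_mul he]
    abel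
  mul_right := by rw [add_mul, mul_assoc, proj_mul he]
  star_mul := by
    simp only [star_add, StarMul.star_mul, proj_star he, mul_add, add_mul, mul_assoc,
      U.star_mul_left, mul_sub, mul_neg, proj_mul he]
    abel
  mul_star := by
    simp only [U.innHom_onR, star_add, StarMul.star_mul, proj_star he, mul_add, add_mul, mul_assoc,
      proj_mul he, proj_mul_assoc he]
    abel
  gamma_act := by rw [X.act_act, proj_mul he]
  pi_gamma := by rw [X.pi_act, g.pi_gamma, add_sub_cancel_left]
  rho_gamma := by
    rw [X.rho_act, g.rho_gamma, add_sub_cancel_left, StarMul.star_mul]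

/-- `e` is conjugate to `ε` under `U(R, Δ)`. -/
def UConj (ε e : X.R) : Prop := ∃ g : U X, g.innHom.onR ε = e

theorem innHom_mul (g h : U X) : (g * h).innHom = g.innHom.comp h.innHom := by
  rw [← U.coe_inn, map_mul]; rfl

theorem innHom_one : (1 : U X).innHom = 1 := by
  rw [← U.coe_inn, map_one]; rfl

theorem UConj.of_innHom {ε e : X.R} (g : U X) (h : UConj (g.innHom.onR ε) e) : UConj ε e := by
  obtain ⟨k, hk⟩ := h
  exact ⟨k * g, by rw [innHom_mul]; exact hk⟩

theorem UConj.trans {a b c : X.R} (h : UConj a b) (h' : UConj b c) : UConj a c := by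
  obtain ⟨g, rfl⟩ := h
  exact h'.of_innHom

theorem Isometry.proj_left {ε e : X.R} (i : Isometry X ε e) : IsStarProjection ε :=
  ⟨i.mul_self_left, i.star_left⟩

/-- The translate of an isometry by an element of `U(R, Δ)`. -/
def Isometry.translate (g : U X) {ε e : X.R} (i : Isometry X ε e) :
    Isometry X (g.innHom.onR ε) e := (Isometry.ofUnit g i.proj_left).trans i

theorem Isometry.translate_alpha (g : U X) {ε e : X.R} (i : Isometry X ε e) :
    (i.translate g).alpha = i.alpha + g.beta * i.alpha := by
  change (ε + g.beta * ε) * i.alpha = _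
  rw [add_mul, mul_assoc, i.left_mul]

/-- A reduction step: it suffices to conjugate translates of an isometry. -/
theorem UConj.of_translate {ε e : X.R} (i : Isometry X ε e) (g : U X) (P : X.R → Prop)
    (h : ∀ {ε : X.R} (j : Isometry X ε e), P j.alpha → UConj ε e)
    (hP : P (i.alpha + g.beta * i.alpha)) : UConj ε e :=
  UConj.of_innHom g (h (i.translate g) (by rwa [Isometry.translate_alpha]))

/-- The isotropic vector of `Δ` that corresponds to the image of `e₊` under an isometry. -/
def Isometry.vec {ε : X.R} (η : HyperbolicPair X) (i : Isometry X ε η.abs) : X.D :=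
  X.act i.gamma η.ep + η.qp

namespace Isometry

variable {ε : X.R} (η : HyperbolicPair X) (i : Isometry X ε η.abs)

theorem vec_act : X.act (i.vec η) η.ep = i.vec η := by
  rw [vec, X.add_act, X.act_act, η.ep_mul_ep, η.qp_act]

theorem pi_vec : X.pi (i.vec η) = i.alpha * η.ep := by
  rw [vec, X.pi_add, X.pi_act, i.pi_gamma, η.pi_qp, sub_mul, η.abs_mul_ep, sub_add_cancel]

theorem rho_vec : X.rho (i.vec η) = 0 := by
  rw [vec, X.rho_add, X.rho_act, X.pi_act, i.pi_gamma, i.rho_gamma, η.pi_qp, η.rho_qp]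
  simp only [star_sub, StarMul.star_mul, i.star_right, sub_mul, mul_sub, mul_assoc, η.abs_mul_ep,
    η.star_ep]
  simp

theorem star_alpha_mul_alpha :
    star (i.alpha * η.em) * (i.alpha * η.ep) = η.ep := by
  rw [StarMul.star_mul, mul_assoc, ← mul_assoc (star i.alpha), i.star_mul, η.abs_mul_ep, η.star_em,
    η.ep_mul_ep]

end Isometry

/-- The adjoint of β(g) is β(g⁻¹), so this inverts the equation α(g)a = b. -/
theorem U.star_beta_of_map (g : U X) {a b : X.R} (h : a + g.beta * a = b) :
    b + star g.beta * b = a := by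
  rw [← h, mul_add, U.star_mul_left]; abel

/-- An isotropic vector with component `e₊` is the image of `e₊` under a transvection. -/
theorem HyperbolicPair.exists_transvection (η : HyperbolicPair X) (v : X.D)
    (hv : X.act v η.ep = v) (hr : X.rho v = 0) (hp : η.ep * X.pi v = η.ep) :
    ∃ g : U X, η.ep + g.beta * η.ep = X.pi v ∧ g.beta * η.em = 0 := by
  have hpe : X.pi v * η.ep = X.pi v := by rw [← X.pi_act, hv]
  have hse : star (X.pi v) * η.em = η.em := by rw [← η.star_ep, ← star_mul, hp]
  -- The vector v is stripped of its e₋ and e₊ components, so that e_{|η|} annihilates π(u). Without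
  -- the φ-term ρ would be the adjoint of e₋π(v); with it ρ(u) = e₋π(v), which is the e₋ component
  -- that the image of e₊ must have.
  obtain ⟨u, hu⟩ : ∃ u, u = -X.act η.qm (η.em * X.pi v) + (v + -η.qp) + X.phi (η.em * X.pi v) :=
    ⟨_, rfl⟩
  have hmse : η.em * star (X.pi v) = star (X.pi v) := by rw [← η.star_ep, ← star_mul, hpe]
  have pu : X.pi u = X.pi v - η.abs * X.pi v := by
    rw [hu, HyperbolicPair.abs, add_mul, hp]
    simp only [X.pi_add, X.pi_neg, X.pi_act, X.pi_phi, η.pi_qm, η.pi_qp, η.em_mul_em_assoc]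
    abel
  have ru : X.rho u = η.em * X.pi v := by
    have h1 : X.rho (-X.act η.qm (η.em * X.pi v)) = 0 := by
      rw [← X.star_rho, X.rho_act, η.rho_qm]; simp
    have h2 : X.rho (-η.qp) = 0 := by rw [← X.star_rho, η.rho_qp, star_zero]
    have h4 : star (X.pi v) * η.ep = star (η.em * X.pi v) := by rw [star_mul, η.star_em]
    have h5 : star (η.em * X.pi v) * η.em = 0 := by
      rw [star_mul, η.star_em, mul_assoc, η.ep_mul_em, mul_zero]
    have h6 : star (η.em * X.pi v) * X.pi v = star (η.em * X.pi v) := by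
      rw [star_mul, η.star_em, mul_assoc, hp]
    have h7 : star (η.em * X.pi v) * η.ep = star (η.em * X.pi v) := by
      rw [star_mul, η.star_em, mul_assoc, η.ep_mul_ep]
    rw [hu, X.rho_add, X.rho_add, X.rho_add, h1, h2, hr]
    simp only [X.pi_add, X.pi_neg, X.pi_act, X.pi_phi, X.rho_phi, η.pi_qm, η.pi_qp,
      η.em_mul_em_assoc, mul_neg, neg_mul, star_neg, h4, mul_add, h6, h7]
    simp
  have hu1 : X.act u η.swap.em = u := by
    change X.act u η.ep = u
    rw [hu, X.add_act, X.add_act, X.add_act, X.neg_act, X.neg_act, X.act_act, hv, η.qp_act,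
      ← X.phi_conj, η.star_ep, η.em_mul_em_assoc, mul_assoc,
      hpe]
  have hu2 : η.swap.abs * X.pi u = 0 := by
    rw [η.swap_abs, pu, mul_sub, proj_mul_assoc η.abs_proj, sub_self]
  have hrel := η.swap.transvection_relations hu1 hu2
  refine ⟨η.swap.transvection u hu1 hu2, ?_, ?_⟩
  · have h3 : star (X.pi u) * η.ep = 0 := hrel.2.2.2.2.1
    have h4 : X.pi u * η.ep = X.pi u := hrel.1
    rw [η.swap.transvection_beta, add_mul, sub_mul, h3, h4, pu, ru, mul_assoc, hpe,
      HyperbolicPair.abs, add_mul, hp]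
    abel
  · have h3 : star (X.pi u) * η.em = 0 := hrel.2.2.2.2.2.1
    have h4 : X.pi u * η.em = 0 := by
      rw [← hrel.1, mul_assoc]
      change _ * (η.ep * η.em) = 0
      rw [η.ep_mul_em, mul_zero]
    rw [η.swap.transvection_beta, add_mul, sub_mul, h3, h4, ru, ← hpe, mul_assoc, mul_assoc,
      η.ep_mul_em]
    simp

/-- A hermitian idempotent isometric to `e_{|η|}` is conjugate to `e_{|η|}` if the corresponding
isotropic vector has the component `e₊`. -/
theorem UConj.of_component {ε : X.R} (η : HyperbolicPair X) (i : Isometry X ε η.abs)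
    (h : η.ep * i.alpha * η.ep = η.ep) : UConj ε η.abs := by
  obtain ⟨g, hg, -⟩ := η.exists_transvection (i.vec η) (i.vec_act η) (i.rho_vec η)
    (by rw [i.pi_vec η, ← mul_assoc, h])
  rw [i.pi_vec η] at hg
  refine UConj.of_translate i g⁻¹ (fun a => a * η.ep = η.ep) ?_ ?_
  · intro ε j hj
    -- An isometry preserves the pairing of e₋ with e₊; once αe₊ = e₊, this forces the e₋ component
    -- of αe₋.
    have h1 : η.em * j.alpha * η.em = η.em := by
      have h2 := congrArg star (j.star_alpha_mul_alpha η)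
      rwa [hj, star_mul, star_star, η.star_ep, ← mul_assoc] at h2
    have i' : ∃ i' : Isometry X ε η.swap.abs, i'.alpha = j.alpha := by
      rw [η.swap_abs]; exact ⟨j, rfl⟩
    obtain ⟨i', hi'⟩ := i'
    obtain ⟨g, hg, hg'⟩ := η.swap.exists_transvection (i'.vec _) (i'.vec_act _) (i'.rho_vec _)
      (by rw [i'.pi_vec, ← mul_assoc, hi']; exact h1)
    rw [i'.pi_vec, hi'] at hg
    change η.em + g.beta * η.em = j.alpha * η.em at hg
    -- The opposite transvection fixes e₊, so correcting αe₋ does not spoil the normalisation αe₊ =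
    -- e₊.
    change g.beta * η.ep = 0 at hg'
    refine UConj.of_translate j g⁻¹ (fun a => a = η.abs) ?_ ?_
    · intro ε k hk
      refine ⟨1, ?_⟩
      rw [innHom_one]
      change ε = _
      rw [← k.mul_star, hk, proj_star η.abs_proj, proj_mul η.abs_proj]
    · have h3 : j.alpha = η.ep + j.alpha * η.em := by
        have h4 : j.alpha * (η.em + η.ep) = j.alpha := j.mul_right
        rw [mul_add, hj, add_comm] at h4
        exact h4.symm
      have h4 := g.star_beta_of_map (a := η.ep) (b := η.ep) (by rw [hg', add_zero])
      have h5 := g.star_beta_of_map hg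
      rw [h3, U.beta_inv, mul_add, add_add_add_comm, h4, h5, add_comm]; rfl
  · change (i.alpha + star g.beta * i.alpha) * η.ep = η.ep
    rw [add_mul, mul_assoc, g.star_beta_of_map hg]

end Conjugation

end OddForm

namespace OddForm

/-! ### Stable rank conditions in terms of block columns -/

section Families

variable {X : OddFormRing.{u, v}}

/-- The entries at (i, j) and (j, i) contribute x - x̄ together, which lies in M by `hN`, and the
diagonal entries lie in M by assumption. This turns the matrix supplied by the Λ-condition into a
single ρ(u) with π(u) = 0, hence into one transvection. -/
theorem sum_antihermitian_mem {A ι : Type*} [NonUnitalRing A] [StarRing A] [DecidableEq ι]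
    (M N : AddSubgroup A) (hN : ∀ x ∈ N, x - star x ∈ M) (a : ι → ι → A)
    (ha : ∀ i j, a i j ∈ N) (ha' : ∀ i j, a i j = -star (a j i)) (hd : ∀ i, a i i ∈ M)
    (s : Finset ι) : ∑ i ∈ s, ∑ j ∈ s, a i j ∈ M := by
  induction s using Finset.induction_on with
  | empty => simp
  | insert k s hk ih =>
    have h1 : ∑ i ∈ insert k s, ∑ j ∈ insert k s, a i j =
        a k k + (∑ j ∈ s, a k j - star (∑ j ∈ s, a k j)) + ∑ i ∈ s, ∑ j ∈ s, a i j := by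
      have h2 : ∑ i ∈ s, a i k = -star (∑ j ∈ s, a k j) := by
        rw [star_sum, ← Finset.sum_neg_distrib]
        exact Finset.sum_congr rfl fun i _ => ha' i k
      simp only [Finset.sum_insert hk, Finset.sum_add_distrib, h2]
      abel
    rw [h1]
    exact M.add_mem (M.add_mem (hd k) (hN _ (sum_mem fun j _ => ha k j))) ih

/-- The group of all `ρ(u)`, where `u ∈ Δ · f` and `π(u) = 0`. -/
def evenGroup (X : OddFormRing.{u, v}) (f : X.R) : AddSubgroup X.R where
  carrier := {r | ∃ u, X.act u f = u ∧ X.pi u = 0 ∧ X.rho u = r}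
  zero_mem' := ⟨0, by simp⟩
  add_mem' := by
    rintro _ _ ⟨u, h1, h2, rfl⟩ ⟨v, h3, h4, rfl⟩
    exact ⟨u + v, by rw [X.add_act, h1, h3], by rw [X.pi_add, h2, h4, add_zero],
      by rw [X.rho_add, h2]; simp⟩
  neg_mem' := by
    rintro _ ⟨u, h1, h2, rfl⟩
    refine ⟨-u, by rw [X.neg_act, h1], by rw [X.pi_neg, h2, neg_zero], ?_⟩
    rw [← X.star_rho, X.star_rho_eq, h2]; simp

/-- The subgroup `e R f` of `R`. -/
def peirceGroup (X : OddFormRing.{u, v}) (e f : X.R) : AddSubgroup X.R where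
  carrier := {x | e * x = x ∧ x * f = x}
  zero_mem' := by simp
  add_mem' := by
    rintro x y ⟨h1, h2⟩ ⟨h3, h4⟩
    exact ⟨by rw [mul_add, h1, h3], by rw [add_mul, h2, h4]⟩
  neg_mem' := by
    rintro x ⟨h1, h2⟩
    exact ⟨by rw [mul_neg, h1], by rw [neg_mul, h2]⟩

theorem HyperbolicPair.sub_star_mem_evenGroup (η : HyperbolicPair X) {x : X.R}
    (hx : x ∈ peirceGroup X η.ep η.em) : x - star x ∈ evenGroup X η.em := by
  refine ⟨X.phi x, ?_, X.pi_phi x, X.rho_phi x⟩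
  rw [← X.phi_conj, η.star_em, hx.1, hx.2]

theorem mem_peirce_left {e f x : X.R} (he : e * e = e) (hx : x ∈ peirce X e f) : e * x = x := by
  have h : e * x * f = x := hx
  rw [← h, mul_assoc, ← mul_assoc e, he]

namespace FreeHyperbolicFamily

/-- The sum of a subfamily. -/
theorem exists_sum {n : ℕ} (H : FreeHyperbolicFamily X n) (s : Finset (Fin n)) :
    ∃ η : HyperbolicPair X, η.ep = ∑ i ∈ s, (H.pair i).ep ∧ η.em = ∑ i ∈ s, (H.pair i).em := by
  induction s using Finset.induction_on with
  | empty => exact ⟨⟨0, 0, 0, 0, by simp, by simp, by simp, by simp, by simp, by simp, by simp,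
      by simp, by simp, by simp, by simp⟩, by simp⟩
  | insert k s hk ih =>
    obtain ⟨η, h1, h2⟩ := ih
    have ho : (H.pair k).Orthogonal η := by
      have hne : ∀ i ∈ s, k ≠ i := fun i hi h => hk (h ▸ hi)
      have h3 : η.abs = ∑ i ∈ s, (H.pair i).abs := by
        rw [HyperbolicPair.abs, h1, h2, ← Finset.sum_add_distrib]; rfl
      constructor
      · rw [h3, Finset.mul_sum]
        exact Finset.sum_eq_zero fun i hi => (H.orthogonal k i (hne i hi)).1
      · rw [h3, Finset.sum_mul]
        exact Finset.sum_eq_zero fun i hi => (H.orthogonal k i (hne i hi)).2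
    refine ⟨(H.pair k).add η ho, ?_, ?_⟩
    · rw [Finset.sum_insert hk, ← h1]; rfl
    · rw [Finset.sum_insert hk, ← h2]; rfl

variable {n : ℕ} (H : FreeHyperbolicFamily X n)

theorem unit_mul_assoc (i j k : Fin n) (x : X.R) :
    H.unit i j * (H.unit j k * x) = H.unit i k * x := by
  rw [← mul_assoc, H.unit_mul]

theorem unit_mul_of_ne {i j : Fin n} (h : i ≠ j) (a b : Fin n) :
    H.unit a i * H.unit j b = 0 := by
  rw [← H.unit_mul_ep, ← H.ep_mul_unit j, mul_assoc, ← mul_assoc (H.pair i).ep,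
    (H.orthogonal i j h).mul_eq_zero.1, zero_mul, mul_zero]

theorem unit_mul_sum_ep {s : Finset (Fin n)} {i : Fin n} (hi : i ∈ s) (a : Fin n) :
    H.unit a i * ∑ j ∈ s, (H.pair j).ep = H.unit a i := by
  rw [Finset.mul_sum, Finset.sum_eq_single_of_mem i hi, H.unit_mul_ep]
  intro j _ hj
  rw [← H.unit_self, H.unit_mul_of_ne (Ne.symm hj)]

theorem sum_ep_mul_unit {s : Finset (Fin n)} {i : Fin n} (hi : i ∈ s) (a : Fin n) :
    (∑ j ∈ s, (H.pair j).ep) * H.unit i a = H.unit i a := by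
  rw [Finset.sum_mul, Finset.sum_eq_single_of_mem i hi, H.ep_mul_unit]
  intro j _ hj
  rw [← H.unit_self, H.unit_mul_of_ne hj]

theorem star_unit_mul_sum_em {s : Finset (Fin n)} {i : Fin n} (hi : i ∈ s) (a : Fin n) :
    star (H.unit i a) * ∑ j ∈ s, (H.pair j).em = star (H.unit i a) := by
  have h := congrArg star (H.sum_ep_mul_unit hi a)
  simp only [star_mul, star_sum, HyperbolicPair.star_ep] at h
  exact h

theorem unit_mem_peirce (i a b : Fin n) (x : X.R) :
    H.unit a i * x * H.unit i b ∈ peirce X (H.pair a).ep (H.pair b).ep := by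
  change _ * _ * _ = _
  simp only [mul_assoc, H.unit_mul_ep]
  rw [← mul_assoc, H.ep_mul_unit]

end FreeHyperbolicFamily

namespace FreeHyperbolicFamily

variable {k : ℕ} (H : FreeHyperbolicFamily X (k + 1))

/-- The units e_{ij} transport every entry of a block column to R_1, where the scalar stable rank
applies. The result is put back as one element b of e_F R e_n with e_F = e_1 + ⋯ + e_{n-1}, so that
it can define one transvection. The index 0 stands for η_1 and `Fin.last k` for η_n. -/
theorem exists_of_SrLE (hsr : SrLE X (H.pair 0).ep k) {x y t : X.R}
    (hx : x * (H.pair (Fin.last k)).ep = x)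
    (ht : t * (H.pair (Fin.last k)).ep = t)
    (h : y * (∑ i : Fin k, (H.pair i.castSucc).ep) * x + t = (H.pair (Fin.last k)).ep) :
    ∃ b z, (∑ i : Fin k, (H.pair i.castSucc).ep) * b = b ∧ b * (H.pair (Fin.last k)).ep = b ∧
      z * ((∑ i : Fin k, (H.pair i.castSucc).ep) * x + b * t) = (H.pair (Fin.last k)).ep := by
  set l := Fin.last k with hl
  set E := ∑ i : Fin k, (H.pair i.castSucc).ep with hE
  have hEs : E = ∑ j ∈ Finset.univ.map Fin.castSuccEmb, (H.pair j).ep := by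
    rw [Finset.sum_map]; rfl
  have hmem (i : Fin k) : i.castSucc ∈ Finset.univ.map Fin.castSuccEmb := by simp
  have uE (i : Fin k) (a) : H.unit a i.castSucc * E = H.unit a i.castSucc := by
    rw [hEs, H.unit_mul_sum_ep (hmem i)]
  have Eu (i : Fin k) (a) : E * H.unit i.castSucc a = H.unit i.castSucc a := by
    rw [hEs, H.sum_ep_mul_unit (hmem i)]
  have hxl : x = x * H.unit l 0 * H.unit 0 l := by rw [mul_assoc, H.unit_mul, H.unit_self, hx]
  -- The entry t is placed last, because the last entry is the one that the stable rank condition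
  -- absorbs into the others.
  obtain ⟨a, ha, z, hz, hsum⟩ := hsr
    (Fin.snoc (fun i : Fin k => H.unit 0 i.castSucc * x * H.unit l 0)
      (H.unit 0 l * t * H.unit l 0)) (by
        intro i
        refine Fin.lastCases ?_ (fun i => ?_) i
        · simp only [Fin.snoc_last]; exact H.unit_mem_peirce _ _ _ _
        · simp only [Fin.snoc_castSucc]
          change _ * _ * _ = _
          simp only [mul_assoc, H.unit_mul_ep]
          rw [← mul_assoc, H.ep_mul_unit])
      ⟨Fin.snoc (fun i : Fin k => H.unit 0 l * y * H.unit i.castSucc 0) (H.pair 0).ep, by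
        intro i
        refine Fin.lastCases ?_ (fun i => ?_) i
        · simp only [Fin.snoc_last]
          change _ * _ * _ = _
          rw [(H.pair 0).ep_mul_ep, (H.pair 0).ep_mul_ep]
        · simp only [Fin.snoc_castSucc]
          change _ * _ * _ = _
          simp only [mul_assoc, H.unit_mul_ep]
          rw [← mul_assoc, H.ep_mul_unit], by
        rw [Fin.sum_univ_castSucc]
        simp only [Fin.snoc_last, Fin.snoc_castSucc]
        have h1 (i : Fin k) : H.unit 0 l * y * H.unit i.castSucc 0 *
            (H.unit 0 i.castSucc * x * H.unit l 0) =
            H.unit 0 l * (y * ((H.pair i.castSucc).ep * (x * H.unit l 0))) := by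
          simp only [mul_assoc, H.unit_mul_assoc, H.unit_self]
        simp only [h1]
        rw [← Finset.mul_sum, ← Finset.mul_sum, ← Finset.sum_mul, ← hE, ← mul_assoc (H.pair 0).ep,
          ← mul_assoc (H.pair 0).ep, H.ep_mul_unit, mul_assoc _ t, ← mul_add]
        have h2 := congrArg (fun w => H.unit 0 l * (w * H.unit l 0)) h
        simp only [add_mul, mul_assoc, H.ep_mul_unit, H.unit_mul, H.unit_self] at h2
        exact h2⟩
  simp only [Fin.snoc_last, Fin.snoc_castSucc] at hsum
  refine ⟨∑ i, H.unit i.castSucc 0 * (a i * H.unit 0 l),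
    ∑ i, H.unit l 0 * (z i * H.unit 0 i.castSucc), ?_, ?_, ?_⟩
  · rw [Finset.mul_sum]
    refine Finset.sum_congr rfl fun i _ => ?_
    rw [← mul_assoc, Eu]
  · rw [Finset.sum_mul]
    refine Finset.sum_congr rfl fun i _ => ?_
    rw [mul_assoc, mul_assoc, H.unit_mul_ep]
  · have h3 (i : Fin k) : H.unit 0 i.castSucc * ∑ j : Fin k, H.unit j.castSucc 0 *
        (a j * H.unit 0 l) = a i * H.unit 0 l := by
      rw [Finset.mul_sum, Finset.sum_eq_single_of_mem i (Finset.mem_univ _)]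
      · rw [H.unit_mul_assoc, H.unit_self, ← mul_assoc,
          mem_peirce_left (H.pair 0).ep_mul_ep (ha i)]
      · intro j _ hj
        rw [← mul_assoc, H.unit_mul_of_ne fun h => hj (Fin.castSucc_injective k h).symm, zero_mul]
    have h4 : t = t * H.unit l 0 * H.unit 0 l := by
      rw [mul_assoc, H.unit_mul, H.unit_self, ht]
    have h5 (i : Fin k) : H.unit 0 i.castSucc *
        (E * x + (∑ j : Fin k, H.unit j.castSucc 0 * (a j * H.unit 0 l)) * t) =
        (H.unit 0 i.castSucc * x * H.unit l 0 + a i * (H.unit 0 l * t * H.unit l 0)) *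
          H.unit 0 l := by
      rw [mul_add, ← mul_assoc, uE, ← mul_assoc, h3, add_mul]
      conv_lhs => rw [hxl, h4]
      simp only [mul_assoc]
    rw [Finset.sum_mul]
    simp only [mul_assoc (H.unit l 0), mul_assoc (z _), h5]
    rw [← Finset.mul_sum]
    simp only [← mul_assoc (z _)]
    rw [← Finset.sum_mul, hsum, ← mul_assoc, H.unit_mul_ep, H.unit_mul, H.unit_self]

/-- Again the units e_{ij} and their adjoints transport the coordinates to R_1 and e_{-1}Re_1. The
antihermitian matrix obtained there becomes one element a that is ρ(u) for some u with π(u) = 0. -/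
theorem exists_of_LambdaSrLE (hΛ : H.LambdaSrLE (Nat.le_add_left 1 k) k) {x y : X.R}
    (hx : x * (H.pair (Fin.last k)).ep = x) (η : HyperbolicPair X)
    (hp : η.ep = ∑ i, (H.pair i).ep) (hm : η.em = ∑ i, (H.pair i).em)
    (h : y * (η.abs * x) = (H.pair (Fin.last k)).ep) :
    ∃ a ∈ evenGroup X η.em, ∃ z, z * (η.ep * x + a * x) = (H.pair (Fin.last k)).ep := by
  set l := Fin.last k with hl
  have hxl : x = x * H.unit l 0 * H.unit 0 l := by rw [mul_assoc, H.unit_mul, H.unit_self, hx]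
  have uE (i a) : H.unit a i * η.ep = H.unit a i := by
    rw [hp, H.unit_mul_sum_ep (Finset.mem_univ i)]
  have Eu (i a) : η.ep * H.unit i a = H.unit i a := by
    rw [hp, H.sum_ep_mul_unit (Finset.mem_univ i)]
  have suE (i a) : star (H.unit i a) * η.em = star (H.unit i a) := by
    rw [hm, H.star_unit_mul_sum_em (Finset.mem_univ i)]
  obtain ⟨a, ha, ha', hae, z, hz, hsum⟩ := hΛ.2 (fun i => H.unit 0 i * x * H.unit l 0)
    (fun i => star (H.unit i 0) * x * H.unit l 0)
    (fun i => by
      change (H.pair 0).ep * _ * (H.pair 0).ep = _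
      simp only [mul_assoc, H.unit_mul_ep]
      rw [← mul_assoc, H.ep_mul_unit])
    (fun i => by
      change (H.pair 0).em * _ * (H.pair 0).ep = _
      simp only [mul_assoc, H.unit_mul_ep]
      rw [← mul_assoc, H.em_mul_star_unit])
    ⟨fun i => H.unit 0 l * y * H.unit i 0, fun i => H.unit 0 l * y * star (H.unit 0 i),
      fun i => by
        change (H.pair 0).ep * _ * (H.pair 0).ep = _
        simp only [mul_assoc, H.unit_mul_ep]
        rw [← mul_assoc, H.ep_mul_unit],
      fun i => by
        change (H.pair 0).ep * _ * (H.pair 0).em = _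
        simp only [mul_assoc, H.star_unit_mul_em]
        rw [← mul_assoc, H.ep_mul_unit], by
        have h1 (i) : H.unit 0 l * y * star (H.unit 0 i) *
            (star (H.unit i 0) * x * H.unit l 0) =
            H.unit 0 l * (y * ((H.pair i).em * (x * H.unit l 0))) := by
          simp only [mul_assoc]
          rw [← mul_assoc (star (H.unit 0 i)), ← star_mul, H.unit_mul, H.unit_self,
            HyperbolicPair.star_ep]
        have h2 (i) : H.unit 0 l * y * H.unit i 0 *
            (H.unit 0 i * x * H.unit l 0) =
            H.unit 0 l * (y * ((H.pair i).ep * (x * H.unit l 0))) := by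
          simp only [mul_assoc, H.unit_mul_assoc, H.unit_self]
        simp only [h1, h2]
        rw [← Finset.mul_sum, ← Finset.mul_sum, ← Finset.mul_sum, ← Finset.mul_sum,
          ← Finset.sum_mul, ← Finset.sum_mul, ← hp, ← hm, ← mul_add, ← mul_add, ← add_mul]
        have h3 := congrArg (fun w => H.unit 0 l * (w * H.unit l 0)) h
        simp only [mul_assoc, H.ep_mul_unit, H.unit_mul, H.unit_self] at h3
        exact h3⟩
  change ∑ i, z i * (H.unit 0 i * x * H.unit l 0 + ∑ j, a i j * (star (H.unit j 0) * x *
    H.unit l 0)) = (H.pair 0).ep at hsum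
  have hal (i j) : (H.pair 0).ep * a i j = a i j :=
    mem_peirce_left (H.pair 0).ep_mul_ep (ha i j)
  refine ⟨∑ i, ∑ j, H.unit i 0 * a i j * star (H.unit j 0), ?_,
    ∑ i, H.unit l 0 * (z i * H.unit 0 i), ?_⟩
  · refine sum_antihermitian_mem (evenGroup X η.em) (peirceGroup X η.ep η.em)
      (fun x hx => η.sub_star_mem_evenGroup hx) _ ?_ ?_ ?_ _
    · intro i j
      constructor
      · rw [← mul_assoc, ← mul_assoc, Eu]
      · rw [mul_assoc, suE]
    · intro i j
      conv_lhs => rw [ha' i j]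
      simp only [star_mul, star_star, mul_neg, neg_mul, mul_assoc]
    · intro i
      obtain ⟨w, -, hw2, hw3⟩ := hae i
      -- The rule ρ(w · x) = x̄ρ(w)x conjugates the diagonal entry from η_1 to η_i.
      refine ⟨X.act w (star (H.unit i 0)), ?_, ?_, ?_⟩
      · rw [X.act_act, suE]
      · rw [X.pi_act, hw2, zero_mul]
      · rw [X.rho_act, hw3, star_star]
  · have h3 (i) : H.unit 0 i * (∑ i, ∑ j, H.unit i 0 * a i j * star (H.unit j 0)) =
        ∑ j, a i j * star (H.unit j 0) := by
      rw [Finset.mul_sum, Finset.sum_eq_single_of_mem i (Finset.mem_univ _)]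
      · rw [Finset.mul_sum]
        refine Finset.sum_congr rfl fun j _ => ?_
        rw [mul_assoc, H.unit_mul_assoc, H.unit_self, ← mul_assoc, hal]
      · intro j _ hj
        rw [Finset.mul_sum]
        refine Finset.sum_eq_zero fun j' _ => ?_
        rw [mul_assoc, ← mul_assoc, H.unit_mul_of_ne (Ne.symm hj), zero_mul]
    have h5 (i) : H.unit 0 i * (η.ep * x +
          (∑ i, ∑ j, H.unit i 0 * a i j * star (H.unit j 0)) * x) =
        (H.unit 0 i * x * H.unit l 0 + ∑ j, a i j * (star (H.unit j 0) * x *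
          H.unit l 0)) * H.unit 0 l := by
      rw [mul_add, ← mul_assoc, uE, ← mul_assoc, h3, add_mul, Finset.sum_mul, Finset.sum_mul]
      congr 1
      · conv_lhs => rw [hxl]
        simp only [mul_assoc]
      · refine Finset.sum_congr rfl fun j _ => ?_
        conv_lhs => rw [hxl]
        simp only [mul_assoc]
    rw [Finset.sum_mul]
    simp only [mul_assoc (H.unit l 0), mul_assoc (z _), h5]
    rw [← Finset.mul_sum]
    simp only [← mul_assoc (z _)]
    rw [← Finset.sum_mul, hsum, ← mul_assoc, H.unit_mul_ep, H.unit_mul, H.unit_self]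

end FreeHyperbolicFamily

end Families

end OddForm

namespace OddForm

/-! ### Transitivity of the unitary group on idempotents isometric to the last one -/

section Transitivity

variable {X : OddFormRing.{u, v}} {ε : X.R}

theorem HyperbolicPair.rho_act_qp (η : HyperbolicPair X) (x : X.R) : X.rho (X.act η.qp x) = 0 := by
  rw [X.rho_act, η.rho_qp]; simp

theorem HyperbolicPair.rho_act_qm (η : HyperbolicPair X) (x : X.R) : X.rho (X.act η.qm x) = 0 := by
  rw [X.rho_act, η.rho_qm]; simp

theorem HyperbolicPair.Orthogonal.abs_mul {η η' : HyperbolicPair X} (h : η.Orthogonal η') :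
    η.abs * η'.ep = 0 ∧ η.abs * η'.em = 0 := by
  rw [HyperbolicPair.abs, add_mul, add_mul, h.mul_eq_zero.1, h.mul_eq_zero.2.1,
    h.mul_eq_zero.2.2.1, h.mul_eq_zero.2.2.2]
  simp

/-- Reduction to the case where the component of the isotropic vector is the unit. -/
theorem UConj.of_left_inverse_orthogonal (η η' : HyperbolicPair X) (ho : η.Orthogonal η')
    (i : Isometry X ε η.abs)
    (h : ∃ z, z * (η'.ep * (i.alpha * η.ep)) = η.ep) : UConj ε η.abs := by
  obtain ⟨z, hz⟩ := h
  obtain ⟨x, hx⟩ : ∃ x, x = i.alpha * η.ep := ⟨_, rfl⟩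
  have hxe : x * η.ep = x := by rw [hx, mul_assoc, η.ep_mul_ep]
  rw [← hx] at hz
  -- Since z is a left inverse of the η' component of x, cx = e₊ - e₊x. This is what has to be added
  -- to the e₊ component to make it e₊, and the transvection defined by -c̄ adds it.
  set c := (η.ep - η.ep * x) * z * η'.ep with hc
  have hc1 : c * η'.ep = c := by rw [hc, mul_assoc, η'.ep_mul_ep]
  have hc2 : η.ep * c = c := by
    rw [hc]; simp only [mul_sub, sub_mul, mul_assoc, η.ep_mul_ep_assoc]
  have hc3 : η'.em * star c = star c := by rw [← η'.star_ep, ← star_mul, hc1]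
  have hc4 : star c * η.em = star c := by rw [← η.star_ep, ← star_mul, hc2]
  have hpi : X.pi (X.act η'.qm (-star c)) = -star c := by
    rw [X.pi_act, η'.pi_qm, mul_neg, hc3]
  refine UConj.of_translate i (η.transvection (X.act η'.qm (-star c)) ?_ ?_)
    (fun a => η.ep * a * η.ep = η.ep) (fun j hj => UConj.of_component η j hj) ?_
  · rw [X.act_act, neg_mul, hc4]
  · rw [hpi, mul_neg, ← hc3, ← mul_assoc, ho.abs_mul.2, zero_mul, neg_zero]
  · rw [HyperbolicPair.transvection_beta, hpi, η'.rho_act_qm, star_neg, star_star, mul_assoc,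
      add_mul, mul_assoc, ← hx]
    have h1 : η.ep * (star c * x) = 0 := by
      rw [← hc3, ← mul_assoc, ← mul_assoc, ho.mul_eq_zero.2.1, zero_mul, zero_mul]
    have h2 : c * x = η.ep - η.ep * x := by
      rw [hc, mul_assoc, mul_assoc, hz, sub_mul, η.ep_mul_ep, mul_assoc, hxe]
    have h4 : η.ep * (c * x) = η.ep - η.ep * x := by
      rw [h2, mul_sub, η.ep_mul_ep, η.ep_mul_ep_assoc]
    simp only [add_zero, sub_neg_eq_add, add_mul, neg_mul, mul_add, mul_neg, h1, h4]
    abel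

namespace FreeHyperbolicFamily

variable {k : ℕ} (H : FreeHyperbolicFamily X (k + 1))

/-- Transitivity of the action of `U(R, Δ)` on hermitian idempotents isometric to `e_{|n|}`. -/
theorem uconj_of_LambdaSrLE (hΛ : H.LambdaSrLE (Nat.le_add_left 1 k) k)
    (i : Isometry X ε (H.pair (Fin.last k)).abs) : UConj ε (H.pair (Fin.last k)).abs := by
  set η := H.pair (Fin.last k) with hη
  -- E is the sum of all pairs and F the sum of the first n - 1 pairs; block transvections become
  -- transvections of a single pair.
  obtain ⟨E, hEp, hEm⟩ := H.exists_sum Finset.univ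
  obtain ⟨F, hFp, hFm⟩ := H.exists_sum (Finset.univ.map Fin.castSuccEmb)
  rw [Finset.sum_map] at hFp hFm
  have hFs : ∑ i : Fin k, (H.pair i.castSucc).ep = F.ep := hFp.symm
  have hEF : E.ep = F.ep + η.ep := by rw [hEp, hFp, Fin.sum_univ_castSucc]; rfl
  have hEF' : E.em = F.em + η.em := by rw [hEm, hFm, Fin.sum_univ_castSucc]; rfl
  have hne (j : Fin k) : Fin.last k ≠ j.castSucc := (Fin.castSucc_lt_last j).ne'
  have hF : F.abs = ∑ j : Fin k, (H.pair j.castSucc).abs := by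
    rw [HyperbolicPair.abs, hFp, hFm, ← Finset.sum_add_distrib]; rfl
  have ho : η.Orthogonal F := by
    constructor
    · rw [hF, Finset.mul_sum]
      exact Finset.sum_eq_zero fun j _ => (H.orthogonal _ _ (hne j)).1
    · rw [hF, Finset.sum_mul]
      exact Finset.sum_eq_zero fun j _ => (H.orthogonal _ _ (hne j)).2
  have ho' : F.Orthogonal η := ho.symm
  -- Second use of the stable rank: the n-th coordinate, multiplied by part of the left inverse, is
  -- absorbed into the coordinates of F.
  have step2 {ε : X.R} (i : Isometry X ε η.abs)
      (h : ∃ z, z * (E.ep * (i.alpha * η.ep)) = η.ep) : UConj ε η.abs := by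
    obtain ⟨z, hz⟩ := h
    obtain ⟨x, hx⟩ : ∃ x, x = i.alpha * η.ep := ⟨_, rfl⟩
    have hxe : x * η.ep = x := by rw [hx, mul_assoc, η.ep_mul_ep]
    rw [← hx] at hz
    obtain ⟨b, z', hb1, hb2, hz'⟩ := H.exists_of_SrLE hΛ.1 (x := x) (y := η.ep * z)
      (t := η.ep * (z * (η.ep * x))) hxe (by simp only [mul_assoc]; rw [← hη, hxe]) (by
        have h1 := congrArg (η.ep * ·) hz
        simp only [hEF, add_mul, mul_add, η.ep_mul_ep] at h1
        rw [hFs]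
        simp only [mul_assoc]
        exact h1)
    change _ * b = b at hb1
    change b * η.ep = b at hb2
    change z' * (_ * x + _) = η.ep at hz'
    rw [hFs] at hb1 hz'
    -- With this factor b'x = b · t, where t is the last entry of the shortened column. As b' lies
    -- in e_F R e_n, the corresponding transvection adds b'x to the F-coordinates of x.
    set b' := b * (η.ep * (z * η.ep)) with hb'
    have hb3 : F.ep * b' = b' := by rw [hb', ← mul_assoc, hb1]
    have hb4 : b' * η.ep = b' := by rw [hb']; simp only [mul_assoc, η.ep_mul_ep]
    have hb5 : η.em * star b' = star b' := by rw [← η.star_ep, ← star_mul, hb4]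
    have hpi : X.pi (X.act F.qp b') = b' := by rw [X.pi_act, F.pi_qp, hb3]
    refine UConj.of_translate i (η.swap.transvection (X.act F.qp b') ?_ ?_)
      (fun a => ∃ z, z * (F.ep * (a * η.ep)) = η.ep)
      (fun j hj => UConj.of_left_inverse_orthogonal η F ho j hj) ⟨z', ?_⟩
    · change X.act _ η.ep = _
      rw [X.act_act, hb4]
    · rw [hpi, η.swap_abs, ← hb3, ← mul_assoc, ho.abs_mul.1, zero_mul]
    · rw [HyperbolicPair.transvection_beta, hpi, F.rho_act_qp, add_mul, mul_assoc, ← hx, add_zero,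
        sub_mul]
      have h1 : F.ep * (star b' * x) = 0 := by
        rw [← hb5, ← mul_assoc, ← mul_assoc, ho'.mul_eq_zero.2.1, zero_mul, zero_mul]
      have h2 : F.ep * (b' * x) = b * (η.ep * (z * (η.ep * x))) := by
        rw [← mul_assoc, hb3, hb']; simp only [mul_assoc]
      rw [mul_add, mul_sub, h1, h2, sub_zero, hz']
  -- The Λ-condition: a transvection with π(u) = 0 adds ρ(u) times the negative coordinates to the
  -- positive ones, after which the positive coordinates alone have a left inverse.
  have step1 {ε : X.R} (i : Isometry X ε η.abs)
      (h : ∃ z, z * (E.abs * (i.alpha * η.ep)) = η.ep) : UConj ε η.abs := by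
    obtain ⟨y, hy⟩ := h
    obtain ⟨_, ⟨u, hu1, hu2, rfl⟩, z, hz⟩ := H.exists_of_LambdaSrLE hΛ (x := i.alpha * η.ep)
      (by rw [mul_assoc, ← hη, η.ep_mul_ep]) E hEp hEm hy
    have hab : E.abs * X.pi u = 0 := by rw [hu2, mul_zero]
    refine UConj.of_translate i (E.transvection u hu1 hab)
      (fun a => ∃ z, z * (E.ep * (a * η.ep)) = η.ep) step2 ⟨z, ?_⟩
    rw [HyperbolicPair.transvection_beta, hu2, star_zero, sub_zero, zero_add, add_mul, mul_add,
      mul_assoc, ← mul_assoc _ (X.rho u), (E.transvection_relations hu1 hab).2.2.2.2.2.2.1]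
    exact hz
  obtain ⟨i', hi'⟩ : ∃ i' : Isometry X ε η.swap.abs, i'.alpha = i.alpha := by
    rw [η.swap_abs]; exact ⟨i, rfl⟩
  obtain ⟨x, hx⟩ : ∃ x, x = i.alpha * η.ep := ⟨_, rfl⟩
  obtain ⟨y, hy⟩ : ∃ y, y = star (i.alpha * η.em) := ⟨_, rfl⟩
  have hxe : x * η.ep = x := by rw [hx, mul_assoc, η.ep_mul_ep]
  have hyx : y * x = η.ep := hy ▸ hx ▸ i.star_alpha_mul_alpha η
  -- The column x may have a part outside e_{0'}R. Therefore everything in yx = e_n except the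
  -- contribution of the F-coordinates is collected in one last entry and absorbed into those
  -- coordinates.
  obtain ⟨b, z, hb1, hb2, hz⟩ := H.exists_of_SrLE hΛ.1 (x := x) (y := y)
    (t := y * (x - F.ep * x)) hxe (by rw [← hη, mul_assoc, sub_mul, mul_assoc, hxe]) (by
      rw [mul_sub, hyx, hFs, ← mul_assoc, add_sub_cancel])
  change _ * b = b at hb1
  change z * (_ * x + _) = η.ep at hz
  rw [hFs] at hb1 hz
  have hEb : E.ep * b = b := by
    rw [← hb1, ← mul_assoc, hEF, add_mul, F.ep_mul_ep, ho.mul_eq_zero.1, add_zero]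
  have hbE : star b * E.em = star b := by rw [← E.star_ep, ← star_mul, hEb]
  -- The isotropic vector attached to αe_{-n} lifts ȳ to Δ, so v is a lift of -ȳb̄.
  set v := X.act (i'.vec η.swap) (-star b) with hv
  have hpv : X.pi v = -(star y * star b) := by
    rw [hv, X.pi_act, i'.pi_vec, hi', mul_neg, hy, star_star]; rfl
  have hpvE : X.pi v * E.em = X.pi v := by rw [hpv, neg_mul, mul_assoc, hbE]
  have hvE : X.act v E.em = v := by rw [hv, X.act_act, neg_mul, hbE]
  -- Removing the E-components of v makes it admissible for a transvection of E. The transvection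
  -- then adds only by(1 - e_{|E|})x to the F-coordinates, apart from a contribution of ρ(u).
  obtain ⟨u, hu⟩ : ∃ u, u = -X.act E.qp (X.pi v) + -X.act E.qm (X.pi v) + v := ⟨_, rfl⟩
  have hpu : X.pi u = X.pi v - E.abs * X.pi v := by
    rw [hu]
    simp only [X.pi_add, X.pi_neg, X.pi_act, E.pi_qp, E.pi_qm, HyperbolicPair.abs, add_mul]
    abel
  have hu1 : X.act u E.em = u := by
    rw [hu]
    simp only [X.add_act, X.neg_act, X.act_act, hpvE, hvE]
  have hu2 : E.abs * X.pi u = 0 := by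
    rw [hpu, mul_sub, proj_mul_assoc E.abs_proj, sub_self]
  have hrel := E.transvection_relations hu1 hu2
  have hspu : star (X.pi u) = b * y * E.abs - b * y := by
    rw [hpu, hpv, star_sub, star_neg, star_mul, star_mul, star_star, star_star, star_neg, star_mul,
      star_star, star_star, proj_star E.abs_proj]
    simp only [neg_mul]
    abel
  -- The left inverse is found by expressing z(e_F x + by(x - e_F x)) through the new column x'. The
  -- negative coordinates do not change, hence ρ(u)x = ρ(u)x'. The terms with ρ(u) undo its effect
  -- on the positive coordinates, and the terms with by replace the part of byx that the
  -- transvection could not add.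
  refine UConj.of_translate i (E.transvection u hu1 hu2)
    (fun a => ∃ z, z * (E.abs * (a * η.ep)) = η.ep) step1
    ⟨z * F.ep - z * F.ep * X.rho u + z * b * y * η.ep + z * b * y * E.em -
      z * b * y * η.ep * X.rho u, ?_⟩
  set r := X.rho u with hr
  rw [HyperbolicPair.transvection_beta, ← hr, add_mul i.alpha, mul_assoc _ i.alpha, ← hx]
  obtain ⟨x', hx'⟩ : ∃ x', x' = x + (X.pi u - star (X.pi u) + r) * x := ⟨_, rfl⟩
  rw [← hx']
  have hrE : r * E.em = r := hrel.2.2.2.2.2.2.2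
  have hEr : E.em * r = 0 := by
    rw [← hrel.2.2.2.2.2.2.1, ← mul_assoc, E.em_mul_ep, zero_mul]
  have hEps : E.em * star (X.pi u) = 0 := by
    rw [← hrel.2.2.2.1, ← mul_assoc, E.em_mul_ep, zero_mul]
  have e1 : E.em * x' = E.em * x := by
    simp only [hx', mul_add, add_mul, sub_mul, mul_sub, ← mul_assoc, hrel.2.1, hEps, hEr]
    simp
  have e2 : r * x' = r * x := by rw [← hrE, mul_assoc, e1, ← mul_assoc]
  have ef : F.ep * E.ep = F.ep := by
    rw [hEF, mul_add, F.ep_mul_ep, ho'.mul_eq_zero.1, add_zero]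
  have el : η.ep * E.ep = η.ep := by
    rw [hEF, mul_add, η.ep_mul_ep, ho.mul_eq_zero.1, zero_add]
  have fpu : F.ep * X.pi u = 0 := by rw [← ef, mul_assoc, hrel.2.2.1, mul_zero]
  have lpu : η.ep * X.pi u = 0 := by rw [← el, mul_assoc, hrel.2.2.1, mul_zero]
  have lb : η.ep * b = 0 := by rw [← hb1, ← mul_assoc, ho.mul_eq_zero.1, zero_mul]
  have e3 : F.ep * x' = F.ep * x + b * y * x - b * y * E.abs * x + F.ep * r * x := by
    simp only [hx', hspu, mul_add, add_mul, sub_mul, mul_sub, ← mul_assoc, fpu, hb1]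
    simp
    abel
  have e4 : η.ep * x' = η.ep * x + η.ep * r * x := by
    simp only [hx', hspu, mul_add, add_mul, sub_mul, mul_sub, ← mul_assoc, lpu, lb]
    simp
  have fa : F.ep * E.abs = F.ep := by rw [← ef, mul_assoc, E.ep_mul_abs]
  have la : η.ep * E.abs = η.ep := by rw [← el, mul_assoc, E.ep_mul_abs]
  have ra : r * E.abs = r := by rw [← hrE, mul_assoc, E.em_mul_abs]
  rw [← mul_assoc]
  simp only [add_mul, sub_mul, mul_assoc, fa, la, ra, E.em_mul_abs]
  simp only [e1, e2, e3, e4]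
  have hz2 : E.abs = F.ep + η.ep + E.em := by rw [HyperbolicPair.abs, hEF, add_comm]
  conv_rhs => rw [← hz]
  simp only [hz2, mul_add, mul_sub, add_mul, mul_assoc]
  abel

end FreeHyperbolicFamily

end Transitivity

end OddForm

namespace OddForm

/-! ### Transfer of stable rank conditions to subfamilies and corners -/

section Transfer

variable {X : OddFormRing.{u, v}} {Y : OddFormRing.{u₁, v₁}}

/-- The inclusion of an odd form subring. -/
def OddFormSubring.incl (A : OddFormSubring X) : OddFormHom A.toOddFormRing X where
  onR := ⟨⟨Subtype.val, fun _ _ => rfl⟩, rfl, fun _ _ => rfl⟩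
  onD := ⟨⟨Subtype.val, rfl⟩, fun _ _ => rfl⟩
  map_star _ := rfl
  map_act _ _ := rfl
  map_phi _ := rfl
  map_pi _ := rfl
  map_rho _ := rfl

theorem mem_peirce_of_abs {η : HyperbolicPair X} {a b x : X.R} (ha : η.abs * a = a)
    (hb : b * η.abs = b) (hx : x ∈ peirce X a b) : η.abs * x = x ∧ x * η.abs = x := by
  have h : a * x * b = x := hx
  constructor
  · rw [← h, ← mul_assoc, ← mul_assoc, ha]
  · rw [← h, mul_assoc, hb]

theorem exists_preimage_peirce (f : OddFormHom Y X) (hf : Function.Injective f.onR)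
    {η : HyperbolicPair X}
    (hR : ∀ x, η.abs * x = x → x * η.abs = x → ∃ y, f.onR y = x) {a b : Y.R}
    (ha : η.abs * f.onR a = f.onR a) (hb : f.onR b * η.abs = f.onR b) {x : X.R}
    (hx : x ∈ peirce X (f.onR a) (f.onR b)) : ∃ y ∈ peirce Y a b, f.onR y = x := by
  obtain ⟨y, rfl⟩ := hR x (mem_peirce_of_abs ha hb hx).1 (mem_peirce_of_abs ha hb hx).2
  refine ⟨y, hf ?_, rfl⟩
  rw [map_mul, map_mul]
  exact hx

theorem map_mem_peirce (f : OddFormHom Y X) {a b y : Y.R} (hy : y ∈ peirce Y a b) :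
    f.onR y ∈ peirce X (f.onR a) (f.onR b) := by
  have h : a * y * b = y := hy
  change f.onR a * f.onR y * f.onR b = f.onR y
  rw [← map_mul, ← map_mul, h]

namespace FreeHyperbolicFamily

/-- All data of the condition live in e₊Re₊, which is contained in the image of f; they can be
pulled back uniquely. -/
theorem SrLE_of_hom (f : OddFormHom Y X) (hf : Function.Injective f.onR) {η : HyperbolicPair X}
    (hR : ∀ x, η.abs * x = x → x * η.abs = x → ∃ y, f.onR y = x) {e : Y.R} (he : f.onR e = η.ep)
    {k : ℕ} (h : SrLE X η.ep k) : SrLE Y e k := by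
  have ha : η.abs * f.onR e = f.onR e := by rw [he, η.abs_mul_ep]
  have hb : f.onR e * η.abs = f.onR e := by rw [he, η.ep_mul_abs]
  rintro x hx ⟨y, hy, hs⟩
  rw [← he] at h
  obtain ⟨a, h1, z, h2, h3⟩ := h (fun i => f.onR (x i)) (fun i => map_mem_peirce f (hx i))
    ⟨fun i => f.onR (y i), fun i => map_mem_peirce f (hy i), by
      simp only [← map_mul, ← map_sum, hs]⟩
  choose a' h4 h5 using fun i => exists_preimage_peirce f hf hR ha hb (h1 i)
  choose z' h6 h7 using fun i => exists_preimage_peirce f hf hR ha hb (h2 i)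
  refine ⟨a', h4, z', h6, hf ?_⟩
  simp only [map_sum, map_mul, map_add, h5, h7]
  exact h3

theorem em_mul_sum_abs {n : ℕ} (H : FreeHyperbolicFamily X n) (i : Fin n) :
    (H.pair i).em * ∑ j, (H.pair j).abs = (H.pair i).em := by
  rw [Finset.mul_sum, Finset.sum_eq_single_of_mem i (Finset.mem_univ i), HyperbolicPair.em_mul_abs]
  intro j _ hj
  rw [HyperbolicPair.abs, mul_add, (H.orthogonal i j (Ne.symm hj)).mul_eq_zero.2.2.1,
    (H.orthogonal i j (Ne.symm hj)).mul_eq_zero.2.2.2, add_zero]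

/-- The condition on `Λsr` is inherited by subrings containing the Peirce component of `η_1`. -/
theorem LambdaSrLE_of_hom {n n' : ℕ} (H : FreeHyperbolicFamily X n)
    (H' : FreeHyperbolicFamily Y n') (hn : 1 ≤ n) (hn' : 1 ≤ n') (f : OddFormHom Y X)
    (hf : Function.Injective f.onR)
    (he : f.onR (H'.pair (H'.first hn')).ep = (H.pair (H.first hn)).ep)
    (hR : ∀ x, (H.pair (H.first hn)).abs * x = x → x * (H.pair (H.first hn)).abs = x →
      ∃ y, f.onR y = x)
    (hD : ∀ u, X.act u (H.pair (H.first hn)).em = u → X.pi u = 0 → ∃ w, f.onD w = u) {k : ℕ}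
    (h : H.LambdaSrLE hn k) : H'.LambdaSrLE hn' k := by
  set η := H.pair (H.first hn) with hη
  set η' := H'.pair (H'.first hn') with hη'
  have he' : f.onR η'.em = η.em := by rw [← η.star_ep, ← he, ← f.map_star, η'.star_ep]
  have ap : η.abs * f.onR η'.ep = f.onR η'.ep := by rw [he, η.abs_mul_ep]
  have pa : f.onR η'.ep * η.abs = f.onR η'.ep := by rw [he, η.ep_mul_abs]
  have ma : f.onR η'.em * η.abs = f.onR η'.em := by rw [he', η.em_mul_abs]
  refine ⟨SrLE_of_hom f hf hR he h.1, ?_⟩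
  rintro xp xm hxp hxm ⟨yp, ym, hyp, hym, hs⟩
  have h' := h.2
  change ∀ xp xm : Fin (k + 1) → X.R, (∀ i, xp i ∈ peirce X η.ep η.ep) →
    (∀ i, xm i ∈ peirce X η.em η.ep) → (∃ yp ym : Fin (k + 1) → X.R,
      (∀ i, yp i ∈ peirce X η.ep η.ep) ∧ (∀ i, ym i ∈ peirce X η.ep η.em) ∧
      ∑ i, ym i * xm i + ∑ i, yp i * xp i = η.ep) →
    ∃ a : Fin (k + 1) → Fin (k + 1) → X.R, (∀ i j, a i j ∈ peirce X η.ep η.em) ∧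
      (∀ i j, a i j = -star (a j i)) ∧ (∀ i, a i i ∈ H.evenParam) ∧
      ∃ z : Fin (k + 1) → X.R, (∀ i, z i ∈ peirce X η.ep η.ep) ∧
        ∑ i, z i * (xp i + ∑ j, a i j * xm j) = η.ep at h'
  rw [← he, ← he'] at h'
  obtain ⟨a, h1, h2, h3, z, h4, h5⟩ := h' (fun i => f.onR (xp i)) (fun i => f.onR (xm i))
    (fun i => map_mem_peirce f (hxp i)) (fun i => map_mem_peirce f (hxm i))
    ⟨fun i => f.onR (yp i), fun i => f.onR (ym i), fun i => map_mem_peirce f (hyp i),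
      fun i => map_mem_peirce f (hym i), by
      simp only [← map_mul, ← map_sum, ← map_add]
      exact congrArg f.onR hs⟩
  choose a' ha1 ha2 using fun i j => exists_preimage_peirce f hf hR ap ma (h1 i j)
  choose z' hz1 hz2 using fun i => exists_preimage_peirce f hf hR ap pa (h4 i)
  refine ⟨a', ha1, fun i j => hf ?_, fun i => ?_, z', hz1, hf ?_⟩
  · rw [map_neg, f.map_star, ha2, ha2, ← h2]
  · obtain ⟨w, -, hw2, hw3⟩ := h3 i
    -- The witness w of the even parameter lies in Δ · e_{0'}, which f need not reach. Cutting it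
    -- down by e_{-1} brings it into the image, and ρ does not change because the diagonal entry
    -- already lies in e_1Re_{-1}.
    obtain ⟨w', hw'⟩ := hD (X.act w η.em) (by rw [X.act_act, η.em_mul_em])
      (by rw [X.pi_act, hw2, zero_mul])
    have hmem : f.onR (η'.ep) * f.onR (a' i i) * f.onR (η'.em) = f.onR (a' i i) :=
      map_mem_peirce f (ha1 i i)
    refine ⟨Y.act w' η'.em, ?_, hf ?_, hf ?_⟩
    · rw [Y.act_act, H'.em_mul_sum_abs]
    · rw [f.map_pi, f.map_act, hw', X.pi_act, X.pi_act, hw2, map_zero]; simp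
    · rw [f.map_rho, f.map_act, hw', he', X.act_act, η.em_mul_em, X.rho_act, hw3, η.star_em,
        ← ha2, ← he, ← he', hmem]
  · simp only [map_sum, map_mul, map_add, ha2, hz2]
    exact h5

/-- The subfamily of the first members. -/
def take {n : ℕ} (H : FreeHyperbolicFamily X n) (m : ℕ) (hm : m ≤ n) :
    FreeHyperbolicFamily X m where
  pair i := H.pair (Fin.castLE hm i)
  orthogonal _ _ h := H.orthogonal _ _ fun h' => h (Fin.castLE_injective hm h')
  unit i j := H.unit (Fin.castLE hm i) (Fin.castLE hm j)
  unit_self _ := H.unit_self _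
  unit_mul _ _ _ := H.unit_mul _ _ _

/-- The isometry of `e_{|j|}` with `e_{|i|}`. -/
def isometry {n : ℕ} (H : FreeHyperbolicFamily X n) {i j : Fin n} (hij : i ≠ j) :
    Isometry X (H.pair i).abs (H.pair j).abs where
  alpha := H.absUnit i j
  -- Without the last summand ρ would be -2e_j; φ(e_j) contributes e_j - e_{-j}, which gives the
  -- required -e_{|j|}.
  gamma := X.act (H.pair i).qm (star (H.unit j i)) + X.act (H.pair i).qp (H.unit i j) +
    (-(H.pair j).qm + -(H.pair j).qp) + X.phi (H.pair j).ep
  left_mul := H.abs_mul_absUnit i j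
  mul_right := H.absUnit_mul_abs i j
  star_mul := by
    rw [absUnit, star_add, star_star, add_comm]
    exact H.absUnit_mul_absUnit j i
  mul_star := by
    rw [absUnit, star_add, star_star, add_comm (star _)]
    exact H.absUnit_mul_absUnit i j
  gamma_act := by
    have h1 : (H.pair j).ep * (H.pair j).abs = (H.pair j).ep := (H.pair j).ep_mul_abs
    have h2 (η : HyperbolicPair X) : X.act η.qm η.abs = η.qm := by
      conv_lhs => rw [← η.qm_act]
      rw [X.act_act, η.em_mul_abs, η.qm_act]
    have h3 (η : HyperbolicPair X) : X.act η.qp η.abs = η.qp := by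
      conv_lhs => rw [← η.qp_act]
      rw [X.act_act, η.ep_mul_abs, η.qp_act]
    have h4 : star (H.unit j i) * (H.pair j).abs = star (H.unit j i) := by
      rw [← H.star_unit_mul_em, mul_assoc, HyperbolicPair.em_mul_abs]
    have h5 : H.unit i j * (H.pair j).abs = H.unit i j := by
      rw [← H.unit_mul_ep, mul_assoc, HyperbolicPair.ep_mul_abs]
    simp only [X.add_act, X.neg_act, X.act_act, h2, h3, h4, h5, ← X.phi_conj,
      proj_star (H.pair j).abs_proj, (H.pair j).ep_mul_abs, (H.pair j).abs_mul_ep]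
  pi_gamma := by
    simp only [X.pi_add, X.pi_neg, X.pi_act, X.pi_phi, HyperbolicPair.pi_qm, HyperbolicPair.pi_qp,
      H.em_mul_star_unit, H.ep_mul_unit, absUnit, HyperbolicPair.abs]
    abel
  rho_gamma := by
    have a1 : X.rho (-(H.pair j).qm) = 0 := by
      rw [← X.star_rho, HyperbolicPair.rho_qm, star_zero]
    have a2 : X.rho (-(H.pair j).qp) = 0 := by
      rw [← X.star_rho, HyperbolicPair.rho_qp, star_zero]
    have a3 : H.unit j i * (H.pair j).em = 0 := by
      rw [← H.unit_mul_ep, mul_assoc, (H.orthogonal i j hij).mul_eq_zero.2.1, mul_zero]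
    have a4 : H.unit j i * (H.pair j).ep = 0 := by
      rw [← H.unit_mul_ep, mul_assoc, (H.orthogonal i j hij).mul_eq_zero.1, mul_zero]
    have a5 : star (H.unit i j) * (H.pair j).em = 0 := by
      rw [← H.star_unit_mul_em, mul_assoc, (H.orthogonal i j hij).mul_eq_zero.2.2.2, mul_zero]
    have a6 : star (H.unit i j) * (H.pair j).ep = 0 := by
      rw [← H.star_unit_mul_em, mul_assoc, (H.orthogonal i j hij).mul_eq_zero.2.2.1, mul_zero]
    simp only [X.rho_add, X.rho_act, X.pi_add, X.pi_neg, X.pi_act, X.pi_phi, HyperbolicPair.pi_qm,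
      HyperbolicPair.pi_qp, HyperbolicPair.rho_qm, HyperbolicPair.rho_qp, a1, a2, X.rho_phi,
      H.em_mul_star_unit, H.ep_mul_unit, absUnit, HyperbolicPair.abs, star_star, star_add,
      star_sub, star_neg, H.unit_mul, H.unit_self, HyperbolicPair.star_em, HyperbolicPair.star_ep,
      mul_neg, neg_mul, mul_add, add_mul, sub_mul, a3, a4, a5, a6, (H.pair j).ep_mul_ep,
      (H.pair j).em_mul_em, (H.pair j).em_mul_ep, (H.pair j).ep_mul_em, mul_zero, zero_mul]
    abel

variable {n : ℕ} (H : FreeHyperbolicFamily X n)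

theorem uconj_absLast (hn : 1 ≤ n) (h : H.LambdaSrLE hn (n - 1)) {ε : X.R}
    (i : Isometry X ε (H.absLast hn)) : UConj ε (H.absLast hn) := by
  obtain ⟨k, rfl⟩ : ∃ k, n = k + 1 := ⟨n - 1, by omega⟩
  exact H.uconj_of_LambdaSrLE h i

/-- The isometry of `e_{|n-1|}` with `e_{|n|}`. -/
def isometryLast (hn : 1 ≤ n) (hn2 : 1 ≤ n - 1) :
    Isometry X (H.absLast hn) ((H.corner hn).absLast hn2).1 :=
  H.isometry (i := H.last hn) (j := ⟨n - 1 - 1, by omega⟩) (by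
    intro h
    have h' : n - 1 = n - 1 - 1 := congrArg Fin.val h
    omega)

theorem LambdaSrLE_take (hn : 1 ≤ n) (hn2 : 1 ≤ n - 1) {k : ℕ} (h : H.LambdaSrLE hn k) :
    (H.take (n - 1) (Nat.sub_le n 1)).LambdaSrLE hn2 k :=
  H.LambdaSrLE_of_hom _ hn hn2 (1 : OddFormHom X X) (fun _ _ h => h) rfl
    (fun x _ _ => ⟨x, rfl⟩) (fun u _ _ => ⟨u, rfl⟩) h

/-- The bound n - 2 is the one needed for the subfamily η_1, …, η_{n-1}. As e_{|n|} is isometric to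
e_{|n-1|}, both ε and e_{|n|} are conjugate to e_{|n-1|}. In this way monotonicity of Λsr in the
bound is not needed. -/
theorem uconj_absLast_of_sub_two (hn : 1 ≤ n) (hn2 : 1 ≤ n - 1) (h : H.LambdaSrLE hn (n - 2))
    {ε : X.R} (i : Isometry X ε (H.absLast hn)) : UConj ε (H.absLast hn) := by
  have h1 := H.LambdaSrLE_take hn hn2 h
  have key {ε : X.R} (i : Isometry X ε (H.absLast hn)) :
      UConj ε ((H.take (n - 1) (Nat.sub_le n 1)).absLast hn2) :=
    (H.take (n - 1) (Nat.sub_le n 1)).uconj_absLast hn2 h1 (i.trans (H.isometryLast hn hn2))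
  obtain ⟨g, hg⟩ := key (Isometry.refl (H.absLast_proj hn))
  refine (key i).trans ⟨g⁻¹, ?_⟩
  rw [← hg, ← OddFormHom.comp_onR, ← innHom_mul, inv_mul_cancel, innHom_one]; rfl

theorem corner_first_orthogonal (hn : 1 ≤ n) (hn2 : 1 ≤ n - 1) :
    (H.pair (H.first hn)).Orthogonal (H.pair (H.last hn)) :=
  H.orthogonal _ _ fun h => by
    have h' : 0 = n - 1 := congrArg Fin.val h
    omega

theorem mem_cornerSub_of_first (hn : 1 ≤ n) (hn2 : 1 ≤ n - 1) {x : X.R}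
    (h1 : (H.pair (H.first hn)).abs * x = x) (h2 : x * (H.pair (H.first hn)).abs = x) :
    x ∈ (cornerSub X (H.absLast hn) (H.absLast_proj hn)).ring := by
  have ho := H.corner_first_orthogonal hn hn2
  constructor
  · rw [← h1, ← mul_assoc]
    change (H.pair (H.last hn)).abs * _ * _ = 0
    rw [ho.2, zero_mul]
  · rw [← h2, mul_assoc]
    change _ * (_ * (H.pair (H.last hn)).abs) = 0
    rw [ho.1, mul_zero]

theorem mem_cornerSub_of_act_first (hn : 1 ≤ n) (hn2 : 1 ≤ n - 1) {u : X.D}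
    (h1 : X.act u (H.pair (H.first hn)).em = u) (h2 : X.pi u = 0) :
    u ∈ (cornerSub X (H.absLast hn) (H.absLast_proj hn)).grp := by
  refine ⟨?_, by rw [h2]; simp, by rw [h2]; simp⟩
  have h3 : (H.pair (H.first hn)).em * H.absLast hn = 0 := by
    rw [← HyperbolicPair.em_mul_abs, mul_assoc]
    change _ * (_ * (H.pair (H.last hn)).abs) = 0
    rw [(H.corner_first_orthogonal hn hn2).1, mul_zero]
  rw [← h1, X.act_act1, mul_neg, h3, neg_zero, add_zero]

/-- For n ≥ 2 the pair η_1 is orthogonal to η_n, so the Peirce component of η_1 lies entirely in the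
corner. -/
theorem LambdaSrLE_corner (hn : 1 ≤ n) (hn2 : 1 ≤ n - 1) {k : ℕ} (h : H.LambdaSrLE hn k) :
    (H.corner hn).LambdaSrLE hn2 k :=
  H.LambdaSrLE_of_hom _ hn hn2 (OddFormSubring.incl _) Subtype.val_injective rfl
    (fun x h1 h2 => ⟨⟨x, H.mem_cornerSub_of_first hn hn2 h1 h2⟩, rfl⟩)
    (fun u h1 h2 => ⟨⟨u, H.mem_cornerSub_of_act_first hn hn2 h1 h2⟩, rfl⟩) h

end FreeHyperbolicFamily

end Transfer

end OddForm

namespace OddForm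

/-! ### Generation by a corner and an isometry; uniqueness of extensions -/

section Corners

variable {X : OddFormRing.{u, v}} {Y : OddFormRing.{u₁, v₁}}

theorem act_neg_proj (v : X.D) {e : X.R} (he : IsStarProjection e) :
    X.act v (-e) = X.phi (e * X.rho v * e) + -X.act v e := by
  have h := X.act_add v e (-e)
  rw [add_neg_cancel, X.act_zero, star_neg, proj_star he, neg_mul, neg_mul, X.phi_neg] at h
  rw [eq_neg_of_add_eq_zero_right h.symm, neg_add_rev, neg_neg]

/-- The decomposition of an element of `Δ` defined by a hermitian idempotent. -/
theorem eq_act1_add_act (v : X.D) {e : X.R} (he : IsStarProjection e) :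
    v = X.act1 v (-e) + X.act v e + X.phi (e * X.rho v - e * X.rho v * e) := by
  rw [OddFormRing.act1, act_neg_proj v he, star_neg, proj_star he]
  simp only [add_assoc, neg_add_cancel_left, ← X.phi_add]
  rw [show -e * X.rho v + (e * X.rho v * e + (e * X.rho v - e * X.rho v * e)) = 0 by
    rw [neg_mul]; abel, X.phi_zero, add_zero]

namespace Isometry

variable {e e₁ : X.R} (i : Isometry X e e₁)

/-- The relations for an isometry between orthogonal hermitian idempotents. -/
theorem orthogonal_relations (h : e * e₁ = 0) :
    e₁ * e = 0 ∧ e₁ * i.alpha = 0 ∧ i.alpha * e = 0 ∧ i.alpha * i.alpha = 0 ∧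
      e * star i.alpha = 0 ∧ star i.alpha * e₁ = 0 ∧ star i.alpha * star i.alpha = 0 ∧
      X.rho i.gamma = -e₁ := by
  have h1 : e₁ * e = 0 := by
    have h2 := congrArg star h
    rwa [StarMul.star_mul, i.star_left, i.star_right, star_zero] at h2
  have h2 : e₁ * i.alpha = 0 := by rw [← i.left_mul, ← mul_assoc, h1, zero_mul]
  have h3 : i.alpha * e = 0 := by rw [← i.mul_right, mul_assoc, h1, mul_zero]
  have h4 : e * star i.alpha = 0 := by rw [← i.right_mul_star, ← mul_assoc, h, zero_mul]
  have h5 : star i.alpha * e₁ = 0 := by rw [← i.star_mul_left, mul_assoc, h, mul_zero]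
  have h6 : i.alpha * i.alpha = 0 := by
    nth_rewrite 1 [← i.mul_right]
    rw [mul_assoc, h2, mul_zero]
  refine ⟨h1, h2, h3, h6, h4, h5, ?_, ?_⟩
  · rw [← StarMul.star_mul, h6, star_zero]
  · rw [i.rho_gamma, star_sub, i.star_right, sub_mul, h5, i.mul_self_right, zero_sub]

end Isometry

/-- An odd form ring is generated by the corner of `1 - e` and an isometry of an idempotent of the
corner with `e`. -/
theorem OddFormSubring.eq_top_of_isometry (A : OddFormSubring X) {e e₁ : X.R}
    (he : IsStarProjection e) (i : Isometry X e e₁) (h : e * e₁ = 0)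
    (hR : ∀ x ∈ (cornerSub X e he).ring, x ∈ A.ring)
    (hD : ∀ u ∈ (cornerSub X e he).grp, u ∈ A.grp) (hα : i.alpha ∈ A.ring)
    (hγ : i.gamma ∈ A.grp) : (∀ x, x ∈ A.ring) ∧ ∀ u, u ∈ A.grp := by
  obtain ⟨h1, h2, h3, h4, h5, h6, h7, h8⟩ := i.orthogonal_relations h
  set q := i.alpha with hq
  set s := star q with hs
  have eq' : e * q = q := i.left_mul
  have es : s * e = s := i.star_mul_left
  have qs : q * s = e := i.mul_star
  have hsA : s ∈ A.ring := A.star_mem hα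
  have r10 (x : X.R) : s * x - s * x * e ∈ (cornerSub X e he).ring := by
    constructor
    · simp only [mul_sub, ← mul_assoc, h5, zero_mul, sub_zero]
    · simp only [sub_mul, mul_assoc, proj_mul he, sub_self]
  have r01 (x : X.R) : x * q - e * x * q ∈ (cornerSub X e he).ring := by
    constructor
    · simp only [mul_sub, ← mul_assoc, proj_mul he, sub_self]
    · simp only [sub_mul, mul_assoc, h3, mul_zero, sub_zero]
  have r11 (x : X.R) : s * x * q ∈ (cornerSub X e he).ring := by
    constructor
    · simp only [← mul_assoc, h5, zero_mul]
    · simp only [mul_assoc, h3, mul_zero]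
  have r00 (x : X.R) : x - e * x - x * e + e * x * e ∈ (cornerSub X e he).ring := by
    constructor
    · simp only [mul_sub, mul_add, ← mul_assoc, proj_mul he]; abel
    · simp only [sub_mul, add_mul, mul_assoc, proj_mul he]; abel
  have hRall (x : X.R) : x ∈ A.ring := by
    -- Peirce decomposition with respect to e; as e = qs, every factor e is moved into the corner by
    -- q and s.
    have hx : x = (x - e * x - x * e + e * x * e) + q * (s * x - s * x * e) +
        (x * q - e * x * q) * s + q * (s * x * q) * s := by
      simp only [mul_sub, sub_mul, ← mul_assoc, qs]
      simp only [mul_assoc, qs]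
      abel
    rw [hx]
    exact add_mem (add_mem (add_mem (hR _ (r00 x)) (mul_mem hα (hR _ (r10 x))))
      (mul_mem (hR _ (r01 x)) hsA)) (mul_mem (mul_mem hα (hR _ (r11 x))) hsA)
  refine ⟨hRall, fun v => ?_⟩
  have hc1 (x : X.R) : e * X.pi (X.act i.gamma (s * x)) = e * x := by
    rw [X.pi_act, i.pi_gamma, sub_mul, ← hq, ← mul_assoc, qs, ← mul_assoc, i.right_mul_star, mul_sub,
      ← mul_assoc, proj_mul he, ← mul_assoc e, h5, zero_mul, sub_zero]
  have hc2 (x : X.R) (hx : x * e = 0) : X.act1 (X.act i.gamma (s * x)) (-e) =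
      X.act i.gamma (s * x) := by
    rw [X.act_act1, mul_neg, mul_assoc, hx, mul_zero, neg_zero, add_zero]
  -- An element of Δ · (1 - e) fails to lie in the corner only by the part eπ(w), and γ · (sπ(w))
  -- has the same part.
  have key (w : X.D) (hw : X.act1 w (-e) = w) :
      w ∈ A.grp := by
    have hwe : X.pi w * e = 0 := by
      rw [← hw, X.pi_act1, add_mul, mul_assoc, neg_mul, proj_mul he, mul_neg, add_neg_cancel]
    have h9 : w + -X.act i.gamma (s * X.pi w) ∈ (cornerSub X e he).grp := by
      refine ⟨?_, ?_, ?_⟩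
      · rw [X.add_act1, hw, X.neg_act1, hc2 _ hwe]
      · rw [X.pi_add, X.pi_neg, mul_add, mul_neg, hc1, add_neg_cancel]
      · rw [X.pi_add, X.pi_neg, add_mul, hwe, X.pi_act, neg_mul, mul_assoc, mul_assoc, hwe]
        simp
    have h10 := A.grp.add_mem (hD _ h9) (A.act_mem hγ (hRall (s * X.pi w)))
    rwa [add_assoc, neg_add_cancel, add_zero] at h10
  rw [eq_act1_add_act v he]
  refine add_mem (add_mem (key _ ?_) ?_) (A.phi_mem (hRall _))
  · rw [X.act1_act1, neg_mul, mul_neg, neg_neg, proj_mul he, neg_add_cancel_right]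
  -- The summand v · e equals (v · q) · s, and v · q is fixed by 1 - e.
  · rw [← qs, ← X.act_act]
    refine A.act_mem (key _ ?_) hsA
    rw [X.act_act1, mul_neg, h3, neg_zero, add_zero]

/-- The odd form subring of all elements on which two morphisms are equal. -/
def OddFormHom.eqLocus (f g : OddFormHom Y X) : OddFormSubring Y where
  ring :=
    { carrier := {x | f.onR x = g.onR x}
      zero_mem' := by simp
      add_mem' := fun {a b} ha hb => by
        change f.onR _ = g.onR _
        rw [map_add, map_add, show f.onR a = g.onR a from ha, show f.onR b = g.onR b from hb]
      neg_mem' := fun {a} ha => by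
        change f.onR _ = g.onR _
        rw [map_neg, map_neg, show f.onR a = g.onR a from ha]
      mul_mem' := fun {a b} ha hb => by
        change f.onR _ = g.onR _
        rw [map_mul, map_mul, show f.onR a = g.onR a from ha, show f.onR b = g.onR b from hb] }
  grp := f.onD.eqLocus g.onD
  star_mem := fun {x} hx => by
    change f.onR _ = g.onR _
    rw [f.map_star, g.map_star, show f.onR x = g.onR x from hx]
  act_mem := fun {u x} hu hx => by
    change f.onD _ = g.onD _
    rw [f.map_act, g.map_act, show f.onD u = g.onD u from hu, show f.onR x = g.onR x from hx]
  phi_mem := fun {x} hx => by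
    change f.onD _ = g.onD _
    rw [f.map_phi, g.map_phi, show f.onR x = g.onR x from hx]
  pi_mem := fun {x} hx => by
    change f.onR _ = g.onR _
    rw [f.map_pi, g.map_pi, show f.onD x = g.onD x from hx]
  rho_mem := fun {x} hx => by
    change f.onR _ = g.onR _
    rw [f.map_rho, g.map_rho, show f.onD x = g.onD x from hx]

/-- A morphism is determined by its restriction to a corner and the image of an isometry. -/
theorem OddFormHom.ext_of_isometry {f g : OddFormHom Y X} {e e₁ : Y.R}
    (he : IsStarProjection e) (i : Isometry Y e e₁) (h : e * e₁ = 0)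
    (hR : ∀ x ∈ (cornerSub Y e he).ring, f.onR x = g.onR x)
    (hD : ∀ u ∈ (cornerSub Y e he).grp, f.onD u = g.onD u) (hα : f.onR i.alpha = g.onR i.alpha)
    (hγ : f.onD i.gamma = g.onD i.gamma) : f = g := by
  have h := (f.eqLocus g).eq_top_of_isometry he i h hR hD hα hγ
  exact OddFormHom.ext h.1 h.2

/-- The odd form subring of all elements on which two morphisms are congruent modulo an ideal. -/
def OddFormIdeal.congrLocus (I : OddFormIdeal X) (f g : OddFormHom Y X) : OddFormSubring Y where
  ring :=
    { carrier := {x | (f.onR x, g.onR x) ∈ I.doubleSub.ring}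
      zero_mem' := by
        rw [Set.mem_ofPred_eq, map_zero, map_zero]
        exact I.doubleSub.ring.zero_mem
      add_mem' := fun {a b} ha hb => by
        rw [Set.mem_ofPred_eq, map_add, map_add]
        exact I.doubleSub.ring.add_mem ha hb
      neg_mem' := fun {a} ha => by
        rw [Set.mem_ofPred_eq, map_neg, map_neg]
        exact I.doubleSub.ring.neg_mem ha
      mul_mem' := fun {a b} ha hb => by
        rw [Set.mem_ofPred_eq, map_mul, map_mul]
        exact I.doubleSub.ring.mul_mem ha hb }
  grp :=
    { carrier := {u | (f.onD u, g.onD u) ∈ I.doubleSub.grp}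
      zero_mem' := by
        rw [Set.mem_ofPred_eq, map_zero, map_zero]
        exact I.doubleSub.grp.zero_mem
      add_mem' := fun {a b} ha hb => by
        rw [Set.mem_ofPred_eq, map_add, map_add]
        exact I.doubleSub.grp.add_mem ha hb
      neg_mem' := fun {a} ha => by
        rw [Set.mem_ofPred_eq, map_neg, map_neg]
        exact I.doubleSub.grp.neg_mem ha }
  star_mem := fun {x} hx => by
    change (_, _) ∈ I.doubleSub.ring
    rw [f.map_star, g.map_star]
    exact I.doubleSub.star_mem hx
  act_mem := fun {u x} hu hx => by
    change (_, _) ∈ I.doubleSub.grp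
    rw [f.map_act, g.map_act]
    exact I.doubleSub.act_mem hu hx
  phi_mem := fun {x} hx => by
    change (_, _) ∈ I.doubleSub.grp
    rw [f.map_phi, g.map_phi]
    exact I.doubleSub.phi_mem hx
  pi_mem := fun {x} hx => by
    change (_, _) ∈ I.doubleSub.ring
    rw [f.map_pi, g.map_pi]
    exact I.doubleSub.pi_mem hx
  rho_mem := fun {x} hx => by
    change (_, _) ∈ I.doubleSub.ring
    rw [f.map_rho, g.map_rho]
    exact I.doubleSub.rho_mem hx

theorem OddFormHom.smul_onR (g : U X) (f : OddFormHom Y X) (x : Y.R) :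
    (g • f).onR x = g.innHom.onR (f.onR x) := rfl

theorem OddFormHom.smul_onD (g : U X) (f : OddFormHom Y X) (x : Y.D) :
    (g • f).onD x = g.innHom.onD (f.onD x) := rfl

theorem innHom_onR_eq_self_iff (g : U X) (x : X.R) :
    g.innHom.onR x = x ↔ x * g.beta = g.beta * x := by
  rw [U.innHom_onR]
  constructor
  · intro h
    have h2 := congrArg (fun z => z + z * g.beta) h
    simp only [add_mul, mul_assoc, U.star_mul_eq, mul_sub, mul_neg] at h2
    have h3 : x + g.beta * x = x + x * g.beta := by
      rw [← h2]; abel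
    exact (add_left_cancel h3).symm
  · intro h
    rw [← h, mul_assoc, U.mul_star_eq, mul_sub, mul_neg]
    abel

theorem mem_blockU_iff {e : X.R} (he : IsStarProjection e) (g : U X) :
    g ∈ blockU e he ↔ g.innHom.onR e = e := (innHom_onR_eq_self_iff g e).symm

theorem smul_mem_homFix {e : Y.R} {ε : X.R} (hε : IsStarProjection ε) {g : U X}
    (hg : g ∈ blockU ε hε) {f : OddFormHom Y X} (hf : f ∈ homFix e ε) : g • f ∈ homFix e ε := by
  change g.innHom.onR (f.onR e) = ε
  rw [show f.onR e = ε from hf]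
  exact (mem_blockU_iff hε g).1 hg

/-- The block diagonal elements act on the corner via their projections. -/
theorem innHom_resU {e : X.R} (he : IsStarProjection e) (g : blockU e he) :
    (∀ x : (Corner X e he).R, ((resU e he g).innHom.onR x).1 = g.1.innHom.onR x.1) ∧
      ∀ u : (Corner X e he).D, ((resU e he g).innHom.onD u).1 = g.1.innHom.onD u.1 := by
  have hg : e * g.1.beta = g.1.beta * e := g.2
  have hs : star g.1.beta * e = e * star g.1.beta := by
    have h := congrArg star hg
    rwa [star_mul, star_mul, proj_star he] at h
  constructor
  · rintro ⟨x, hx1, hx2⟩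
    change x + (g.1.beta - e * g.1.beta) * x + x * star (g.1.beta - e * g.1.beta) +
      (g.1.beta - e * g.1.beta) * x * star (g.1.beta - e * g.1.beta) =
      x + g.1.beta * x + x * star g.1.beta + g.1.beta * x * star g.1.beta
    have h1 : (g.1.beta - e * g.1.beta) * x = g.1.beta * x := by
      rw [hg, sub_mul, mul_assoc, hx1, mul_zero, sub_zero]
    have h2 (y : X.R) (hy : y * e = 0) : y * star (g.1.beta - e * g.1.beta) = y * star g.1.beta := by
      rw [star_sub, star_mul, proj_star he, hs, mul_sub, ← mul_assoc, hy, zero_mul, sub_zero]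
    rw [h1, h2 x hx2, h2 _ (by rw [mul_assoc, hx2, mul_zero])]
  · rintro ⟨u, hu1, hu2, hu3⟩
    change X.act1 (X.act (X.act1 g.1.gamma (-e)) (X.pi u) + u) (star (g.1.beta - e * g.1.beta)) =
      X.act1 (X.act g.1.gamma (X.pi u) + u) (star g.1.beta)
    rw [X.act1_act, neg_mul, hu2, neg_zero, add_zero]
    have hw : X.act1 (X.act g.1.gamma (X.pi u) + u) (-e) = X.act g.1.gamma (X.pi u) + u := by
      rw [X.add_act1, hu1, X.act_act1, mul_neg, hu3, neg_zero, add_zero]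
    rw [← hw, X.act1_act1, X.act1_act1]
    congr 1
    rw [star_sub, star_mul, proj_star he, neg_mul, neg_mul, mul_sub, hs, proj_mul_assoc he]
    abel

/-- This equivariance is what makes restriction to the corner well defined on orbits of block
diagonal elements. -/
theorem toCorner_smul {e : Y.R} {ε : X.R} (he : IsStarProjection e) (hε : IsStarProjection ε)
    (g : blockU ε hε) {f : OddFormHom Y X} (hf : f ∈ homFix e ε) :
    (g.1 • f).toCorner he hε (smul_mem_homFix hε g.2 hf) =
      resU ε hε g • f.toCorner he hε hf := by
  have h := innHom_resU hε g
  ext x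
  · exact (h.1 ((f.toCorner he hε hf).onR x)).symm
  · exact (h.2 ((f.toCorner he hε hf).onD x)).symm

theorem incl_mapU_mem_blockU {e : X.R} (he : IsStarProjection e) (h : U (Corner X e he)) :
    (cornerSub X e he).incl.mapU h ∈ blockU e he := by
  change e * h.beta.1 = h.beta.1 * e
  rw [h.beta.2.1, h.beta.2.2]

/-- Extension by the identity on e splits the projection to the corner. -/
theorem resU_incl_mapU {e : X.R} (he : IsStarProjection e) (h : U (Corner X e he)) :
    resU e he ⟨_, incl_mapU_mem_blockU he h⟩ = h := by
  ext
  · change h.beta.1 - e * h.beta.1 = h.beta.1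
    rw [h.beta.2.1, sub_zero]
  · exact h.gamma.2.1

theorem incl_mapU_mem_unitary {e : X.R} (he : IsStarProjection e) {I : OddFormIdeal X}
    {h : U (Corner X e he)} (hI : h ∈ (I.restrict (cornerSub X e he)).unitary) :
    (cornerSub X e he).incl.mapU h ∈ I.unitary := by
  refine ⟨?_, hI.2⟩
  have h1 := hI.1
  rw [OddFormIdeal.restrict, TwoSidedIdeal.mem_mk'] at h1
  exact h1

/-- The element of `U(R, Δ)` given by an isometry of a hermitian idempotent with itself. -/
def Isometry.toU {e : X.R} (i : Isometry X e e) : U X where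
  beta := i.alpha - e
  gamma := i.gamma
  mul_star := by
    rw [star_sub, i.star_left, mul_sub, sub_mul, sub_mul, i.mul_star, i.right_mul_star,
      i.mul_right, i.mul_self_left]
    abel
  star_mul := by
    rw [star_sub, i.star_left, mul_sub, sub_mul, sub_mul, i.star_mul, i.star_mul_left,
      i.left_mul, i.mul_self_left]
    abel
  pi_gamma := i.pi_gamma
  rho_gamma := by
    rw [i.rho_gamma, star_sub, i.star_left, sub_mul, i.star_mul_left, i.mul_self_left]

/-- Morphisms that agree on a corner are conjugate. -/
theorem exists_smul_eq_of_eq_on_corner {e e₁ : Y.R} {ε : X.R} (he : IsStarProjection e)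
    (hε : IsStarProjection ε) (i : Isometry Y e e₁) (h : e * e₁ = 0) {f₁ f₂ : OddFormHom Y X}
    (h₁ : f₁ ∈ homFix e ε) (h₂ : f₂ ∈ homFix e ε)
    (hf : f₂.toCorner he hε h₂ = f₁.toCorner he hε h₁) :
    ∃ g : blockU ε hε, resU ε hε g = 1 ∧ g.1 • f₁ = f₂ ∧ ∀ I : OddFormIdeal X,
      (∀ x, f₂.onR x - f₁.onR x ∈ I.ideal) → (∀ u, f₂.onD u - f₁.onD u ∈ I.grp) →
      g.1 ∈ I.unitary := by
  have hR (x : Y.R) (hx : x ∈ (cornerSub Y e he).ring) : f₂.onR x = f₁.onR x :=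
    congrArg (fun f : OddFormHom (Corner Y e he) (Corner X ε hε) => (f.onR ⟨x, hx⟩).1) hf
  have hD (u : Y.D) (hu : u ∈ (cornerSub Y e he).grp) : f₂.onD u = f₁.onD u :=
    congrArg (fun f : OddFormHom (Corner Y e he) (Corner X ε hε) => (f.onD ⟨u, hu⟩).1) hf
  obtain ⟨r1, r2, r3, r4, r5, r6, r7, r8⟩ := i.orthogonal_relations h
  have he₁ : f₂.onR e₁ = f₁.onR e₁ := hR e₁ ⟨h, r1⟩
  have h₁' : f₁.onR e = ε := h₁
  have h₂' : f₂.onR e = ε := h₂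
  have iso (f : OddFormHom Y X) (hf : f.onR e = ε) (h' : f.onR e₁ = f₁.onR e₁) :
      ∃ j : Isometry X ε (f₁.onR e₁), j.alpha = f.onR i.alpha ∧ j.gamma = f.onD i.gamma := by
    rw [← hf, ← h']; exact ⟨i.map f, rfl, rfl⟩
  obtain ⟨a, ha, ha'⟩ := iso f₁ h₁ rfl
  obtain ⟨b, hb, hb'⟩ := iso f₂ h₂ he₁
  have hor : ε * f₁.onR e₁ = 0 := by rw [← h₁', ← map_mul, h, map_zero]
  -- The two morphisms send i to isometries a and b with the same source and target, because e₁ lies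
  -- in the corner. The element ba⁻¹ of the unitary group on ε acts trivially on the corner and
  -- carries a to b.
  obtain ⟨k, hk⟩ : ∃ k, k = (b.trans a.symm).toU := ⟨_, rfl⟩
  have kβ : k.beta = b.alpha * star a.alpha - ε := by rw [hk]; rfl
  have kγ : k.gamma = X.act (b.gamma + -a.gamma) (star a.alpha) := by
    rw [hk, X.add_act, X.neg_act]; rfl
  obtain ⟨s1, s2, s3, s4, s5, s6, s7, s8⟩ := a.orthogonal_relations hor
  have ek : ε * k.beta = k.beta := by
    rw [kβ, mul_sub, ← mul_assoc, b.left_mul, proj_mul hε]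
  have ke : k.beta * ε = k.beta := by
    rw [kβ, sub_mul, mul_assoc, a.star_mul_left, proj_mul hε]
  have hkb : k ∈ blockU ε hε := ek.trans ke.symm
  have ske : star k.beta * ε = star k.beta := by
    have h5 := congrArg star ek
    rwa [star_mul, proj_star hε] at h5
  have eks : ε * star k.beta = star k.beta := by
    have h5 := congrArg star ke
    rwa [star_mul, proj_star hε] at h5
  have hk1 : resU ε hε ⟨k, hkb⟩ = 1 := by
    ext
    · change k.beta - ε * k.beta = 0
      rw [ek, sub_self]
    · change X.act1 k.gamma (-ε) = 0
      rw [kγ, X.act_act1, mul_neg, a.star_mul_left, add_neg_cancel, X.act_zero]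
  have hkc := toCorner_smul he hε ⟨k, hkb⟩ h₁
  rw [hk1, one_smul, ← hf] at hkc
  refine ⟨⟨k, hkb⟩, hk1, ?_, ?_⟩
  · refine OddFormHom.ext_of_isometry he i h ?_ ?_ ?_ ?_
    · intro x hx
      exact congrArg (fun f : OddFormHom (Corner Y e he) (Corner X ε hε) => (f.onR ⟨x, hx⟩).1) hkc
    · intro x hx
      exact congrArg (fun f : OddFormHom (Corner Y e he) (Corner X ε hε) => (f.onD ⟨x, hx⟩).1) hkc
    · have h1 : a.alpha * star k.beta = 0 := by rw [← eks, ← mul_assoc, s3, zero_mul]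
      rw [OddFormHom.smul_onR, ← ha, ← hb, U.innHom_onR, mul_assoc k.beta, h1, mul_zero, add_zero,
        add_zero, kβ, sub_mul, mul_assoc, a.star_mul, b.mul_right, a.left_mul, add_sub_cancel]
    · have h2 : star a.alpha * X.pi a.gamma = f₁.onR e₁ := by
        rw [a.pi_gamma, mul_sub, a.star_mul, s6, sub_zero]
      rw [OddFormHom.smul_onD, ← ha', ← hb', U.innHom_onD, kγ, X.act_act, h2, X.add_act, X.neg_act,
        a.gamma_act, b.gamma_act, add_assoc, neg_add_cancel, add_zero, ← b.gamma_act, X.act_act1,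
        ← eks, ← mul_assoc, s1, zero_mul, add_zero]
  -- Both β and γ of k are differences of values of f₂ and f₁, multiplied by the adjoint of a. The
  -- choice of k does not depend on the ideal, so it serves the absolute and the relative case.
  · intro I hIR hID
    constructor
    · have h5 : k.beta = (f₂.onR i.alpha - f₁.onR i.alpha) * star a.alpha := by
        rw [kβ, sub_mul, ← ha, ← hb, a.mul_star]
      rw [h5]
      exact I.ideal.mul_mem_right _ _ (hIR _)
    · rw [kγ]
      refine I.act_mem ?_ _
      rw [ha', hb', ← sub_eq_add_neg]
      exact hID _

/-- Morphisms whose restrictions to a corner are conjugate are conjugate. -/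
theorem exists_smul_eq_of_conj_on_corner {e e₁ : Y.R} {ε : X.R} (he : IsStarProjection e)
    (hε : IsStarProjection ε) (i : Isometry Y e e₁) (h : e * e₁ = 0) {f₁ f₂ : OddFormHom Y X}
    (h₁ : f₁ ∈ homFix e ε) (h₂ : f₂ ∈ homFix e ε) (k : U (Corner X ε hε))
    (hf : f₂.toCorner he hε h₂ = k • f₁.toCorner he hε h₁) :
    ∃ g : blockU ε hε, resU ε hε g = k ∧ g.1 • f₁ = f₂ ∧ ∀ I : OddFormIdeal X,
      (∀ x, f₂.onR x - f₁.onR x ∈ I.ideal) → (∀ u, f₂.onD u - f₁.onD u ∈ I.grp) →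
      k ∈ (I.restrict (cornerSub X ε hε)).unitary → g.1 ∈ I.unitary := by
  -- Translating f₁ by the extension of k reduces to morphisms with equal restrictions.
  obtain ⟨k', hk'⟩ : ∃ k' : blockU ε hε, k' = ⟨_, incl_mapU_mem_blockU hε k⟩ := ⟨_, rfl⟩
  have hres : resU ε hε k' = k := by rw [hk', resU_incl_mapU]
  have h3 := toCorner_smul he hε k' h₁
  rw [hres, ← hf] at h3
  obtain ⟨g, hg1, hg2, hg3⟩ := exists_smul_eq_of_eq_on_corner he hε i h
    (smul_mem_homFix hε k'.2 h₁) h₂ h3.symm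
  refine ⟨g * k', by rw [map_mul, hg1, hres, one_mul], ?_, ?_⟩
  · rw [← hg2]
    exact mul_smul g.1 k'.1 f₁
  · intro I hIR hID hkI
    have hkI' : k'.1 ∈ I.unitary := by rw [hk']; exact incl_mapU_mem_unitary hε hkI
    have hkp := I.inn_mem hkI'
    refine mul_mem (hg3 I (fun x => ?_) fun u => ?_) hkI'
    · have h4 := I.ideal.sub_mem (hIR x) (hkp.1 (f₁.onR x))
      rw [sub_sub_sub_cancel_right] at h4
      exact h4
    · have h4 := I.grp.sub_mem (hID u) (hkp.2 (f₁.onD u))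
      rw [sub_eq_add_neg, neg_sub, sub_add_sub_cancel] at h4
      exact h4

/-- An element of the unitary group of an overring that acts trivially on a subring and has the
trivial component in the corner is trivial. -/
theorem eq_one_of_resU_eq_one {e e₁ : Y.R} (he : IsStarProjection e) (i : Isometry Y e e₁)
    (h : e * e₁ = 0) (f : OddFormHom Y X) (g : blockU (f.onR e) (f.map_proj he))
    (hr : resU _ _ g = 1) (hg : g.1 • f = f) : g = 1 := by
  have hε := f.map_proj he
  obtain ⟨j, hj⟩ : ∃ j : Isometry X (f.onR e) (f.onR e₁), j = i.map f := ⟨_, rfl⟩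
  have hor : f.onR e * f.onR e₁ = 0 := by rw [← map_mul, h, map_zero]
  obtain ⟨s1, s2, s3, s4, s5, s6, s7, s8⟩ := j.orthogonal_relations hor
  have hα : g.1.innHom.onR j.alpha = j.alpha := by
    rw [hj]; exact congrArg (fun f : OddFormHom _ _ => f.onR i.alpha) hg
  have hγ : g.1.innHom.onD j.gamma = j.gamma := by
    rw [hj]; exact congrArg (fun f : OddFormHom _ _ => f.onD i.gamma) hg
  have hb : g.1.beta - f.onR e * g.1.beta = 0 :=
    congrArg (fun k : U (Corner X _ hε) => (k.beta.1 : X.R)) hr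
  have hc : X.act1 g.1.gamma (-f.onR e) = 0 :=
    congrArg (fun k : U (Corner X _ hε) => (k.gamma.1 : X.D)) hr
  have hgb : f.onR e * g.1.beta = g.1.beta * f.onR e := g.2
  have hb' : g.1.beta = g.1.beta * f.onR e := by rw [← hgb]; exact sub_eq_zero.1 hb
  -- Here β is supported on f(e) and commutes with α, while αf(e) = 0; hence βα = 0, and
  -- multiplication by ᾱ gives β = 0.
  have hβ : g.1.beta = 0 := by
    rw [innHom_onR_eq_self_iff, hb', mul_assoc, j.left_mul, ← hgb, ← mul_assoc, s3, zero_mul] at hα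
    have h0 := congrArg (g.1.beta * ·) j.mul_star
    simp only [← mul_assoc, ← hα, zero_mul] at h0
    rw [hb', ← h0]
  have h1 : X.act g.1.gamma (f.onR e₁) = 0 := by
    have h2 : X.act (X.act1 g.1.gamma (-f.onR e)) (f.onR e₁) = 0 := by rw [hc, X.zero_act]
    rwa [X.act1_act, neg_mul, hor, neg_zero, add_zero] at h2
  have h2 : X.act g.1.gamma (star j.alpha) = 0 := by
    rw [← j.right_mul_star, ← X.act_act, h1, X.zero_act]
  have h3 : X.act g.1.gamma (X.pi j.gamma) = 0 := by
    rw [U.innHom_onD, hβ, star_zero, X.act1_zero] at hγ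
    exact add_eq_right.1 hγ
  have hρ : X.rho g.1.gamma = 0 := by rw [U.rho_gamma, hβ, star_zero]
  have h4 : X.act g.1.gamma (f.onR e) = 0 := by
    -- The element γ(g) is annihilated by π(γ) of the isometry, because g fixes that vector, and by
    -- ᾱ, because its corner component is zero. These two generate f(e).
    have h5 : f.onR e = X.pi j.gamma * star j.alpha + star j.alpha := by
      rw [j.pi_gamma, sub_mul, j.mul_star, j.right_mul_star, sub_add_cancel]
    refine (congrArg (X.act g.1.gamma) h5).trans ?_
    rw [X.act_add, ← X.act_act, h3, h2, hρ]
    simp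
  apply Subtype.ext
  ext
  · exact hβ
  · change g.1.gamma = 0
    rw [eq_act1_add_act g.1.gamma hε, hc, h4, hρ]
    simp

end Corners

end OddForm

namespace OddForm

/-! ### Two by two matrices over a subring of the corner -/

section Amplification

variable {X : OddFormRing.{u, v}}

namespace Isometry

variable {e e₁ : X.R} (i : Isometry X e e₁)

/-- The components of an element of `R` with respect to `1 - e` and `e`, transported to the corner
of `1 - e` by an isometry. -/
def comp₀₀ (_ : Isometry X e e₁) (x : X.R) : X.R := x - e * x - x * e + e * x * e
/-- See `comp₀₀`. -/
def comp₁₀ (x : X.R) : X.R := star i.alpha * x - star i.alpha * x * e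
/-- See `comp₀₀`. -/
def comp₀₁ (x : X.R) : X.R := x * i.alpha - e * x * i.alpha
/-- See `comp₀₀`. -/
def comp₁₁ (x : X.R) : X.R := star i.alpha * x * i.alpha

/-- All components of an element belong to a subring. -/
def HasComps (A : OddFormSubring X) (x : X.R) : Prop :=
  i.comp₀₀ x ∈ A.ring ∧ i.comp₁₀ x ∈ A.ring ∧ i.comp₀₁ x ∈ A.ring ∧ i.comp₁₁ x ∈ A.ring

variable {i} {A : OddFormSubring X}

theorem comp₁₀_zero : i.comp₁₀ 0 = 0 := by simp [comp₁₀]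
theorem comp₁₁_zero : i.comp₁₁ 0 = 0 := by simp [comp₁₁]
theorem comp₁₀_add (x y : X.R) : i.comp₁₀ (x + y) = i.comp₁₀ x + i.comp₁₀ y := by
  simp only [comp₁₀, mul_add, add_mul]; abel
theorem comp₁₁_add (x y : X.R) : i.comp₁₁ (x + y) = i.comp₁₁ x + i.comp₁₁ y := by
  simp only [comp₁₁, mul_add, add_mul]
theorem comp₁₀_neg (x : X.R) : i.comp₁₀ (-x) = -i.comp₁₀ x := by
  simp only [comp₁₀, mul_neg, neg_mul]; abel
theorem comp₁₁_neg (x : X.R) : i.comp₁₁ (-x) = -i.comp₁₁ x := by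
  simp only [comp₁₁, mul_neg, neg_mul]

theorem HasComps.zero : i.HasComps A 0 := by
  simp [HasComps, comp₀₀, comp₁₀, comp₀₁, comp₁₁]

theorem HasComps.add {x y : X.R} (hx : i.HasComps A x) (hy : i.HasComps A y) :
    i.HasComps A (x + y) := by
  refine ⟨?_, ?_, ?_, ?_⟩
  · rw [show i.comp₀₀ (x + y) = i.comp₀₀ x + i.comp₀₀ y by
      simp only [comp₀₀, mul_add, add_mul]; abel]
    exact add_mem hx.1 hy.1
  · rw [comp₁₀_add]; exact add_mem hx.2.1 hy.2.1
  · rw [show i.comp₀₁ (x + y) = i.comp₀₁ x + i.comp₀₁ y by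
      simp only [comp₀₁, mul_add, add_mul]; abel]
    exact add_mem hx.2.2.1 hy.2.2.1
  · rw [comp₁₁_add]; exact add_mem hx.2.2.2 hy.2.2.2

theorem HasComps.neg {x : X.R} (hx : i.HasComps A x) : i.HasComps A (-x) := by
  refine ⟨?_, ?_, ?_, ?_⟩
  · rw [show i.comp₀₀ (-x) = -i.comp₀₀ x by simp only [comp₀₀, mul_neg, neg_mul]; abel]
    exact neg_mem hx.1
  · rw [comp₁₀_neg]; exact neg_mem hx.2.1
  · rw [show i.comp₀₁ (-x) = -i.comp₀₁ x by simp only [comp₀₁, mul_neg, neg_mul]; abel]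
    exact neg_mem hx.2.2.1
  · rw [comp₁₁_neg]; exact neg_mem hx.2.2.2

theorem alpha_mul_star_assoc (x : X.R) : i.alpha * (star i.alpha * x) = e * x := by
  rw [← mul_assoc, i.mul_star]

/-- Components multiply like matrix entries, because 1 = (1 - e) + αᾱ. -/
theorem comp₁₀_mul (x y : X.R) :
    i.comp₁₀ (x * y) = i.comp₁₀ x * i.comp₀₀ y + i.comp₁₁ x * i.comp₁₀ y := by
  have he (z : X.R) : e * (e * z) = e * z := by rw [← mul_assoc, i.mul_self_left]
  simp only [comp₀₀, comp₁₀, comp₁₁, mul_sub, sub_mul, mul_add, mul_assoc,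
    alpha_mul_star_assoc, he]
  abel

theorem comp₁₁_mul (x y : X.R) :
    i.comp₁₁ (x * y) = i.comp₁₀ x * i.comp₀₁ y + i.comp₁₁ x * i.comp₁₁ y := by
  have he (z : X.R) : e * (e * z) = e * z := by rw [← mul_assoc, i.mul_self_left]
  simp only [comp₀₁, comp₁₀, comp₁₁, mul_sub, sub_mul, mul_assoc, alpha_mul_star_assoc, he]
  abel

theorem HasComps.mul {x y : X.R} (hx : i.HasComps A x) (hy : i.HasComps A y) :
    i.HasComps A (x * y) := by
  have he (z : X.R) : e * (e * z) = e * z := by rw [← mul_assoc, i.mul_self_left]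
  refine ⟨?_, ?_, ?_, ?_⟩
  · rw [show i.comp₀₀ (x * y) = i.comp₀₀ x * i.comp₀₀ y + i.comp₀₁ x * i.comp₁₀ y by
      simp only [comp₀₀, comp₁₀, comp₀₁, mul_sub, sub_mul, mul_add, add_mul, mul_assoc,
        alpha_mul_star_assoc, he]
      abel]
    exact add_mem (mul_mem hx.1 hy.1) (mul_mem hx.2.2.1 hy.2.1)
  · rw [comp₁₀_mul]
    exact add_mem (mul_mem hx.2.1 hy.1) (mul_mem hx.2.2.2 hy.2.1)
  · rw [show i.comp₀₁ (x * y) = i.comp₀₀ x * i.comp₀₁ y + i.comp₀₁ x * i.comp₁₁ y by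
      simp only [comp₀₀, comp₀₁, comp₁₁, mul_sub, sub_mul, add_mul, mul_assoc,
        alpha_mul_star_assoc, he]
      abel]
    exact add_mem (mul_mem hx.1 hy.2.2.1) (mul_mem hx.2.2.1 hy.2.2.2)
  · rw [comp₁₁_mul]
    exact add_mem (mul_mem hx.2.1 hy.2.2.1) (mul_mem hx.2.2.2 hy.2.2.2)

theorem HasComps.star {x : X.R} (hx : i.HasComps A x) : i.HasComps A (star x) := by
  have hs : Star.star e = e := i.star_left
  refine ⟨?_, ?_, ?_, ?_⟩
  · rw [show i.comp₀₀ (Star.star x) = Star.star (i.comp₀₀ x) by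
      simp only [comp₀₀, star_add, star_sub, StarMul.star_mul, hs, mul_assoc]; abel]
    exact A.star_mem hx.1
  · rw [show i.comp₁₀ (Star.star x) = Star.star (i.comp₀₁ x) by
      simp only [comp₁₀, comp₀₁, star_sub, StarMul.star_mul, hs, mul_assoc]]
    exact A.star_mem hx.2.2.1
  · rw [show i.comp₀₁ (Star.star x) = Star.star (i.comp₁₀ x) by
      simp only [comp₁₀, comp₀₁, star_sub, StarMul.star_mul, star_star, hs, mul_assoc]]
    exact A.star_mem hx.2.1
  · rw [show i.comp₁₁ (Star.star x) = Star.star (i.comp₁₁ x) by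
      simp only [comp₁₁, StarMul.star_mul, star_star, mul_assoc]]
    exact A.star_mem hx.2.2.2

theorem HasComps.of_mem (he : IsStarProjection e)
    (hA : A.ring ≤ (cornerSub X e he).ring) {x : X.R} (hx : x ∈ A.ring) : i.HasComps A x := by
  have h1 : e * x = 0 := (hA hx).1
  have h2 : x * e = 0 := (hA hx).2
  have h3 : x * i.alpha = 0 := by rw [← i.left_mul, ← mul_assoc, h2, zero_mul]
  have h4 : Star.star i.alpha * x = 0 := by rw [← i.star_mul_left, mul_assoc, h1, mul_zero]
  refine ⟨?_, ?_, ?_, ?_⟩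
  · simpa [comp₀₀, h1, h2] using hx
  · simp [comp₁₀, h4]
  · simp [comp₀₁, h1, h3]
  · simp [comp₁₁, h4]

/-- The component of an element of `Δ`, corrected by a multiple of `γ`. -/
def GComp (i : Isometry X e e₁) (A : OddFormSubring X) (w : X.D) (x : X.R) : Prop :=
  w + -X.act i.gamma x ∈ A.grp

/-- The commutator of γ · x with m is φ of an element of A: the pairing of π(γ) with π(m) sees only
the summand -e₁, which lies in A. -/
theorem conj_gamma (he : IsStarProjection e) (hA : A.ring ≤ (cornerSub X e he).ring)
    (h₁ : e₁ ∈ A.ring) {m : X.D} (hm : m ∈ A.grp) {x : X.R} (hx : x ∈ A.ring) :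
    X.act i.gamma x + m + -X.act i.gamma x ∈ A.grp ∧
      -X.act i.gamma x + m + X.act i.gamma x ∈ A.grp := by
  have h2 : Star.star (X.pi (X.act i.gamma x)) * X.pi m = -(Star.star x * (e₁ * X.pi m)) := by
    have h3 : Star.star i.alpha * X.pi m = 0 := by
      rw [← i.star_mul_left, mul_assoc, (hA (A.pi_mem hm)).1, mul_zero]
    rw [X.pi_act, i.pi_gamma, StarMul.star_mul, star_sub, i.star_right, mul_assoc, sub_mul, h3,
      zero_sub, mul_neg]
  have h4 : Star.star x * (e₁ * X.pi m) ∈ A.ring :=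
    mul_mem (A.star_mem hx) (mul_mem h₁ (A.pi_mem hm))
  constructor
  · rw [X.add_swap (X.act i.gamma x) m, neg_mul, h2, neg_neg, X.add_phi, add_assoc, add_assoc, add_neg_cancel, add_zero]
    exact add_mem (A.phi_mem h4) hm
  · rw [X.add_swap (-X.act i.gamma x) m, X.pi_neg, star_neg, neg_neg, h2, X.add_phi, add_assoc, add_assoc,
      neg_add_cancel, add_zero]
    exact add_mem (A.phi_mem (neg_mem h4)) hm

/-- The correction x ↦ γ · x is additive only up to φ(x̄'ρ(γ)x), which is harmless since ρ(γ) = -e₁.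
Reordering the summands is allowed by `conj_gamma`. -/
theorem GComp.add (h : e * e₁ = 0) (he : IsStarProjection e)
    (hA : A.ring ≤ (cornerSub X e he).ring) (h₁ : e₁ ∈ A.ring) {w w' : X.D} {x x' : X.R} (hw : i.GComp A w x) (hw' : i.GComp A w' x')
    (hx : x ∈ A.ring) (hx' : x' ∈ A.ring) : i.GComp A (w + w') (x + x') := by
  have h8 := (i.orthogonal_relations h).2.2.2.2.2.2.2
  have h9 : Star.star x' * X.rho i.gamma * x ∈ A.ring := by
    rw [h8]; exact mul_mem (mul_mem (A.star_mem hx') (neg_mem h₁)) hx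
  have h10 := add_mem (add_mem hw (conj_gamma (i := i) he hA h₁ hw' hx).1)
    (neg_mem (A.phi_mem h9))
  unfold GComp
  rw [X.act_add, X.add_phi, neg_add_rev, neg_add_rev]
  simpa only [add_assoc, neg_add_cancel_left] using h10

theorem GComp.neg (h : e * e₁ = 0) (he : IsStarProjection e)
    (hA : A.ring ≤ (cornerSub X e he).ring) (h₁ : e₁ ∈ A.ring) {w : X.D} {x : X.R} (hw : i.GComp A w x) (hx : x ∈ A.ring) :
    i.GComp A (-w) (-x) := by
  have h8 := (i.orthogonal_relations h).2.2.2.2.2.2.2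
  have h9 : Star.star x * X.rho i.gamma * x ∈ A.ring := by
    rw [h8]; exact mul_mem (mul_mem (A.star_mem hx) (neg_mem h₁)) hx
  have h10 := (conj_gamma (i := i) he hA h₁ hw hx).2
  rw [add_assoc, add_assoc, neg_add_cancel, add_zero] at h10
  have h11 := X.act_add i.gamma x (-x)
  rw [add_neg_cancel, X.act_zero] at h11
  have h12 := eq_neg_of_add_eq_zero_right h11.symm
  have h13 := add_mem (neg_mem h10) (neg_mem (A.phi_mem h9))
  unfold GComp
  rw [h12, neg_neg, star_neg, neg_mul, neg_mul, X.phi_neg, ← add_assoc]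
  rwa [neg_add_rev, neg_neg] at h13

theorem GComp.act {w : X.D} {x a : X.R} (hw : i.GComp A w x) (ha : a ∈ A.ring) :
    i.GComp A (X.act w a) (x * a) := by
  have h := A.act_mem hw ha
  rwa [X.add_act, X.neg_act, X.act_act] at h

theorem GComp.of_mem {w : X.D} (hw : w ∈ A.grp) : i.GComp A w 0 := by
  unfold GComp
  rwa [X.act_zero, neg_zero, add_zero]

theorem GComp.phi_add {w : X.D} {x a : X.R} (hw : i.GComp A w x) (ha : a ∈ A.ring) :
    i.GComp A (X.phi a + w) x := by
  unfold GComp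
  rw [add_assoc]
  exact add_mem (A.phi_mem ha) hw

/-- The components of an element of `Δ` belong to a subring. -/
def HasGComps (i : Isometry X e e₁) (A : OddFormSubring X) (u : X.D) : Prop :=
  i.HasComps A (X.pi u) ∧ i.HasComps A (X.rho u) ∧
    i.GComp A (X.act1 u (-e)) (i.comp₁₀ (X.pi u)) ∧
    i.GComp A (X.act u i.alpha) (i.comp₁₁ (X.pi u))

/-- The rule for u · (a + αb) splits it, up to a φ-term from A, into (u · (1 - e)) · a and (u · α) ·
b, that is, into the two components of u acted on by A. -/
theorem HasGComps.gcomp_act (h : e * e₁ = 0) (he : IsStarProjection e)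
    (hA : A.ring ≤ (cornerSub X e he).ring) (h₁ : e₁ ∈ A.ring) {u : X.D} (hu : i.HasGComps A u) {a b : X.R} (ha : a ∈ A.ring)
    (hb : b ∈ A.ring) : i.GComp A (X.act u (a + i.alpha * b))
      (i.comp₁₀ (X.pi u) * a + i.comp₁₁ (X.pi u) * b) := by
  have ha' : e * a = 0 := (hA ha).1
  have e1 : X.act u a = X.act (X.act1 u (-e)) a := by
    rw [X.act1_act, neg_mul, ha', neg_zero, add_zero]
  have e2 : Star.star (i.alpha * b) * X.rho u * a = Star.star b * (i.comp₁₀ (X.rho u) * a) := by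
    rw [comp₁₀, sub_mul, mul_assoc _ e, ha', mul_zero, sub_zero, StarMul.star_mul]
    simp only [mul_assoc]
  rw [X.act_add, X.add_phi, add_assoc, e1, ← X.act_act, e2]
  refine GComp.phi_add ?_ (mul_mem (A.star_mem hb) (mul_mem hu.2.1.2.1 ha))
  exact GComp.add h he hA h₁ (hu.2.2.1.act ha) (hu.2.2.2.act hb) (mul_mem hu.1.2.1 ha)
    (mul_mem hu.1.2.2.2 hb)

/-- The odd form subring generated by a subring of the corner and an isometry. -/
def amplify (i : Isometry X e e₁) (A : OddFormSubring X) (h : e * e₁ = 0)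
    (he : IsStarProjection e) (hA : A.ring ≤ (cornerSub X e he).ring) (h₁ : e₁ ∈ A.ring) :
    OddFormSubring X where
  ring :=
    { carrier := {x | i.HasComps A x}
      zero_mem' := HasComps.zero
      add_mem' := HasComps.add
      neg_mem' := HasComps.neg
      mul_mem' := HasComps.mul }
  grp :=
    { carrier := {u | i.HasGComps A u}
      zero_mem' := by
        refine ⟨?_, ?_, ?_, ?_⟩
        · rw [X.pi_zero]; exact HasComps.zero
        · rw [X.rho_zero]; exact HasComps.zero
        · rw [X.zero_act1, X.pi_zero, comp₁₀_zero]; exact GComp.of_mem A.grp.zero_mem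
        · rw [X.zero_act, X.pi_zero, comp₁₁_zero]; exact GComp.of_mem A.grp.zero_mem
      add_mem' := fun {u w} hu hw => by
        refine ⟨?_, ?_, ?_, ?_⟩
        · rw [X.pi_add]; exact hu.1.add hw.1
        · rw [X.rho_add, sub_eq_add_neg]
          exact (hu.2.1.add (hu.1.star.mul hw.1).neg).add hw.2.1
        · rw [X.add_act1, X.pi_add, comp₁₀_add]
          exact GComp.add h he hA h₁ hu.2.2.1 hw.2.2.1 hu.1.2.1 hw.1.2.1
        · rw [X.add_act, X.pi_add, comp₁₁_add]
          exact GComp.add h he hA h₁ hu.2.2.2 hw.2.2.2 hu.1.2.2.2 hw.1.2.2.2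
      neg_mem' := fun {u} hu => by
        refine ⟨?_, ?_, ?_, ?_⟩
        · rw [X.pi_neg]; exact hu.1.neg
        · rw [← X.star_rho]; exact hu.2.1.star
        · rw [X.neg_act1, X.pi_neg, comp₁₀_neg]; exact GComp.neg h he hA h₁ hu.2.2.1 hu.1.2.1
        · rw [X.neg_act, X.pi_neg, comp₁₁_neg]; exact GComp.neg h he hA h₁ hu.2.2.2 hu.1.2.2.2 }
  star_mem := HasComps.star
  act_mem := fun {u x} hu hx => by
    refine ⟨?_, ?_, ?_, ?_⟩
    · rw [X.pi_act]; exact hu.1.mul hx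
    · rw [X.rho_act]; exact (hx.star.mul hu.2.1).mul hx
    -- The column x(1 - e) has the form a + αb with a and b in A; the next case treats the column
    -- xα.
    · have h2 : x + x * -e = i.comp₀₀ x + i.alpha * i.comp₁₀ x := by
        simp only [comp₀₀, comp₁₀, mul_sub, mul_assoc, alpha_mul_star_assoc, mul_neg]
        abel
      rw [X.act_act1, X.pi_act, comp₁₀_mul, h2]
      exact HasGComps.gcomp_act h he hA h₁ hu hx.1 hx.2.1
    · have h2 : x * i.alpha = i.comp₀₁ x + i.alpha * i.comp₁₁ x := by
        simp only [comp₀₁, comp₁₁, mul_assoc, alpha_mul_star_assoc]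
        abel
      rw [X.act_act, X.pi_act, comp₁₁_mul, h2]
      exact HasGComps.gcomp_act h he hA h₁ hu hx.2.2.1 hx.2.2.2
  phi_mem := fun {x} hx => by
    refine ⟨?_, ?_, ?_, ?_⟩
    · rw [X.pi_phi]; exact HasComps.zero
    · rw [X.rho_phi, sub_eq_add_neg]; exact hx.add hx.star.neg
    · rw [X.pi_phi, comp₁₀_zero, X.phi_act1, star_neg, proj_star he]
      refine GComp.of_mem (A.phi_mem ?_)
      have h2 : x + -e * x + x * -e + -e * x * -e = i.comp₀₀ x := by
        simp only [comp₀₀, neg_mul, mul_neg]; abel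
      rw [h2]; exact hx.1
    · rw [X.pi_phi, comp₁₁_zero, ← X.phi_conj]
      exact GComp.of_mem (A.phi_mem hx.2.2.2)
  pi_mem := fun hu => hu.1
  rho_mem := fun hu => hu.2.1

section

variable (h : e * e₁ = 0) (he : IsStarProjection e)
  (hA : A.ring ≤ (cornerSub X e he).ring) (h₁ : e₁ ∈ A.ring)

theorem alpha_mem_amplify : i.alpha ∈ (i.amplify A h he hA h₁).ring := by
  obtain ⟨r1, r2, r3, r4, r5, r6, r7, r8⟩ := i.orthogonal_relations h
  refine ⟨?_, ?_, ?_, ?_⟩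
  · rw [show i.comp₀₀ i.alpha = 0 by simp [comp₀₀, i.left_mul, r3]]; exact zero_mem _
  · rw [show i.comp₁₀ i.alpha = e₁ by simp [comp₁₀, i.star_mul, r1]]; exact h₁
  · rw [show i.comp₀₁ i.alpha = 0 by simp [comp₀₁, i.left_mul]]; exact zero_mem _
  · rw [show i.comp₁₁ i.alpha = 0 by simp [comp₁₁, i.star_mul, r2]]; exact zero_mem _

theorem mem_amplify_of_mem_ring {x : X.R} (hx : x ∈ A.ring) :
    x ∈ (i.amplify A h he hA h₁).ring := HasComps.of_mem he hA hx

theorem mem_amplify_of_mem_grp (hD : A.grp ≤ (cornerSub X e he).grp) {u : X.D} (hu : u ∈ A.grp) :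
    u ∈ (i.amplify A h he hA h₁).grp := by
  have h2 := hD hu
  have h3 : Star.star i.alpha * X.pi u = 0 := by
    rw [← i.star_mul_left, mul_assoc, h2.2.1, mul_zero]
  refine ⟨HasComps.of_mem he hA (A.pi_mem hu), HasComps.of_mem he hA (A.rho_mem hu), ?_, ?_⟩
  · rw [show i.comp₁₀ (X.pi u) = 0 by simp [comp₁₀, h3], h2.1]
    exact GComp.of_mem hu
  · rw [show i.comp₁₁ (X.pi u) = 0 by simp [comp₁₁, h3]]
    have h4 : X.act u i.alpha = 0 := by
      rw [← h2.1, X.act1_act, neg_mul, i.left_mul, add_neg_cancel, X.act_zero]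
    rw [h4]
    exact GComp.of_mem A.grp.zero_mem

/-- The correction term in `GComp` is made for this: γ · (1 - e) = γ = γ · e₁ has component e₁, so
the corrected component is zero. -/
theorem gamma_mem_amplify : i.gamma ∈ (i.amplify A h he hA h₁).grp := by
  obtain ⟨r1, r2, r3, r4, r5, r6, r7, r8⟩ := i.orthogonal_relations h
  have hπ : X.pi i.gamma = i.alpha - e₁ := i.pi_gamma
  have hq : i.HasComps A i.alpha := alpha_mem_amplify h he hA h₁
  have h₁' : i.HasComps A e₁ := HasComps.of_mem he hA h₁
  have hc1 : X.act i.gamma (-e) = 0 := by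
    rw [← i.gamma_act, X.act_act, mul_neg, r1, neg_zero, X.act_zero]
  have hc2 : X.act i.gamma i.alpha = 0 := by
    rw [← i.gamma_act, X.act_act, r2, X.act_zero]
  refine ⟨?_, ?_, ?_, ?_⟩
  · rw [hπ, sub_eq_add_neg]; exact hq.add h₁'.neg
  · rw [r8]; exact h₁'.neg
  · have h2 : i.comp₁₀ (X.pi i.gamma) = e₁ := by
      simp only [comp₁₀, hπ, mul_sub, i.star_mul, r6, r1, sub_zero]
    have h3 : X.act1 i.gamma (-e) = i.gamma := by
      rw [OddFormRing.act1, hc1, r8, star_neg, proj_star he, neg_mul_neg, h, X.phi_zero, add_zero,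
        add_zero]
    unfold GComp
    rw [h2, h3, i.gamma_act, add_neg_cancel]
    exact A.grp.zero_mem
  · have h2 : i.comp₁₁ (X.pi i.gamma) = 0 := by
      simp only [comp₁₁, hπ, mul_sub, i.star_mul, r6, r2, sub_zero]
    rw [h2, hc2]
    exact GComp.of_mem A.grp.zero_mem

end

end Isometry

end Amplification

end OddForm

namespace OddForm

/-! ### Extension of morphisms and automorphisms from a corner -/

section Extension

variable {X : OddFormRing.{u, v}} {Y : OddFormRing.{u₁, v₁}}

/-- The first projection of a product. -/
def OddFormHom.fst (X : OddFormRing.{u, v}) (Y : OddFormRing.{u₁, v₁}) :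
    OddFormHom (prod X Y) X where
  onR := { toFun := Prod.fst, map_zero' := rfl, map_add' := fun _ _ => rfl,
           map_mul' := fun _ _ => rfl }
  onD := { toFun := Prod.fst, map_zero' := rfl, map_add' := fun _ _ => rfl }
  map_star _ := rfl
  map_act _ _ := rfl
  map_phi _ := rfl
  map_pi _ := rfl
  map_rho _ := rfl

/-- The image of an odd form subring. -/
def OddFormSubring.map (f : OddFormHom X Y) (A : OddFormSubring X) : OddFormSubring Y where
  ring := A.ring.map f.onR
  grp := A.grp.map f.onD
  star_mem := by
    rintro _ ⟨x, hx, rfl⟩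
    exact ⟨star x, A.star_mem hx, f.map_star x⟩
  act_mem := by
    rintro _ _ ⟨w, hw, rfl⟩ ⟨x, hx, rfl⟩
    exact ⟨X.act w x, A.act_mem hw hx, f.map_act w x⟩
  phi_mem := by
    rintro _ ⟨x, hx, rfl⟩
    exact ⟨X.phi x, A.phi_mem hx, f.map_phi x⟩
  pi_mem := by
    rintro _ ⟨w, hw, rfl⟩
    exact ⟨X.pi w, A.pi_mem hw, f.map_pi w⟩
  rho_mem := by
    rintro _ ⟨w, hw, rfl⟩
    exact ⟨X.rho w, A.rho_mem hw, f.map_rho w⟩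

/-- A subring of a product that projects bijectively onto the first factor is the graph of a
morphism. -/
theorem OddFormSubring.exists_hom_of_graph (A : OddFormSubring (prod X Y))
    (hR : ∀ x, ∃ y, (x, y) ∈ A.ring) (hD : ∀ x, ∃ y, (x, y) ∈ A.grp)
    (hR' : ∀ y, ((0 : X.R), y) ∈ A.ring → y = 0) (hD' : ∀ y, ((0 : X.D), y) ∈ A.grp → y = 0) :
    ∃ f : OddFormHom X Y, (∀ x y, (x, y) ∈ A.ring → f.onR x = y) ∧
      ∀ x y, (x, y) ∈ A.grp → f.onD x = y := by
  choose f hf using hR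
  choose g hg using hD
  have hf' (x : X.R) (y : Y.R) (h : (x, y) ∈ A.ring) : f x = y := by
    have h1 := A.ring.sub_mem (hf x) h
    rw [Prod.mk_sub_mk, sub_self] at h1
    exact sub_eq_zero.1 (hR' _ h1)
  have hg' (x : X.D) (y : Y.D) (h : (x, y) ∈ A.grp) : g x = y := by
    have h1 := A.grp.sub_mem (hg x) h
    rw [Prod.mk_sub_mk, sub_self] at h1
    exact sub_eq_zero.1 (hD' _ h1)
  refine ⟨{ onR := { toFun := f, map_zero' := ?_, map_add' := ?_, map_mul' := ?_ }
            onD := { toFun := g, map_zero' := ?_, map_add' := ?_ }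
            map_star := ?_, map_act := ?_, map_phi := ?_, map_pi := ?_, map_rho := ?_ }, hf', hg'⟩
  · exact fun x y => hf' _ _ (A.ring.mul_mem (hf x) (hf y))
  · exact hf' _ _ A.ring.zero_mem
  · exact fun x y => hf' _ _ (A.ring.add_mem (hf x) (hf y))
  · exact hg' _ _ A.grp.zero_mem
  · exact fun x y => hg' _ _ (A.grp.add_mem (hg x) (hg y))
  · exact fun x => hf' _ _ (A.star_mem (hf x))
  · exact fun w x => hg' _ _ (A.act_mem (hg w) (hf x))
  · exact fun x => hg' _ _ (A.phi_mem (hf x))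
  · exact fun w => hf' _ _ (A.pi_mem (hg w))
  · exact fun w => hf' _ _ (A.rho_mem (hg w))

/-- The product of isometries. -/
def Isometry.prodMk {e e₁ : X.R} {ε ε₁ : Y.R} (i : Isometry X e e₁) (j : Isometry Y ε ε₁) :
    Isometry (prod X Y) (e, ε) (e₁, ε₁) where
  alpha := (i.alpha, j.alpha)
  gamma := (i.gamma, j.gamma)
  left_mul := Prod.ext i.left_mul j.left_mul
  mul_right := Prod.ext i.mul_right j.mul_right
  star_mul := Prod.ext i.star_mul j.star_mul
  mul_star := Prod.ext i.mul_star j.mul_star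
  gamma_act := Prod.ext i.gamma_act j.gamma_act
  pi_gamma := Prod.ext i.pi_gamma j.pi_gamma
  rho_gamma := Prod.ext i.rho_gamma j.rho_gamma

theorem proj_prodMk {e : X.R} {ε : Y.R} (he : IsStarProjection e) (hε : IsStarProjection ε) :
    IsStarProjection ((e, ε) : (prod X Y).R) where
  isIdempotentElem := Prod.ext (proj_mul he) (proj_mul hε)
  isSelfAdjoint := Prod.ext (proj_star he) (proj_star hε)

/-- The graph of a morphism of corners. -/
def OddFormHom.cornerGraph {e : X.R} {ε : Y.R} {he : IsStarProjection e} {hε : IsStarProjection ε}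
    (f : OddFormHom (Corner X e he) (Corner Y ε hε)) : OddFormSubring (prod X Y) where
  ring :=
    { carrier := {z | ∃ x, (x.1, (f.onR x).1) = z}
      zero_mem' := ⟨0, by rw [map_zero]; rfl⟩
      add_mem' := by
        rintro _ _ ⟨x, rfl⟩ ⟨y, rfl⟩
        exact ⟨x + y, by rw [map_add]; rfl⟩
      neg_mem' := by
        rintro _ ⟨x, rfl⟩
        exact ⟨-x, by rw [map_neg]; rfl⟩
      mul_mem' := by
        rintro _ _ ⟨x, rfl⟩ ⟨y, rfl⟩
        exact ⟨x * y, by rw [map_mul]; rfl⟩ }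
  grp :=
    { carrier := {z | ∃ x, (x.1, (f.onD x).1) = z}
      zero_mem' := ⟨0, by rw [map_zero]; rfl⟩
      add_mem' := by
        rintro _ _ ⟨x, rfl⟩ ⟨y, rfl⟩
        exact ⟨x + y, by rw [map_add]; rfl⟩
      neg_mem' := by
        rintro _ ⟨x, rfl⟩
        exact ⟨-x, by rw [map_neg]; rfl⟩ }
  star_mem := by
    rintro _ ⟨x, rfl⟩
    exact ⟨star x, by rw [f.map_star]; rfl⟩
  act_mem := by
    rintro _ _ ⟨w, rfl⟩ ⟨x, rfl⟩
    exact ⟨(Corner X e he).act w x, by rw [f.map_act]⟩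
  phi_mem := by
    rintro _ ⟨x, rfl⟩
    exact ⟨(Corner X e he).phi x, by rw [f.map_phi]⟩
  pi_mem := by
    rintro _ ⟨w, rfl⟩
    exact ⟨(Corner X e he).pi w, by rw [f.map_pi]⟩
  rho_mem := by
    rintro _ ⟨w, rfl⟩
    exact ⟨(Corner X e he).rho w, by rw [f.map_rho]⟩

theorem OddFormHom.cornerGraph_le {e : X.R} {ε : Y.R} {he : IsStarProjection e}
    {hε : IsStarProjection ε} (f : OddFormHom (Corner X e he) (Corner Y ε hε)) :
    f.cornerGraph.ring ≤ (cornerSub (prod X Y) (e, ε) (proj_prodMk he hε)).ring ∧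
      f.cornerGraph.grp ≤ (cornerSub (prod X Y) (e, ε) (proj_prodMk he hε)).grp := by
  constructor
  · rintro _ ⟨x, rfl⟩
    exact ⟨Prod.ext x.2.1 (f.onR x).2.1, Prod.ext x.2.2 (f.onR x).2.2⟩
  · rintro _ ⟨x, rfl⟩
    exact ⟨Prod.ext x.2.1 (f.onD x).2.1, Prod.ext x.2.2.1 (f.onD x).2.2.1,
      Prod.ext x.2.2.2 (f.onD x).2.2.2⟩

theorem OddFormHom.eq_zero_of_mem_cornerGraph_ring {e : X.R} {ε : Y.R} {he : IsStarProjection e}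
    {hε : IsStarProjection ε} (f : OddFormHom (Corner X e he) (Corner Y ε hε)) {z : X.R × Y.R}
    (hz : z ∈ f.cornerGraph.ring) (h : z.1 = 0) : z.2 = 0 := by
  obtain ⟨x, rfl⟩ := hz
  obtain rfl : x = 0 := Subtype.ext h
  change (f.onR 0).1 = 0
  rw [map_zero]; rfl

theorem OddFormHom.eq_zero_of_mem_cornerGraph_grp {e : X.R} {ε : Y.R} {he : IsStarProjection e}
    {hε : IsStarProjection ε} (f : OddFormHom (Corner X e he) (Corner Y ε hε)) {z : X.D × Y.D}
    (hz : z ∈ f.cornerGraph.grp) (h : z.1 = 0) : z.2 = 0 := by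
  obtain ⟨x, rfl⟩ := hz
  obtain rfl : x = 0 := Subtype.ext h
  change (f.onD 0).1 = 0
  rw [map_zero]; rfl

/-- The matrix of x is transported back by α and ᾱ; an element with zero components is therefore
zero. -/
theorem Isometry.eq_sum_comps {e e₁ : X.R} (i : Isometry X e e₁) (x : X.R) :
    x = i.comp₀₀ x + i.alpha * i.comp₁₀ x + i.comp₀₁ x * star i.alpha +
      i.alpha * i.comp₁₁ x * star i.alpha := by
  simp only [Isometry.comp₀₀, Isometry.comp₁₀, Isometry.comp₀₁, Isometry.comp₁₁, mul_sub, sub_mul,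
    mul_assoc, Isometry.alpha_mul_star_assoc, i.mul_star]
  abel

/-- Extension of morphisms from corners. -/
theorem exists_extension {e : X.R} {ε : Y.R} (he : IsStarProjection e) (hε : IsStarProjection ε)
    (f : OddFormHom (Corner X e he) (Corner Y ε hε)) {e₁ : (Corner X e he).R}
    (i : Isometry X e e₁.1) (j : Isometry Y ε (f.onR e₁).1) :
    ∃ (F : OddFormHom X Y) (hF : F ∈ homFix e ε), F.toCorner he hε hF = f ∧
      F.onR i.alpha = j.alpha ∧ F.onD i.gamma = j.gamma := by
  obtain ⟨hA, hA'⟩ := f.cornerGraph_le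
  have hZ := proj_prodMk he hε
  have hor : ((e, ε) : (prod X Y).R) * (e₁.1, (f.onR e₁).1) = 0 :=
    Prod.ext e₁.2.1 (f.onR e₁).2.1
  have h₁ : (e₁.1, (f.onR e₁).1) ∈ f.cornerGraph.ring := ⟨e₁, rfl⟩
  let k := i.prodMk j
  -- Matrices over the graph of f form a subring of the product that should be the graph of the
  -- extension. It projects onto X by generation, and an element with first coordinate 0 has
  -- components in the graph of f with first coordinate 0.
  let B := k.amplify f.cornerGraph hor hZ hA h₁
  have hBα : k.alpha ∈ B.ring := Isometry.alpha_mem_amplify hor hZ hA h₁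
  have hBγ : k.gamma ∈ B.grp := Isometry.gamma_mem_amplify hor hZ hA h₁
  have hBR (x : (Corner X e he).R) : (x.1, (f.onR x).1) ∈ B.ring :=
    Isometry.mem_amplify_of_mem_ring hor hZ hA h₁ ⟨x, rfl⟩
  have hBD (x : (Corner X e he).D) : (x.1, (f.onD x).1) ∈ B.grp :=
    Isometry.mem_amplify_of_mem_grp hor hZ hA h₁ hA' ⟨x, rfl⟩
  have htop := (B.map (OddFormHom.fst X Y)).eq_top_of_isometry he i e₁.2.1
    (fun x hx => ⟨_, hBR ⟨x, hx⟩, rfl⟩) (fun x hx => ⟨_, hBD ⟨x, hx⟩, rfl⟩) ⟨_, hBα, rfl⟩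
    ⟨_, hBγ, rfl⟩
  have h0 (y : Y.R) (hy : ((0 : X.R), y) ∈ B.ring) : y = 0 := by
    obtain ⟨h1, h2, h3, h4⟩ := hy
    have h1' : j.comp₀₀ y = 0 := f.eq_zero_of_mem_cornerGraph_ring h1
      (show i.comp₀₀ 0 = 0 by simp [Isometry.comp₀₀])
    have h2' : j.comp₁₀ y = 0 := f.eq_zero_of_mem_cornerGraph_ring h2
      (show i.comp₁₀ 0 = 0 by simp [Isometry.comp₁₀])
    have h3' : j.comp₀₁ y = 0 := f.eq_zero_of_mem_cornerGraph_ring h3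
      (show i.comp₀₁ 0 = 0 by simp [Isometry.comp₀₁])
    have h4' : j.comp₁₁ y = 0 := f.eq_zero_of_mem_cornerGraph_ring h4
      (show i.comp₁₁ 0 = 0 by simp [Isometry.comp₁₁])
    rw [j.eq_sum_comps y, h1', h2', h3', h4']
    simp
  obtain ⟨F, hF, hF'⟩ := B.exists_hom_of_graph
    (fun x => by
      obtain ⟨⟨x, y⟩, h, rfl⟩ := htop.1 x
      exact ⟨y, h⟩)
    (fun x => by
      obtain ⟨⟨x, y⟩, h, rfl⟩ := htop.2 x
      exact ⟨y, h⟩) h0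
    (fun y hy => by
      obtain ⟨h1, h2, h3, h4⟩ := hy
      have h1' : Y.pi y = 0 := h0 _ (by
        have h5 : ((X.pi 0, Y.pi y) : X.R × Y.R) ∈ B.ring := h1
        rwa [X.pi_zero] at h5)
      have h2' : Y.rho y = 0 := h0 _ (by
        have h5 : ((X.rho 0, Y.rho y) : X.R × Y.R) ∈ B.ring := h2
        rwa [X.rho_zero] at h5)
      have h3' : Y.act1 y (-ε) + -Y.act j.gamma (j.comp₁₀ (Y.pi y)) = 0 :=
        f.eq_zero_of_mem_cornerGraph_grp h3
          (show X.act1 0 (-e) + -X.act i.gamma (i.comp₁₀ (X.pi 0)) = 0 by simp [Isometry.comp₁₀])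
      have h4' : Y.act y j.alpha + -Y.act j.gamma (j.comp₁₁ (Y.pi y)) = 0 :=
        f.eq_zero_of_mem_cornerGraph_grp h4
          (show X.act 0 i.alpha + -X.act i.gamma (i.comp₁₁ (X.pi 0)) = 0 by simp [Isometry.comp₁₁])
      rw [h1', Isometry.comp₁₀_zero, Y.act_zero, neg_zero, add_zero] at h3'
      rw [h1', Isometry.comp₁₁_zero, Y.act_zero, neg_zero, add_zero] at h4'
      rw [eq_act1_add_act y hε, h3', h2', ← j.mul_star, ← Y.act_act, h4']
      simp)
  -- The pair (e, ε) is the product of the isometry (i, j) and its adjoint, so it lies in the graph.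
  have he' : F.onR e = ε := by
    refine hF _ _ ?_
    have h := B.ring.mul_mem hBα (B.star_mem hBα)
    rwa [k.mul_star] at h
  refine ⟨F, he', ?_, hF _ _ hBα, hF' _ _ hBγ⟩
  ext x
  · exact hF _ _ (hBR x)
  · exact hF' _ _ (hBD x)

/-- Extension of automorphisms from corners. -/
theorem exists_resPU_eq {e : X.R} (he : IsStarProjection e) (σ : PU (Corner X e he))
    {e₁ : (Corner X e he).R} (i : Isometry X e e₁.1) (hσ : σ.val.onR e₁ = e₁) :
    ∃ τ : puFix e, resPU e he τ = σ ∧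
      ∀ I : OddFormIdeal X, σ ∈ (I.restrict (cornerSub X e he)).pu → τ.1 ∈ I.pu := by
  have key (σ : PU (Corner X e he)) (hσ : σ.val.onR e₁ = e₁) :
      ∃ (F : OddFormHom X X) (hF : F ∈ homFix e e), F.toCorner he he hF = σ.val ∧
        F.onR i.alpha = i.alpha ∧ F.onD i.gamma = i.gamma := by
    obtain ⟨j, hj, hj'⟩ : ∃ j : Isometry X e (σ.val.onR e₁).1,
        j.alpha = i.alpha ∧ j.gamma = i.gamma := by
      rw [hσ]; exact ⟨i, rfl, rfl⟩
    obtain ⟨F, hF, h1, h2, h3⟩ := exists_extension he he σ.val i j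
    exact ⟨F, hF, h1, h2.trans hj, h3.trans hj'⟩
  obtain ⟨F, hF, hc, hα, hγ⟩ := key σ hσ
  -- Both σ and σ⁻¹ are extended so as to fix the same isometry; uniqueness of extensions shows that
  -- the results are mutually inverse.
  obtain ⟨G, hG, hc', hα', hγ'⟩ := key σ⁻¹ (by
    conv_lhs => rw [← hσ]
    rw [← OddFormHom.mul_onR, Units.inv_mul]; rfl)
  have comp (σ τ : PU (Corner X e he)) (F G : OddFormHom X X) (hF : F ∈ homFix e e)
      (hG : G ∈ homFix e e) (h1 : F.toCorner he he hF = σ.val) (h2 : G.toCorner he he hG = τ.val)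
      (h : σ * τ = 1) (hα : F.onR i.alpha = i.alpha) (hγ : F.onD i.gamma = i.gamma)
      (hα' : G.onR i.alpha = i.alpha) (hγ' : G.onD i.gamma = i.gamma) : F * G = 1 := by
    have h3 : F.toCorner he he hF * G.toCorner he he hG = 1 := by
      rw [h1, h2, ← Units.val_mul, h]; rfl
    refine OddFormHom.ext_of_isometry he i e₁.2.1 ?_ ?_ ?_ ?_
    · intro x hx
      exact congrArg (fun f : OddFormHom (Corner X e he) (Corner X e he) => (f.onR ⟨x, hx⟩).1) h3
    · intro x hx
      exact congrArg (fun f : OddFormHom (Corner X e he) (Corner X e he) => (f.onD ⟨x, hx⟩).1) h3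
    · rw [OddFormHom.mul_onR, hα', hα]; rfl
    · rw [OddFormHom.mul_onD, hγ', hγ]; rfl
  refine ⟨⟨⟨F, G, comp _ _ F G hF hG hc hc' (mul_inv_cancel σ) hα hγ hα' hγ',
    comp _ _ G F hG hF hc' hc (inv_mul_cancel σ) hα' hγ' hα hγ⟩, hF⟩, Units.ext hc, ?_⟩
  intro I hI
  have hm (x : (Corner X e he).R) : F.onR x.1 = (σ.val.onR x).1 :=
    congrArg (fun f : OddFormHom (Corner X e he) (Corner X e he) => (f.onR x).1) hc
  have hm' (x : (Corner X e he).D) : F.onD x.1 = (σ.val.onD x).1 :=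
    congrArg (fun f : OddFormHom (Corner X e he) (Corner X e he) => (f.onD x).1) hc
  -- The locus where F is congruent to the identity contains the corner and the fixed isometry,
  -- hence everything.
  have h := (I.congrLocus F 1).eq_top_of_isometry he i e₁.2.1
    (fun x hx => by
      have h1 := hI.1 ⟨x, hx⟩
      rw [OddFormIdeal.restrict, TwoSidedIdeal.mem_mk'] at h1
      change F.onR x - x ∈ I.ideal
      rw [hm ⟨x, hx⟩]
      exact h1)
    (fun x hx => by
      have h1 := hI.2 ⟨x, hx⟩
      change F.onD x - x ∈ I.grp
      rw [hm' ⟨x, hx⟩]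
      exact h1)
    (by
      change F.onR i.alpha - i.alpha ∈ I.ideal
      rw [hα, sub_self]
      exact I.ideal.zero_mem)
    (by
      change F.onD i.gamma - i.gamma ∈ I.grp
      rw [hγ, sub_self]
      exact I.grp.zero_mem)
  exact h

end Extension

end OddForm

namespace OddForm

/-! ### Criteria for stability of orbits and cosets -/

section Stability

/-- The two directions of `h` are well-definedness and injectivity; `hs` is needed only for
surjectivity. -/
theorem OrbitStability.intro {G : Type u} {A : Type v} [Group G] [MulAction G A] {G' : Type u₁}
    {A' : Type v₁} [Group G'] [MulAction G' A'] {K : Subgroup G} {Y : Set A} {L : Subgroup G'}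
    {Z : Set A'} {r : Y → A'} {cond : Prop} (hr : ∀ y, r y ∈ Z)
    (h : ∀ y y' : Y, (∃ k ∈ K, k • y.1 = y'.1) ↔ ∃ l ∈ L, l • r y = r y')
    (hs : cond → ∀ z ∈ Z, ∃ y, ∃ l ∈ L, l • z = r y) : OrbitStability K Y L Z r cond := by
  have h1 (y y' : Y) : (Quotient.mk _ y : OrbitSet K Y) = Quotient.mk _ y' ↔
      ∃ k ∈ K, k • y'.1 = y.1 := by
    rw [Quotient.eq, Setoid.comap_rel, MulAction.orbitRel_apply, MulAction.mem_orbit_iff]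
    exact ⟨fun ⟨k, hk⟩ => ⟨k.1, k.2, hk⟩, fun ⟨k, hk, e⟩ => ⟨⟨k, hk⟩, e⟩⟩
  have h2 (z z' : Z) : (Quotient.mk _ z : OrbitSet L Z) = Quotient.mk _ z' ↔
      ∃ k ∈ L, k • z'.1 = z.1 := by
    rw [Quotient.eq, Setoid.comap_rel, MulAction.orbitRel_apply, MulAction.mem_orbit_iff]
    exact ⟨fun ⟨k, hk⟩ => ⟨k.1, k.2, hk⟩, fun ⟨k, hk, e⟩ => ⟨⟨k, hk⟩, e⟩⟩
  let Φ : OrbitSet K Y → OrbitSet L Z := Quotient.lift (fun y => Quotient.mk _ ⟨r y, hr y⟩)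
    fun y y' hy => (h2 _ _).2 ((h y' y).1 ((h1 y y').1 (Quotient.sound hy)))
  have hΦ : Function.Injective Φ := by
    rintro ⟨y⟩ ⟨y'⟩ e
    exact (h1 y y').2 ((h y' y).2 ((h2 _ _).1 e))
  refine ⟨Φ, fun y => ⟨hr y, rfl⟩, hΦ, fun hc => ⟨hΦ, ?_⟩⟩
  rintro ⟨z⟩
  obtain ⟨y, l, hl, e⟩ := hs hc z.1 z.2
  exact ⟨Quotient.mk _ y, (h2 _ _).2 ⟨l, hl, e⟩⟩

/-- By `h` the subgroup N is the preimage of M under r, so its normality in P and the injectivity on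
cosets both follow from normality of M in Q. -/
theorem CosetStability.intro {G : Type u} [Group G] {G' : Type u₁} [Group G'] {P N : Subgroup G}
    {Q M : Subgroup G'} {r : P →* G'} {cond : Prop} (hN : N ≤ P) (hM : M ≤ Q)
    (hMn : ∀ q ∈ Q, ∀ x ∈ M, q * x * q⁻¹ ∈ M) (hr : ∀ p, r p ∈ Q)
    (h : ∀ p : P, p.1 ∈ N ↔ r p ∈ M) (hs : cond → ∀ q ∈ Q, ∃ p, r p * q⁻¹ ∈ M) :
    CosetStability P N Q M r cond := by
  have hn : (M.subgroupOf Q).Normal := ⟨fun x hx q => hMn q.1 q.2 x.1 hx⟩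
  have hker : N.subgroupOf P = (M.subgroupOf Q).comap (r.codRestrict Q hr) := by
    ext p
    exact h p
  have hn' : (N.subgroupOf P).Normal := by
    rw [hker]; exact hn.comap _
  let Φ : P ⧸ N.subgroupOf P → Q ⧸ M.subgroupOf Q :=
    QuotientGroup.map _ (M.subgroupOf Q) (r.codRestrict Q hr) hker.le
  have hΦ : Function.Injective Φ := by
    intro x y
    obtain ⟨x, rfl⟩ := QuotientGroup.mk_surjective x
    obtain ⟨y, rfl⟩ := QuotientGroup.mk_surjective y
    intro e
    have e' : (QuotientGroup.mk (r.codRestrict Q hr x) : Q ⧸ M.subgroupOf Q) =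
        QuotientGroup.mk (r.codRestrict Q hr y) := e
    rw [QuotientGroup.eq, ← map_inv, ← map_mul] at e'
    rw [QuotientGroup.eq, hker]
    exact e'
  refine ⟨⟨hN, hn'⟩, ⟨hM, hn⟩, Φ, fun p => ⟨hr p, rfl⟩, hΦ, fun hc => ⟨hΦ, fun x => ?_⟩⟩
  obtain ⟨q, rfl⟩ := QuotientGroup.mk_surjective x
  obtain ⟨p, hp⟩ := hs hc q.1 q.2
  refine ⟨QuotientGroup.mk p, ?_⟩
  change (QuotientGroup.mk (r.codRestrict Q hr p) : Q ⧸ M.subgroupOf Q) = QuotientGroup.mk q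
  rw [eq_comm, QuotientGroup.eq]
  change q.1⁻¹ * r p ∈ M
  have h1 := hMn q.1⁻¹ (inv_mem q.2) _ hp
  rwa [← mul_assoc, inv_inv, inv_mul_cancel_right] at h1

/-- Two bijective coset maps with the same source give an isomorphism of their targets. -/
theorem CosetStability.exists_mulEquiv {G : Type u} [Group G] {G₁ : Type u₁} [Group G₁]
    {G₂ : Type u₂} [Group G₂] {P N : Subgroup G} {Q₁ M₁ : Subgroup G₁} {Q₂ M₂ : Subgroup G₂}
    [(M₁.subgroupOf Q₁).Normal] [(M₂.subgroupOf Q₂).Normal] {r₁ : P →* G₁} {r₂ : P →* G₂}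
    {c₁ c₂ : Prop} (h₁ : CosetStability P N Q₁ M₁ r₁ c₁) (h₂ : CosetStability P N Q₂ M₂ r₂ c₂)
    (hc₁ : c₁) (hc₂ : c₂) :
    ∃ Φ : Q₁ ⧸ M₁.subgroupOf Q₁ ≃* Q₂ ⧸ M₂.subgroupOf Q₂,
      ∀ p : P, ∃ (h : r₁ p ∈ Q₁) (h' : r₂ p ∈ Q₂),
        Φ (QuotientGroup.mk ⟨r₁ p, h⟩) = QuotientGroup.mk ⟨r₂ p, h'⟩ := by
  obtain ⟨-, -, F₁, e₁, -, b₁⟩ := h₁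
  obtain ⟨-, -, F₂, e₂, -, b₂⟩ := h₂
  choose m₁ e₁ using e₁
  choose m₂ e₂ using e₂
  let E : Q₁ ⧸ M₁.subgroupOf Q₁ ≃ Q₂ ⧸ M₂.subgroupOf Q₂ :=
    (Equiv.ofBijective F₁ (b₁ hc₁)).symm.trans (Equiv.ofBijective F₂ (b₂ hc₂))
  have hE (p : P) : E (QuotientGroup.mk ⟨r₁ p, m₁ p⟩) = QuotientGroup.mk ⟨r₂ p, m₂ p⟩ := by
    have h : (Equiv.ofBijective F₁ (b₁ hc₁)).symm (QuotientGroup.mk ⟨r₁ p, m₁ p⟩) =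
        QuotientGroup.mk p := by
      rw [Equiv.symm_apply_eq]; exact (e₁ p).symm
    rw [Equiv.trans_apply, h]
    exact e₂ p
  -- The coset maps are given only as maps of sets. Every class comes from P, and multiplicativity
  -- there follows from that of r₁ and r₂.
  have hs (x : Q₁ ⧸ M₁.subgroupOf Q₁) : ∃ p : P, QuotientGroup.mk ⟨r₁ p, m₁ p⟩ = x := by
    obtain ⟨y, rfl⟩ := (b₁ hc₁).2 x
    obtain ⟨p, rfl⟩ := QuotientGroup.mk_surjective y
    exact ⟨p, (e₁ p).symm⟩
  refine ⟨MulEquiv.mk E ?_, fun p => ⟨m₁ p, m₂ p, hE p⟩⟩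
  intro x y
  obtain ⟨p, rfl⟩ := hs x
  obtain ⟨q, rfl⟩ := hs y
  have h1 : (QuotientGroup.mk ⟨r₁ p, m₁ p⟩ * QuotientGroup.mk ⟨r₁ q, m₁ q⟩ :
      Q₁ ⧸ M₁.subgroupOf Q₁) = QuotientGroup.mk ⟨r₁ (p * q), m₁ (p * q)⟩ := by
    rw [← QuotientGroup.mk_mul]
    congr 1
    exact Subtype.ext (map_mul r₁ p q).symm
  have h2 : (QuotientGroup.mk ⟨r₂ p, m₂ p⟩ * QuotientGroup.mk ⟨r₂ q, m₂ q⟩ :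
      Q₂ ⧸ M₂.subgroupOf Q₂) = QuotientGroup.mk ⟨r₂ (p * q), m₂ (p * q)⟩ := by
    rw [← QuotientGroup.mk_mul]
    congr 1
    exact Subtype.ext (map_mul r₂ p q).symm
  change E _ = E _ * E _
  rw [h1, hE, hE, hE, h2]

end Stability

/-! ### Coset stability for projective and general unitary groups -/

section GeneralUnitary

variable {X : OddFormRing.{u, v}} {Y : OddFormRing.{u₁, v₁}} {T : OddFormRing.{u₂, v₂}}

theorem mapU_innHom (g k : U X) : g.innHom.mapU k = g * k * g⁻¹ := by
  rw [eq_mul_inv_iff_mul_eq]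
  ext
  · simp only [U.beta_mul, OddFormHom.mapU_beta, U.innHom_onR, add_mul, mul_assoc, U.star_mul_eq,
      mul_sub, mul_neg]
    abel
  · have h1 : star g.beta + g.beta + star g.beta * g.beta = 0 := by rw [U.star_mul_eq]; abel
    rw [U.gamma_mul, U.gamma_mul, OddFormHom.mapU_gamma, U.innHom_onD, X.act1_act1, h1,
      X.act1_zero, X.add_swap, k.pi_gamma, X.pi_add, X.pi_act, g.pi_gamma, k.pi_gamma,
      OddFormRing.act1, g.rho_gamma]
    have h2 : -star (g.beta * k.beta + k.beta) * g.beta = star k.beta * star g.beta := by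
      simp only [star_add, star_mul, neg_add_rev, add_mul, neg_mul, mul_assoc, U.star_mul_eq,
        mul_sub, mul_neg]
      abel
    rw [h2]
    simp only [add_assoc, X.add_phi]

theorem OddFormHom.mapU_smul (f : OddFormHom Y X) (g : U Y) :
    f.mapU g • f = f.comp g.innHom := by
  ext x
  · simp [OddFormHom.smul_onR, f.map_star]
  · simp [OddFormHom.smul_onD, f.map_star, f.map_act, f.map_act1, f.map_pi]

/-- Stability of the image of ι is automatic, because σ is surjective. -/
theorem mem_gunitOver_iff (ι : OddFormHom X T) (P : Subgroup (PU X)) (g : U T) :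
    g ∈ gunitOver ι P ↔ ∃ σ ∈ P, g • ι = ι.comp σ.val := by
  refine ⟨fun h => h.2, fun ⟨σ, hσ, e⟩ => ⟨⟨?_, ?_⟩, σ, hσ, e⟩⟩
  · have h1 : Set.range (σ.val.onR) = Set.univ := Set.range_eq_univ.2 fun x =>
      ⟨σ⁻¹.val.onR x, by rw [← OddFormHom.mul_onR, Units.mul_inv]; rfl⟩
    have h2 : ((U.inn g).val.onR : T.R → T.R) ∘ ι.onR = ι.onR ∘ σ.val.onR :=
      congrArg (fun f : OddFormHom X T => (f.onR : X.R → T.R)) e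
    rw [← Set.range_comp, h2, Set.range_comp, h1, Set.image_univ]
  · have h1 : Set.range (σ.val.onD) = Set.univ := Set.range_eq_univ.2 fun x =>
      ⟨σ⁻¹.val.onD x, by rw [← OddFormHom.mul_onD, Units.mul_inv]; rfl⟩
    have h2 : ((U.inn g).val.onD : T.D → T.D) ∘ ι.onD = ι.onD ∘ σ.val.onD :=
      congrArg (fun f : OddFormHom X T => (f.onD : X.D → T.D)) e
    rw [← Set.range_comp, h2, Set.range_comp, h1, Set.image_univ]

theorem OddFormHom.Injective.comp_cancel {ι : OddFormHom X T} (hι : ι.Injective)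
    {f g : OddFormHom Y X} (h : ι.comp f = ι.comp g) : f = g := by
  ext x
  · exact hι.1 (congrArg (fun f : OddFormHom Y T => f.onR x) h)
  · exact hι.2 (congrArg (fun f : OddFormHom Y T => f.onD x) h)

theorem mapU_mem_gunitOver (ι : OddFormHom X T) {P : Subgroup (PU X)} {g : U X}
    (hg : U.inn g ∈ P) : ι.mapU g ∈ gunitOver ι P :=
  (mem_gunitOver_iff _ _ _).2 ⟨U.inn g, hg, ι.mapU_smul g⟩

/-- This reduces normality of ι(W) in the general unitary group to stability of W under the
automorphisms σ. -/
theorem conj_mapU (ι : OddFormHom X T) {q : U T} {σ : PU X} (h : q • ι = ι.comp σ.val) (g : U X) :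
    q * ι.mapU g * q⁻¹ = ι.mapU (σ.val.mapU g) := by
  rw [← mapU_innHom]
  have h1 : q.innHom.mapU (ι.mapU g) = (q • ι).mapU g := rfl
  rw [h1, h]; rfl

section Subtype

variable {P Q : Subgroup (PU X)} {V W : Subgroup (U X)} {cond : Prop}

/-- Common form of the absolute and relative statements in rank n: V is the part of W that acts
through P, so injectivity is formal, and all the content is in `hs`. -/
theorem cosetStability_subtype (hPQ : P ≤ Q) (hV : ∀ g, g ∈ V ↔ g ∈ W ∧ U.inn g ∈ P)
    (hW : ∀ g ∈ W, U.inn g ∈ Q) (hWn : ∀ σ ∈ Q, ∀ g ∈ W, σ.val.mapU g ∈ W)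
    (hs : cond → ∀ σ ∈ Q, ∃ g ∈ W, U.inn g * σ ∈ P) :
    CosetStability P (V.map U.inn) Q (W.map U.inn) P.subtype cond := by
  refine CosetStability.intro ?_ ?_ ?_ (fun p => hPQ p.2) ?_ ?_
  · rintro _ ⟨g, hg, rfl⟩
    exact ((hV g).1 hg).2
  · rintro _ ⟨g, hg, rfl⟩
    exact hW g hg
  · rintro q hq _ ⟨g, hg, rfl⟩
    exact ⟨q.val.mapU g, hWn q hq g hg, (conj_inn q g).symm⟩
  · rintro ⟨p, hp⟩
    constructor
    · rintro ⟨g, hg, rfl⟩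
      exact ⟨g, ((hV g).1 hg).1, rfl⟩
    · rintro ⟨g, hg, rfl⟩
      exact ⟨g, (hV g).2 ⟨hg, hp⟩, rfl⟩
  · intro hc σ hσ
    obtain ⟨g, hg, h⟩ := hs hc σ hσ
    exact ⟨⟨_, h⟩, g, hg, (mul_inv_cancel_right (U.inn g) σ).symm⟩

theorem cosetStability_gunitOver_subtype {ι : OddFormHom X T} (hι : ι.Injective) (hPQ : P ≤ Q)
    (hV : ∀ g, g ∈ V ↔ g ∈ W ∧ U.inn g ∈ P) (hW : ∀ g ∈ W, U.inn g ∈ Q)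
    (hWn : ∀ σ ∈ Q, ∀ g ∈ W, σ.val.mapU g ∈ W)
    (hs : cond → ∀ σ ∈ Q, ∃ g ∈ W, U.inn g * σ ∈ P) :
    CosetStability (gunitOver ι P) (V.map ι.mapU) (gunitOver ι Q) (W.map ι.mapU)
      (gunitOver ι P).subtype cond := by
  refine CosetStability.intro ?_ ?_ ?_ (fun p => gunitOver_mono ι hPQ p.2) ?_ ?_
  · rintro _ ⟨g, hg, rfl⟩
    exact mapU_mem_gunitOver ι ((hV g).1 hg).2
  · rintro _ ⟨g, hg, rfl⟩
    exact mapU_mem_gunitOver ι (hW g hg)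
  · rintro q hq _ ⟨g, hg, rfl⟩
    obtain ⟨σ, hσ, e⟩ := (mem_gunitOver_iff _ _ _).1 hq
    exact ⟨σ.val.mapU g, hWn σ hσ g hg, (conj_mapU ι e g).symm⟩
  · rintro ⟨p, hp⟩
    constructor
    · rintro ⟨g, hg, rfl⟩
      exact ⟨g, ((hV g).1 hg).1, rfl⟩
    · rintro ⟨g, hg, rfl⟩
      obtain ⟨σ, hσ, e⟩ := (mem_gunitOver_iff _ _ _).1 hp
      -- As ι is injective, the automorphism induced by an element of the general unitary group is
      -- unique.
      have h1 : U.inn g = σ := Units.ext (hι.comp_cancel ((ι.mapU_smul g).symm.trans e))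
      exact ⟨g, (hV g).2 ⟨hg, h1 ▸ hσ⟩, rfl⟩
  · intro hc q hq
    obtain ⟨σ, hσ, e⟩ := (mem_gunitOver_iff _ _ _).1 hq
    obtain ⟨g, hg, h⟩ := hs hc σ hσ
    refine ⟨⟨ι.mapU g * q, (mem_gunitOver_iff _ _ _).2 ⟨_, h, ?_⟩⟩, g, hg,
      (mul_inv_cancel_right (ι.mapU g) q).symm⟩
    rw [mul_smul, e]
    change (ι.mapU g • ι).comp σ.val = _
    rw [ι.mapU_smul]; rfl

end Subtype

section Restriction

variable {e : X.R} {he : IsStarProjection e} {P : Subgroup (PU X)} {hP : P ≤ puFix e}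
  {Q : Subgroup (PU (Corner X e he))} {V : Subgroup (U X)} {W : Subgroup (U (Corner X e he))}
  {cond : Prop}

/-- Common form of the restriction statements: `hlift` (inner on the corner implies inner) gives
injectivity, and `hs` (extension after an inner change) gives surjectivity. -/
theorem cosetStability_resPU (hVP : ∀ g ∈ V, U.inn g ∈ P)
    (hVW : ∀ g : blockU e he, g.1 ∈ V → resU e he g ∈ W)
    (hr : ∀ p : P, resPU e he ⟨p.1, hP p.2⟩ ∈ Q)
    (hlift : ∀ p : P, ∀ k ∈ W, resPU e he ⟨p.1, hP p.2⟩ = U.inn k →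
      ∃ g : blockU e he, g.1 ∈ V ∧ resU e he g = k ∧ U.inn g.1 = p.1)
    (hW : ∀ k ∈ W, U.inn k ∈ Q) (hWn : ∀ σ ∈ Q, ∀ k ∈ W, σ.val.mapU k ∈ W)
    (hs : cond → ∀ σ ∈ Q, ∃ p : P, ∃ k ∈ W, resPU e he ⟨p.1, hP p.2⟩ = U.inn k * σ) :
    CosetStability P (V.map U.inn) Q (W.map U.inn)
      ((resPU e he).comp (Subgroup.inclusion hP)) cond := by
  have hres (g : blockU e he) (hg : U.inn g.1 ∈ puFix e) :
      resPU e he ⟨_, hg⟩ = U.inn (resU e he g) := by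
    have h := innHom_resU he g
    apply Units.ext
    ext x
    · exact (h.1 x).symm
    · exact (h.2 x).symm
  refine CosetStability.intro ?_ ?_ ?_ (fun p => hr p) ?_ ?_
  · rintro _ ⟨g, hg, rfl⟩
    exact hVP g hg
  · rintro _ ⟨g, hg, rfl⟩
    exact hW g hg
  · rintro q hq _ ⟨g, hg, rfl⟩
    exact ⟨q.val.mapU g, hWn q hq g hg, (conj_inn q g).symm⟩
  · rintro ⟨p, hp⟩
    constructor
    · rintro ⟨g, hg, rfl⟩
      have hb : g ∈ blockU e he := (mem_blockU_iff he g).2 (hP hp)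
      exact ⟨_, hVW ⟨g, hb⟩ hg, (hres ⟨g, hb⟩ (hP hp)).symm⟩
    · rintro ⟨k, hk, e'⟩
      obtain ⟨g, hg, -, h⟩ := hlift ⟨p, hp⟩ k hk e'.symm
      exact ⟨g.1, hg, h⟩
  · intro hc σ hσ
    obtain ⟨p, k, hk, h⟩ := hs hc σ hσ
    refine ⟨p, k, hk, ?_⟩
    change U.inn k = resPU e he ⟨p.1, hP p.2⟩ * σ⁻¹
    rw [h, mul_inv_cancel_right]

theorem OddFormHom.Injective.toCorner {ι : OddFormHom X T} (hι : ι.Injective) {ε : T.R}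
    (hε : IsStarProjection ε) (h : ι ∈ homFix e ε) : (ι.toCorner he hε h).Injective :=
  ⟨fun _ _ h => Subtype.ext (hι.1 (congrArg Subtype.val h)),
    fun _ _ h => Subtype.ext (hι.2 (congrArg Subtype.val h))⟩

theorem resU_smul_toCorner {ι : OddFormHom X T} (g : blockU (ι.onR e) (ι.map_proj he))
    {σ : PU X} (hσ : σ ∈ puFix e) (h : g.1 • ι = ι.comp σ.val) :
    resU _ _ g • ι.toCorner he (ι.map_proj he) rfl =
      (ι.toCorner he (ι.map_proj he) rfl).comp (resPU e he ⟨σ, hσ⟩).val := by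
  rw [← toCorner_smul he (ι.map_proj he) g rfl]
  ext x
  · exact congrArg (fun f : OddFormHom X T => f.onR x.1) h
  · exact congrArg (fun f : OddFormHom X T => f.onD x.1) h

/-- The hypotheses on automorphisms are those of `cosetStability_resPU`. Elements of U(T, Ξ) are not
determined by their action on (R, Δ), so the isometry i is needed to recover them from the action
and the corner component. -/
theorem cosetStability_resU {ι : OddFormHom X T} (hι : ι.Injective) {e₁ : X.R}
    (i : Isometry X e e₁) (hor : e * e₁ = 0) (hVP : ∀ g ∈ V, U.inn g ∈ P)
    (hVW : ∀ g : blockU e he, g.1 ∈ V → resU e he g ∈ W)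
    (hr : ∀ p : P, resPU e he ⟨p.1, hP p.2⟩ ∈ Q)
    (hlift : ∀ p : P, ∀ k ∈ W, resPU e he ⟨p.1, hP p.2⟩ = U.inn k →
      ∃ g : blockU e he, g.1 ∈ V ∧ resU e he g = k ∧ U.inn g.1 = p.1)
    (hW : ∀ k ∈ W, U.inn k ∈ Q) (hWn : ∀ σ ∈ Q, ∀ k ∈ W, σ.val.mapU k ∈ W)
    (hs : cond → ∀ σ ∈ Q, ∃ p : P, ∃ k ∈ W, resPU e he ⟨p.1, hP p.2⟩ = U.inn k * σ)
    (hb : gunitOver ι P ≤ blockU (ι.onR e) (ι.map_proj he)) :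
    CosetStability (gunitOver ι P) (V.map ι.mapU)
      (gunitOver (ι.toCorner he (ι.map_proj he) rfl) Q)
      (W.map (ι.toCorner he (ι.map_proj he) rfl).mapU)
      ((resU (ι.onR e) (ι.map_proj he)).comp (Subgroup.inclusion hb)) cond := by
  obtain ⟨ι', hι'⟩ : ∃ ι', ι' = ι.toCorner he (ι.map_proj he) rfl := ⟨_, rfl⟩
  have hinj : ι'.Injective := hι' ▸ hι.toCorner (ι.map_proj he) rfl
  have hmap (g : blockU e he) (hg : ι.mapU g.1 ∈ blockU (ι.onR e) (ι.map_proj he)) :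
      resU (ι.onR e) (ι.map_proj he) ⟨_, hg⟩ = ι'.mapU (resU e he g) := by
    subst hι'
    ext
    · change ι.onR g.1.beta - ι.onR e * ι.onR g.1.beta = ι.onR (g.1.beta - e * g.1.beta)
      rw [map_sub, map_mul]
    · change T.act1 (ι.onD g.1.gamma) (-ι.onR e) = ι.onD (X.act1 g.1.gamma (-e))
      rw [ι.map_act1, map_neg]
  have hres (p : U T) (hp : p ∈ gunitOver ι P) {σ : PU X} (hσ : σ ∈ P)
      (h : p • ι = ι.comp σ.val) :
      resU (ι.onR e) (ι.map_proj he) ⟨p, hb hp⟩ • ι' = ι'.comp (resPU e he ⟨σ, hP hσ⟩).val := by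
    subst hι'
    exact resU_smul_toCorner ⟨p, hb hp⟩ (hP hσ) h
  rw [← hι']
  refine CosetStability.intro ?_ ?_ ?_ ?_ ?_ ?_
  · rintro _ ⟨g, hg, rfl⟩
    exact mapU_mem_gunitOver ι (hVP g hg)
  · rintro _ ⟨g, hg, rfl⟩
    exact mapU_mem_gunitOver ι' (hW g hg)
  · rintro q hq _ ⟨g, hg, rfl⟩
    obtain ⟨σ, hσ, e'⟩ := (mem_gunitOver_iff _ _ _).1 hq
    exact ⟨σ.val.mapU g, hWn σ hσ g hg, (conj_mapU ι' e' g).symm⟩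
  · rintro ⟨p, hp⟩
    obtain ⟨σ, hσ, h⟩ := (mem_gunitOver_iff _ _ _).1 hp
    exact (mem_gunitOver_iff _ _ _).2 ⟨_, hr ⟨σ, hσ⟩, hres p hp hσ h⟩
  · rintro ⟨p, hp⟩
    constructor
    · rintro ⟨g, hg, rfl⟩
      have hgb : g ∈ blockU e he := (mem_blockU_iff he g).2 (hP (hVP g hg))
      exact ⟨_, hVW ⟨g, hgb⟩ hg, (hmap ⟨g, hgb⟩ (hb hp)).symm⟩
    · rintro ⟨k, hk, e'⟩
      replace e' : ι'.mapU k = resU (ι.onR e) (ι.map_proj he) ⟨p, hb hp⟩ := e'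
      obtain ⟨σ, hσ, h⟩ := (mem_gunitOver_iff _ _ _).1 hp
      have h1 := hres p hp hσ h
      rw [← e', ι'.mapU_smul] at h1
      obtain ⟨g, hg, hgk, hgσ⟩ := hlift ⟨σ, hσ⟩ k hk (Units.ext (hinj.comp_cancel h1).symm)
      have hgP : ι.mapU g.1 ∈ gunitOver ι P := mapU_mem_gunitOver ι (hVP g.1 hg)
      have h2 : ι.mapU g.1 • ι = p • ι := by
        rw [ι.mapU_smul, h, show σ = U.inn g.1 from hgσ.symm]; rfl
      -- The elements ι(g) and p act in the same way on (R, Δ) and have the same corner component,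
      -- so they coincide.
      have h3 : (⟨ι.mapU g.1, hb hgP⟩⁻¹ * ⟨p, hb hp⟩ :
          blockU (ι.onR e) (ι.map_proj he)) = 1 := by
        refine eq_one_of_resU_eq_one he i hor ι _ ?_ ?_
        · rw [map_mul, map_inv, ← e', hmap g, hgk, inv_mul_cancel]
        · change ((ι.mapU g.1)⁻¹ * p) • ι = ι
          rw [mul_smul, ← h2, inv_smul_smul]
      exact ⟨g.1, hg, congrArg Subtype.val (inv_mul_eq_one.1 h3)⟩
  · intro hc q hq
    obtain ⟨σ, hσ, h⟩ := (mem_gunitOver_iff _ _ _).1 hq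
    obtain ⟨p, k, hk, hpk⟩ := hs hc σ hσ
    have hf : ι.comp p.1.val ∈ homFix e (ι.onR e) := congrArg ι.onR (hP p.2)
    -- The embeddings ι and ι ∘ p restrict to corner morphisms conjugate under ι'(k)q. The resulting
    -- block diagonal element realises p and has exactly this corner component.
    obtain ⟨g, hg1, hg2, -⟩ := exists_smul_eq_of_conj_on_corner he (ι.map_proj he) i hor
      (f₁ := ι) (f₂ := ι.comp p.1.val) rfl hf (ι'.mapU k * q) (by
        rw [mul_smul, ← hι', h]
        have h1 : ι'.mapU k • ι'.comp σ.val = (ι'.mapU k • ι').comp σ.val := rfl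
        rw [h1, ι'.mapU_smul]
        have h2 : (ι'.comp (U.innHom k)).comp σ.val = ι'.comp (U.inn k * σ).val := rfl
        rw [h2, ← hpk]
        subst hι'
        rfl)
    refine ⟨⟨g.1, (mem_gunitOver_iff _ _ _).2 ⟨p.1, p.2, hg2⟩⟩, k, hk, ?_⟩
    change ι'.mapU k = resU (ι.onR e) (ι.map_proj he) g * q⁻¹
    rw [hg1, mul_inv_cancel_right]

end Restriction

end GeneralUnitary

end OddForm

namespace OddForm

/-- Hermitian idempotents of an odd form ring. -/
abbrev IsProjection (X : OddFormRing.{u, v}) (e : X.R) : Prop := IsStarProjection e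

/-! ### Inputs for the absolute statements -/

section Absolute

variable {X : OddFormRing.{u, v}} {Y : OddFormRing.{u₁, v₁}}

/-- An isometry between elements of a corner belongs to the corner. -/
def Isometry.toCorner {e : X.R} (he : IsStarProjection e) {a b : (Corner X e he).R}
    (i : Isometry X a.1 b.1) : Isometry (Corner X e he) a b where
  alpha := ⟨i.alpha, by rw [← i.left_mul, ← mul_assoc, a.2.1, zero_mul], by
    rw [← i.mul_right, mul_assoc, b.2.2, mul_zero]⟩
  gamma := ⟨i.gamma, by
      rw [← i.gamma_act, X.act_act1, mul_neg, b.2.2, neg_zero, add_zero], by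
      rw [i.pi_gamma, ← i.left_mul, mul_sub, ← mul_assoc, a.2.1, b.2.1, zero_mul, sub_zero], by
      rw [i.pi_gamma, ← i.mul_right, sub_mul, mul_assoc, b.2.2, mul_zero, sub_zero]⟩
  left_mul := Subtype.ext i.left_mul
  mul_right := Subtype.ext i.mul_right
  star_mul := Subtype.ext i.star_mul
  mul_star := Subtype.ext i.mul_star
  gamma_act := Subtype.ext i.gamma_act
  pi_gamma := Subtype.ext i.pi_gamma
  rho_gamma := Subtype.ext i.rho_gamma

/-- The isometry is composed of f(e₁) ≅ f(e) = ε ≅ ε₁; its ends lie in the corner, hence so does the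
whole isometry. -/
theorem toCorner_mem_homStar {e : Y.R} {ε : X.R} (he : IsStarProjection e)
    (hε : IsStarProjection ε) {e₁ : (Corner Y e he).R} (i : Isometry Y e e₁.1)
    {ε₁ : (Corner X ε hε).R} (j : Isometry X ε ε₁.1) {f : OddFormHom Y X} (hf : f ∈ homFix e ε) :
    f.toCorner he hε hf ∈ homStar e₁ ε₁ := by
  have hf' : f.onR e = ε := hf
  have k := (i.map f).symm
  rw [hf'] at k
  exact ⟨Isometry.toCorner hε (a := (f.toCorner he hε hf).onR e₁) (k.trans j)⟩

theorem inn_mem_puStar {e : X.R} (he : IsStarProjection e) (g : U X) :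
    U.inn g ∈ puStar e he := ⟨Isometry.ofUnit g he⟩

/-- If g carries f to f' and both send a to e, then g fixes e and is block diagonal. Transitivity
`hc` moves f(a) to e. -/
theorem orbitStability_homStar {a : Y.R} {e : X.R} (he : IsStarProjection e) {cond : Prop}
    (hc : cond → ∀ {ε : X.R}, Isometry X ε e → UConj ε e) :
    OrbitStability (blockU e he) (homFix a e) (⊤ : Subgroup (U X)) (homStar a e) (fun f => f.1)
      cond := by
  refine OrbitStability.intro ?_ ?_ ?_
  · rintro ⟨f, hf⟩
    exact ⟨by rw [show f.onR a = e from hf]; exact Isometry.refl he⟩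
  · rintro ⟨f, hf⟩ ⟨f', hf'⟩
    constructor
    · rintro ⟨g, -, h⟩
      exact ⟨g, Subgroup.mem_top g, h⟩
    · rintro ⟨g, -, h⟩
      refine ⟨g, (mem_blockU_iff he g).2 ?_, h⟩
      have h1 : (g • f).onR a = f'.onR a := by rw [show g • f = f' from h]
      rwa [OddFormHom.smul_onR, show f.onR a = e from hf, show f'.onR a = e from hf'] at h1
  · rintro h f ⟨i⟩
    obtain ⟨g, hg⟩ := hc h i
    exact ⟨⟨g • f, hg⟩, g, Subgroup.mem_top g, rfl⟩

/-- Injectivity is the lifting of conjugacy from the corner. For surjectivity, transitivity in the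
corner first makes the image of e₁ equal to ε₁, and then j serves as the image of i in an extension.
-/
theorem orbitStability_toCorner {e : Y.R} {ε : X.R} (he : IsStarProjection e)
    (hε : IsStarProjection ε) {e₁ : (Corner Y e he).R} (i : Isometry Y e e₁.1)
    {ε₁ : (Corner X ε hε).R} (j : Isometry X ε ε₁.1) {cond : Prop}
    (hc : cond → ∀ {δ : (Corner X ε hε).R}, Isometry (Corner X ε hε) δ ε₁ → UConj δ ε₁) :
    OrbitStability (blockU ε hε) (homFix e ε) (⊤ : Subgroup (U (Corner X ε hε))) (homStar e₁ ε₁)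
      (fun f => f.1.toCorner he hε f.2) cond := by
  refine OrbitStability.intro (fun f => toCorner_mem_homStar he hε i j f.2) ?_ ?_
  · rintro ⟨f, hf⟩ ⟨f', hf'⟩
    constructor
    · rintro ⟨g, hg, rfl⟩
      exact ⟨resU ε hε ⟨g, hg⟩, Subgroup.mem_top _, (toCorner_smul he hε ⟨g, hg⟩ hf).symm⟩
    · rintro ⟨k, -, h⟩
      obtain ⟨g, -, hg, -⟩ := exists_smul_eq_of_conj_on_corner he hε i e₁.2.1 hf hf' k h.symm
      exact ⟨g.1, g.2, hg⟩
  · rintro h f ⟨k⟩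
    obtain ⟨g, hg⟩ := hc h k
    have l : Isometry X ε ((g • f).onR e₁).1 := by
      rw [OddFormHom.smul_onR, hg]; exact j
    obtain ⟨F, hF, hF', -⟩ := exists_extension he hε (g • f) i l
    exact ⟨⟨F, hF⟩, g, Subgroup.mem_top g, hF'.symm⟩

variable {e : X.R} (he : IsStarProjection e)

theorem mem_blockU_iff_inn_mem (g : U X) : g ∈ blockU e he ↔ g ∈ (⊤ : Subgroup (U X)) ∧
    U.inn g ∈ puFix e := by
  rw [mem_blockU_iff]
  exact ⟨fun h => ⟨Subgroup.mem_top g, h⟩, fun h => h.2⟩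

theorem puFix_le_puStar : puFix e ≤ puStar e he := by
  intro σ hσ
  exact ⟨by rw [show σ.val.onR e = e from hσ]; exact Isometry.refl he⟩

theorem exists_inn_mul_mem_puFix {cond : Prop}
    (hc : cond → ∀ {ε : X.R}, Isometry X ε e → UConj ε e) (h : cond) (σ : PU X)
    (hσ : σ ∈ puStar e he) : ∃ g ∈ (⊤ : Subgroup (U X)), U.inn g * σ ∈ puFix e := by
  obtain ⟨i⟩ := hσ
  obtain ⟨g, hg⟩ := hc h i
  exact ⟨g, Subgroup.mem_top g, hg⟩

/-- A lift of an inner automorphism of a corner. -/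
theorem exists_inn_eq {e₁ : X.R} (i : Isometry X e e₁) (hor : e * e₁ = 0) (σ : puFix e)
    (k : U (Corner X e he)) (h : resPU e he σ = U.inn k) :
    ∃ g : blockU e he, resU e he g = k ∧ U.inn g.1 = σ.1 ∧ ∀ I : OddFormIdeal X, σ.1 ∈ I.pu →
      k ∈ (I.restrict (cornerSub X e he)).unitary → g.1 ∈ I.unitary := by
  obtain ⟨g, h1, h2, h3⟩ := exists_smul_eq_of_conj_on_corner he he i hor
    (f₁ := (1 : OddFormHom X X)) (f₂ := σ.1.val) rfl σ.2 k (congrArg Units.val h)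
  exact ⟨g, h1, Units.ext h2, fun I hI hk => h3 I hI.1 hI.2 hk⟩

/-- An inner change makes σ fix e₁, and an automorphism of the corner fixing e₁ extends. -/
theorem exists_resPU_eq_inn_mul {e₁ : (Corner X e he).R} (he₁ : IsStarProjection e₁)
    (i : Isometry X e e₁.1) {cond : Prop}
    (hc : cond → ∀ {δ : (Corner X e he).R}, Isometry (Corner X e he) δ e₁ → UConj δ e₁)
    (h : cond) (σ : PU (Corner X e he)) (hσ : σ ∈ puStar e₁ he₁) :
    ∃ p : puFix e, ∃ k ∈ (⊤ : Subgroup (U (Corner X e he))), resPU e he p = U.inn k * σ := by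
  obtain ⟨k, hk, h1⟩ := exists_inn_mul_mem_puFix he₁ hc h σ hσ
  obtain ⟨τ, hτ, -⟩ := exists_resPU_eq he (U.inn k * σ) i h1
  exact ⟨τ, k, hk, hτ⟩

end Absolute

/-! ### Passage between the double and the relative groups -/

section Relative

variable {X : OddFormRing.{u, v}} (I : OddFormIdeal X)

theorem OddFormIdeal.mem_restrict_ideal {A : OddFormSubring X} (x : A.toOddFormRing.R) :
    x ∈ (I.restrict A).ideal ↔ x.1 ∈ I.ideal := by
  rw [OddFormIdeal.restrict, TwoSidedIdeal.mem_mk']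
  rfl

/-- The embedding σ ↦ σ × id acts trivially on the second coordinate, so only the first one imposes
a condition. -/
theorem OddFormIdeal.mem_relative_puFix_iff (e : I.Double.R) (σ : PU X) :
    σ ∈ I.relative (puFix e) ↔ σ ∈ I.pu ∧ σ.val.onR e.1.1 = e.1.1 := by
  constructor
  · rintro ⟨σ, hσ, rfl⟩
    exact ⟨σ.2, congrArg (fun z : I.Double.R => z.1.1) hσ⟩
  · rintro ⟨h, h'⟩
    exact ⟨⟨σ, h⟩, Subtype.ext (Prod.ext h' rfl), rfl⟩

/-- The element `(g, 1)` of the unitary group of the double. -/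
def OddFormIdeal.unitaryDouble (g : I.unitary) : U I.Double where
  beta := ⟨(g.1.beta, 0), by
    change g.1.beta - 0 ∈ I.ideal
    rw [sub_zero]; exact g.2.1⟩
  gamma := ⟨(g.1.gamma, 0), by
    change g.1.gamma - 0 ∈ I.grp
    rw [sub_zero]; exact g.2.2⟩
  mul_star := Subtype.ext (Prod.ext g.1.mul_star (U.mul_star (1 : U X)))
  star_mul := Subtype.ext (Prod.ext g.1.star_mul (U.star_mul (1 : U X)))
  pi_gamma := Subtype.ext (Prod.ext g.1.pi_gamma (U.pi_gamma (1 : U X)))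
  rho_gamma := Subtype.ext (Prod.ext g.1.rho_gamma (U.rho_gamma (1 : U X)))

theorem OddFormIdeal.puDouble_inn (g : I.unitary) :
    I.puDouble ⟨U.inn g.1, I.inn_mem g.2⟩ = U.inn (I.unitaryDouble g) := by
  have h1 : (1 : U X).innHom = 1 := by rw [← U.coe_inn, map_one]; rfl
  apply Units.ext
  refine OddFormHom.ext (fun x => Subtype.ext (Prod.ext rfl ?_))
    fun x => Subtype.ext (Prod.ext rfl ?_)
  · exact (congrArg (fun f : OddFormHom X X => f.onR x.1.2) h1).symm
  · exact (congrArg (fun f : OddFormHom X X => f.onD x.1.2) h1).symm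

theorem OddFormIdeal.inn_mem_relative {e : I.Double.R} (he : IsProjection I.Double e) {g : U X}
    (hg : g ∈ I.unitary) : U.inn g ∈ I.relative (puStar e he) := by
  refine ⟨⟨_, I.inn_mem hg⟩, ?_, rfl⟩
  change I.puDouble _ ∈ puStar e he
  rw [I.puDouble_inn ⟨g, hg⟩]
  exact inn_mem_puStar he _

theorem OddFormIdeal.mapU_mem_unitary {σ : PU X} (hσ : σ ∈ I.pu) {g : U X} (hg : g ∈ I.unitary) :
    σ.val.mapU g ∈ I.unitary := by
  constructor
  · have h := I.ideal.add_mem (hσ.1 g.beta) hg.1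
    rwa [sub_add_cancel] at h
  · have h := I.grp.add_mem (hσ.2 g.gamma) hg.2
    rwa [sub_add_cancel] at h

theorem OddFormIdeal.relative_mono {P Q : Subgroup (PU I.Double)} (h : P ≤ Q) :
    I.relative P ≤ I.relative Q := Subgroup.map_mono (Subgroup.comap_mono h)

/-- The projections of the double. -/
def OddFormIdeal.doubleFst : OddFormHom I.Double X :=
  (OddFormHom.fst X X).comp I.doubleSub.incl
/-- See `doubleFst`. -/
def OddFormIdeal.doubleSnd : OddFormHom I.Double X where
  onR := { toFun := fun x => x.1.2, map_zero' := rfl, map_add' := fun _ _ => rfl,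
           map_mul' := fun _ _ => rfl }
  onD := { toFun := fun x => x.1.2, map_zero' := rfl, map_add' := fun _ _ => rfl }
  map_star _ := rfl
  map_act _ _ := rfl
  map_phi _ := rfl
  map_pi _ := rfl
  map_rho _ := rfl

theorem OddFormHom.map_innHom {Y : OddFormRing.{u₁, v₁}} (f : OddFormHom X Y) (g : U X) (x : X.R) :
    f.onR (g.innHom.onR x) = (f.mapU g).innHom.onR (f.onR x) := by
  simp [f.map_star]

/-- The two coordinates of G are congruent modulo (I, Γ), so their quotient is congruent to 1. -/
theorem OddFormIdeal.mul_inv_mem_unitary (G : U I.Double) :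
    (I.doubleSnd.mapU G)⁻¹ * I.doubleFst.mapU G ∈ I.unitary := by
  set g := I.doubleSnd.mapU G with hg
  set h := I.doubleFst.mapU G with hh
  have h1 : h.beta - g.beta ∈ I.ideal := G.beta.2
  have h2 : h.gamma - g.gamma ∈ I.grp := G.gamma.2
  have hx : star g.beta * h.beta + star g.beta + h.beta ∈ I.ideal := by
    have h3 := I.ideal.add_mem (I.ideal.mul_mem_left (star g.beta) _ h1) h1
    have h4 : star g.beta * (h.beta - g.beta) + (h.beta - g.beta) =
        star g.beta * h.beta + star g.beta + h.beta := by
      rw [mul_sub, U.star_mul_eq]; abel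
    rwa [h4] at h3
  refine ⟨hx, ?_⟩
  change X.act1 (-X.act1 g.gamma (star g.beta)) h.beta + h.gamma ∈ I.grp
  have h5 : star g.beta + h.beta + star g.beta * h.beta =
      star g.beta * h.beta + star g.beta + h.beta := by abel
  rw [X.neg_act1, X.act1_act1, h5, OddFormRing.act1, add_assoc g.gamma, neg_add_rev, add_assoc]
  refine I.grp.add_mem (I.grp.neg_mem (I.grp.add_mem (I.phi_mem ?_) (I.act_mem_of_mem _ hx))) ?_
  · exact I.ideal.mul_mem_right _ _ (I.star_mem hx)
  · have h6 := I.normal.conj_mem _ h2 (-g.gamma)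
    rwa [neg_neg, sub_eq_add_neg, ← add_assoc, neg_add_cancel_right] at h6

/-- Transitivity in the double yields a unitary pair (h, g) with h carrying σ(e) to e and g fixing
e. Then g⁻¹h still carries σ(e) to e, and it lies in U(I, Γ). -/
theorem OddFormIdeal.exists_inn_mul_mem_relative {e : X.R} {e₂ : I.Double.R} (he₂ : e₂.1 = (e, e))
    (hp : IsProjection I.Double e₂) {cond : Prop}
    (hc : cond → ∀ {ε : I.Double.R}, Isometry I.Double ε e₂ → UConj ε e₂) (h : cond) (σ : PU X)
    (hσ : σ ∈ I.relative (puStar e₂ hp)) :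
    ∃ g ∈ I.unitary, U.inn g * σ ∈ I.relative (puFix e₂) := by
  obtain ⟨σ, ⟨i⟩, rfl⟩ := hσ
  obtain ⟨G, hG⟩ := hc h i
  have h1 : (I.doubleFst.mapU G).innHom.onR (σ.1.val.onR e) = e := by
    have h2 := congrArg I.doubleFst.onR hG
    rw [OddFormHom.map_innHom] at h2
    have h3 : I.doubleFst.onR e₂ = e := congrArg Prod.fst he₂
    have h4 : I.doubleFst.onR ((I.puDouble σ).val.onR e₂) = σ.1.val.onR (I.doubleFst.onR e₂) := rfl
    rwa [h4, h3] at h2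
  have h1' : (I.doubleSnd.mapU G).innHom.onR e = e := by
    have h2 := congrArg I.doubleSnd.onR hG
    rw [OddFormHom.map_innHom] at h2
    have h3 : I.doubleSnd.onR e₂ = e := congrArg Prod.snd he₂
    have h4 : I.doubleSnd.onR ((I.puDouble σ).val.onR e₂) = I.doubleSnd.onR e₂ := rfl
    rwa [h4, h3] at h2
  refine ⟨_, I.mul_inv_mem_unitary G, (I.mem_relative_puFix_iff e₂ _).2
    ⟨mul_mem (I.inn_mem (I.mul_inv_mem_unitary G)) σ.2, ?_⟩⟩
  have h5 : e₂.1.1 = e := congrArg Prod.fst he₂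
  rw [h5]
  change (((I.doubleSnd.mapU G)⁻¹ * I.doubleFst.mapU G).innHom).onR (σ.1.val.onR e) = e
  rw [innHom_mul, OddFormHom.comp_onR, h1]
  conv_lhs => rw [← h1']
  rw [← OddFormHom.comp_onR, ← innHom_mul, inv_mul_cancel, innHom_one]
  rfl

/-- The morphism from the corner of the double to the double of the corner. -/
def OddFormIdeal.cornerDouble {e : X.R} (he : IsStarProjection e) {e₂ : I.Double.R}
    (he₂ : e₂.1 = (e, e)) (hp : IsProjection I.Double e₂) :
    OddFormHom (Corner I.Double e₂ hp) (I.restrict (cornerSub X e he)).Double :=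
  have h1 : e₂.1.1 = e := congrArg Prod.fst he₂
  have h2 : e₂.1.2 = e := congrArg Prod.snd he₂
  { onR :=
      { toFun := fun x => ⟨(⟨x.1.1.1, by
            have h := congrArg (fun z : I.Double.R => z.1.1) x.2.1
            have h' := congrArg (fun z : I.Double.R => z.1.1) x.2.2
            exact ⟨h1 ▸ h, h1 ▸ h'⟩⟩, ⟨x.1.1.2, by
            have h := congrArg (fun z : I.Double.R => z.1.2) x.2.1
            have h' := congrArg (fun z : I.Double.R => z.1.2) x.2.2
            exact ⟨h2 ▸ h, h2 ▸ h'⟩⟩), by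
          exact (I.mem_restrict_ideal _).2 x.1.2⟩
        map_zero' := rfl
        map_add' := fun _ _ => rfl
        map_mul' := fun _ _ => rfl }
    onD :=
      { toFun := fun x => ⟨(⟨x.1.1.1, by
            have h := congrArg (fun z : I.Double.D => z.1.1) x.2.1
            have h' := congrArg (fun z : I.Double.R => z.1.1) x.2.2.1
            have h'' := congrArg (fun z : I.Double.R => z.1.1) x.2.2.2
            exact ⟨h1 ▸ h, h1 ▸ h', h1 ▸ h''⟩⟩, ⟨x.1.1.2, by
            have h := congrArg (fun z : I.Double.D => z.1.2) x.2.1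
            have h' := congrArg (fun z : I.Double.R => z.1.2) x.2.2.1
            have h'' := congrArg (fun z : I.Double.R => z.1.2) x.2.2.2
            exact ⟨h2 ▸ h, h2 ▸ h', h2 ▸ h''⟩⟩), x.1.2⟩
        map_zero' := rfl
        map_add' := fun _ _ => rfl }
    map_star := fun _ => rfl
    map_act := fun _ _ => rfl
    map_phi := fun _ => rfl
    map_pi := fun _ => rfl
    map_rho := fun _ => rfl }

/-- The morphism from the double of an odd form subring. -/
def OddFormIdeal.restrictDouble (A : OddFormSubring X) :
    OddFormHom (I.restrict A).Double I.Double where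
  onR :=
    { toFun := fun x => ⟨(x.1.1.1, x.1.2.1), (I.mem_restrict_ideal _).1 x.2⟩
      map_zero' := rfl
      map_add' := fun _ _ => rfl
      map_mul' := fun _ _ => rfl }
  onD :=
    { toFun := fun x => ⟨(x.1.1.1, x.1.2.1), x.2⟩
      map_zero' := rfl
      map_add' := fun _ _ => rfl }
  map_star _ := rfl
  map_act _ _ := rfl
  map_phi _ := rfl
  map_pi _ := rfl
  map_rho _ := rfl

end Relative

end OddForm

namespace OddForm

/-! ### Corners of doubles and relative restriction -/

namespace FreeHyperbolicFamily

variable {X : OddFormRing.{u, v}} {n : ℕ} (H : FreeHyperbolicFamily X n)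

theorem uconj_corner_absLast (hn : 1 ≤ n) (hn2 : 1 ≤ n - 1) (h : H.LambdaSrLE hn (n - 2))
    {δ : (Corner X (H.absLast hn) (H.absLast_proj hn)).R}
    (i : Isometry (Corner X (H.absLast hn) (H.absLast_proj hn)) δ ((H.corner hn).absLast hn2)) :
    UConj δ ((H.corner hn).absLast hn2) := by
  refine (H.corner hn).uconj_absLast hn2 (H.LambdaSrLE_corner hn hn2 ?_) i
  rwa [Nat.sub_sub]

variable (I : OddFormIdeal X)

theorem map_diag_absLast (hn : 1 ≤ n) :
    ((H.map I.diag).absLast hn).1 = (H.absLast hn, H.absLast hn) := rfl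

/-- As in the absolute case, applied to both coordinates: the Peirce component of η_1 in the double
of R already lies in the double of the corner. -/
theorem LambdaSrLE_corner_double (hn : 1 ≤ n) (hn2 : 1 ≤ n - 1) {k : ℕ}
    (h : (H.map I.diag).LambdaSrLE hn k) :
    ((H.corner hn).map
      (I.restrict (cornerSub X (H.absLast hn) (H.absLast_proj hn))).diag).LambdaSrLE hn2 k := by
  refine LambdaSrLE_of_hom _ _ hn hn2 (I.restrictDouble _) ?_ rfl ?_ ?_ h
  · intro x y hxy
    have h1 := congrArg (fun z : I.Double.R => z.1.1) hxy
    have h2 := congrArg (fun z : I.Double.R => z.1.2) hxy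
    exact Subtype.ext (Prod.ext (Subtype.ext h1) (Subtype.ext h2))
  · rintro ⟨⟨x, y⟩, hxy⟩ h1 h2
    have hx := H.mem_cornerSub_of_first hn hn2 (congrArg (fun z : I.Double.R => z.1.1) h1)
      (congrArg (fun z : I.Double.R => z.1.1) h2)
    have hy := H.mem_cornerSub_of_first hn hn2 (congrArg (fun z : I.Double.R => z.1.2) h1)
      (congrArg (fun z : I.Double.R => z.1.2) h2)
    exact ⟨⟨(⟨x, hx⟩, ⟨y, hy⟩), (I.mem_restrict_ideal _).2 hxy⟩, rfl⟩
  · rintro ⟨⟨x, y⟩, hxy⟩ h1 h2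
    have hx := H.mem_cornerSub_of_act_first hn hn2 (congrArg (fun z : I.Double.D => z.1.1) h1)
      (congrArg (fun z : I.Double.R => z.1.1) h2)
    have hy := H.mem_cornerSub_of_act_first hn hn2 (congrArg (fun z : I.Double.D => z.1.2) h1)
      (congrArg (fun z : I.Double.R => z.1.2) h2)
    exact ⟨⟨(⟨x, hx⟩, ⟨y, hy⟩), hxy⟩, rfl⟩

theorem uconj_corner_double (hn : 1 ≤ n) (hn2 : 1 ≤ n - 1)
    (h : (H.map I.diag).LambdaSrLE hn (n - 2))
    {δ : (I.restrict (cornerSub X (H.absLast hn) (H.absLast_proj hn))).Double.R}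
    (i : Isometry (I.restrict (cornerSub X (H.absLast hn) (H.absLast_proj hn))).Double δ
      (((H.corner hn).map
        (I.restrict (cornerSub X (H.absLast hn) (H.absLast_proj hn))).diag).absLast hn2)) :
    UConj δ (((H.corner hn).map
      (I.restrict (cornerSub X (H.absLast hn) (H.absLast_proj hn))).diag).absLast hn2) := by
  refine FreeHyperbolicFamily.uconj_absLast _ hn2 (H.LambdaSrLE_corner_double I hn hn2 ?_) i
  rwa [Nat.sub_sub]

theorem mem_blockU_inf_unitary_iff (hn : 1 ≤ n) (g : U X) :
    g ∈ blockU (H.absLast hn) (H.absLast_proj hn) ⊓ I.unitary ↔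
      g ∈ I.unitary ∧ U.inn g ∈ I.relative (puFix ((H.map I.diag).absLast hn)) := by
  rw [I.mem_relative_puFix_iff, Subgroup.mem_inf, mem_blockU_iff]
  exact ⟨fun h => ⟨h.2, I.inn_mem h.2, h.1⟩, fun h => ⟨h.2.2, h.1⟩⟩

theorem resU_mem_unitary {e : X.R} (he : IsStarProjection e) {g : blockU e he}
    (hg : g.1 ∈ I.unitary) : resU e he g ∈ (I.restrict (cornerSub X e he)).unitary :=
  ⟨(I.mem_restrict_ideal _).2 (I.ideal.sub_mem hg.1 (I.ideal.mul_mem_left _ _ hg.1)),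
    I.act1_mem hg.2 _⟩

theorem resPU_mem_pu {e : X.R} (he : IsStarProjection e) {σ : puFix e} (hσ : σ.1 ∈ I.pu) :
    resPU e he σ ∈ (I.restrict (cornerSub X e he)).pu :=
  ⟨fun x => (I.mem_restrict_ideal _).2 (hσ.1 x.1), fun x => hσ.2 x.1⟩

/-- The isometry is found in the corner of the double and then carried to the double of the corner
by `OddFormIdeal.cornerDouble`. -/
theorem resPU_mem_relative (hn : 1 ≤ n) (hn2 : 1 ≤ n - 1) {σ : PU X}
    (hσ : σ ∈ I.relative (puFix ((H.map I.diag).absLast hn))) :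
    resPU (H.absLast hn) (H.absLast_proj hn) ⟨σ, H.relative_le_puFix I hn hσ⟩ ∈
      (I.restrict (cornerSub X (H.absLast hn) (H.absLast_proj hn))).relative
        (puStar (((H.corner hn).map
          (I.restrict (cornerSub X (H.absLast hn) (H.absLast_proj hn))).diag).absLast hn2)
          (FreeHyperbolicFamily.absLast_proj _ hn2)) := by
  have hσ' := H.relative_le_puFix I hn hσ
  obtain ⟨⟨σ, h⟩, hd, rfl⟩ := hσ
  obtain ⟨i⟩ := toCorner_mem_homStar ((H.map I.diag).absLast_proj hn)
    ((H.map I.diag).absLast_proj hn) ((H.map I.diag).isometryLast hn hn2)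
    ((H.map I.diag).isometryLast hn hn2) hd
  refine ⟨⟨_, resPU_mem_pu I _ (σ := ⟨σ, hσ'⟩) h⟩, ⟨?_⟩, rfl⟩
  exact i.map (I.cornerDouble (H.absLast_proj hn) (H.map_diag_absLast I hn)
    ((H.map I.diag).absLast_proj hn))

end FreeHyperbolicFamily

end OddForm

/-- Stability for the orbits of morphisms of odd form rings and for the projective and general
unitary groups. -/
theorem mainTheorem4
    (S : OddFormRing.{u₁, v₁}) (R : OddFormRing.{u, v}) (T : OddFormRing.{u₂, v₂}) (m n : ℕ)
    (hm : 1 ≤ m) (hn : 1 ≤ n) (HS : FreeHyperbolicFamily S m) (HR : FreeHyperbolicFamily R n)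
    (ι : OddFormHom R T) (hι : ι.Injective) (I : OddFormIdeal R) :
    let eS : S.R := HS.absLast hm
    let hS : IsStarProjection eS := HS.absLast_proj hm
    let e : R.R := HR.absLast hn
    let he : IsStarProjection e := HR.absLast_proj hn
    -- the subgroups `U'_{|n|}` and `U'_{|n|}(I, Γ)`
    let U' : Subgroup (U R) := blockU e he
    let UI' : Subgroup (U R) := blockU e he ⊓ I.unitary
    -- the relative groups `PU_n` and `PU^*`
    let HD : FreeHyperbolicFamily I.Double n := HR.map I.diag
    let puFixI : Subgroup (PU R) := I.relative (puFix (HD.absLast hn))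
    let puStarI : Subgroup (PU R) := I.relative (puStar (HD.absLast hn) (HD.absLast_proj hn))
    -- (1)
    (OrbitStability U' (homFix eS e) (⊤ : Subgroup (U R)) (homStar eS e) (fun f => f.1)
        (HR.LambdaSrLE hn (n - 1)) ∧
      CosetStability (puFix e) (U'.map U.inn) (puStar e he) U.inn.range (puFix e).subtype
        (HR.LambdaSrLE hn (n - 1)) ∧
      CosetStability (gunitOver ι (puFix e)) (U'.map ι.mapU) (gunitOver ι (puStar e he))
        ι.mapU.range (gunitOver ι (puFix e)).subtype (HR.LambdaSrLE hn (n - 1))) ∧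
    -- (2) for the orbits of morphisms
    (∀ (hm2 : 1 ≤ m - 1) (hn2 : 1 ≤ n - 1),
      OrbitStability U' (homFix eS e) (⊤ : Subgroup (U (Corner R e he)))
        (homStar ((HS.corner hm).absLast hm2) ((HR.corner hn).absLast hn2))
        (fun f => f.1.toCorner hS he f.2) (HR.LambdaSrLE hn (n - 2))) ∧
    -- (3)
    (CosetStability puFixI (UI'.map U.inn) puStarI (I.unitary.map U.inn) puFixI.subtype
        (HD.LambdaSrLE hn (n - 1)) ∧
      CosetStability (gunitOver ι puFixI) (UI'.map ι.mapU) (gunitOver ι puStarI)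
        (I.unitary.map ι.mapU) (gunitOver ι puFixI).subtype
        (HD.LambdaSrLE hn (n - 1))) ∧
    ∀ hn2 : 1 ≤ n - 1,
      -- the objects of rank `n - 1`
      let R' : OddFormRing.{u, v} := Corner R e he
      let T' : OddFormRing.{u₂, v₂} := Corner T (ι.onR e) (ι.map_proj he)
      let HR' : FreeHyperbolicFamily R' (n - 1) := HR.corner hn
      let ι' : OddFormHom R' T' := ι.toCorner he (ι.map_proj he) rfl
      let I' : OddFormIdeal R' := I.restrict (cornerSub R e he)
      let e' : R'.R := HR'.absLast hn2
      let he' : IsStarProjection e' := HR'.absLast_proj hn2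
      let puStar' : Subgroup (PU R') := puStar e' he'
      let HD' : FreeHyperbolicFamily I'.Double (n - 1) := HR'.map I'.diag
      let puStarI' : Subgroup (PU R') :=
        I'.relative (puStar (HD'.absLast hn2) (HD'.absLast_proj hn2))
      let hI : puFixI ≤ puFix e := HR.relative_le_puFix I hn
      -- (2) for the projective and general unitary groups
      (CosetStability (puFix e) (U'.map U.inn) puStar' U.inn.range (resPU e he)
          (HR.LambdaSrLE hn (n - 2)) ∧
        CosetStability (gunitOver ι (puFix e)) (U'.map ι.mapU) (gunitOver ι' puStar') ι'.mapU.range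
          ((resU (ι.onR e) (ι.map_proj he)).comp
            (Subgroup.inclusion (gunitOver_le_blockU ι he)))
          (HR.LambdaSrLE hn (n - 2))) ∧
      -- (4)
      (CosetStability puFixI (UI'.map U.inn) puStarI' (I'.unitary.map U.inn)
          ((resPU e he).comp (Subgroup.inclusion hI))
          (HD.LambdaSrLE hn (n - 2)) ∧
        CosetStability (gunitOver ι puFixI) (UI'.map ι.mapU) (gunitOver ι' puStarI')
          (I'.unitary.map ι'.mapU)
          ((resU (ι.onR e) (ι.map_proj he)).comp
            (Subgroup.inclusion ((gunitOver_mono ι hI).trans (gunitOver_le_blockU ι he))))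
          (HD.LambdaSrLE hn (n - 2))) ∧
      -- the resulting isomorphisms
      (HR.LambdaSrLE hn (n - 2) →
        ∃ Φ : puStar' ⧸ (U.inn (X := R')).range.subgroupOf puStar' ≃*
            puStar e he ⧸ (U.inn (X := R)).range.subgroupOf (puStar e he),
          ∀ σ : puFix e, ∃ (h : resPU e he σ ∈ puStar') (h' : σ.1 ∈ puStar e he),
            Φ (QuotientGroup.mk ⟨resPU e he σ, h⟩) = QuotientGroup.mk ⟨σ.1, h'⟩) ∧
      (HD.LambdaSrLE hn (n - 2) →
        ∃ Φ : puStarI' ⧸ (I'.unitary.map U.inn).subgroupOf puStarI' ≃*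
            puStarI ⧸ (I.unitary.map U.inn).subgroupOf puStarI,
          ∀ σ : puFixI, ∃ (h : resPU e he ⟨σ.1, hI σ.2⟩ ∈ puStarI') (h' : σ.1 ∈ puStarI),
            Φ (QuotientGroup.mk ⟨resPU e he ⟨σ.1, hI σ.2⟩, h⟩) = QuotientGroup.mk ⟨σ.1, h'⟩) := by
  intro eS hS e he U' UI' HD puFixI puStarI
  have hHD : IsProjection I.Double (HD.absLast hn) := HD.absLast_proj hn
  have hI : puFixI ≤ puFix e := HR.relative_le_puFix I hn
  have hIle : puFixI ≤ puStarI := I.relative_mono (puFix_le_puStar hHD)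
  have hIV : ∀ g, g ∈ UI' ↔ g ∈ I.unitary ∧ U.inn g ∈ puFixI :=
    HR.mem_blockU_inf_unitary_iff I hn
  have hIW : ∀ g ∈ I.unitary, U.inn g ∈ puStarI := fun g hg => I.inn_mem_relative hHD hg
  have hIn : ∀ σ ∈ puStarI, ∀ g ∈ I.unitary, σ.val.mapU g ∈ I.unitary :=
    fun σ hσ g hg => I.mapU_mem_unitary (I.relative_le_pu _ hσ) hg
  -- The condition is left open because the statement is used twice: with bound n - 1 in rank n, and
  -- with bound n - 2 for the final isomorphism. The same applies to `pu3`.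
  have pu1 {c : Prop} (hc : c → ∀ {ε : R.R}, Isometry R ε e → UConj ε e) :
      CosetStability (puFix e) (U'.map U.inn) (puStar e he) U.inn.range (puFix e).subtype c := by
    rw [MonoidHom.range_eq_map]
    exact cosetStability_subtype (puFix_le_puStar he) (mem_blockU_iff_inn_mem he)
      (fun g _ => inn_mem_puStar he g) (fun _ _ _ _ => Subgroup.mem_top _)
      (exists_inn_mul_mem_puFix he hc)
  have pu3 {c : Prop}
      (hc : c → ∀ {ε : I.Double.R}, Isometry I.Double ε (HD.absLast hn) →
        UConj ε (HD.absLast hn)) :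
      CosetStability puFixI (UI'.map U.inn) puStarI (I.unitary.map U.inn) puFixI.subtype c :=
    cosetStability_subtype hIle hIV hIW hIn
      (I.exists_inn_mul_mem_relative (HR.map_diag_absLast I hn) hHD hc)
  refine ⟨⟨orbitStability_homStar he fun h _ i => HR.uconj_absLast hn h i,
    pu1 fun h _ i => HR.uconj_absLast hn h i, ?_⟩, ?_,
    ⟨pu3 fun h _ i => HD.uconj_absLast hn h i,
      cosetStability_gunitOver_subtype hι hIle hIV hIW hIn
        (I.exists_inn_mul_mem_relative (HR.map_diag_absLast I hn) hHD
          fun h _ i => HD.uconj_absLast hn h i)⟩, ?_⟩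
  · rw [MonoidHom.range_eq_map]
    exact cosetStability_gunitOver_subtype hι (puFix_le_puStar he) (mem_blockU_iff_inn_mem he)
      (fun g _ => inn_mem_puStar he g) (fun _ _ _ _ => Subgroup.mem_top _)
      (exists_inn_mul_mem_puFix he fun h _ i => HR.uconj_absLast hn h i)
  · intro hm2 hn2
    exact orbitStability_toCorner hS he (HS.isometryLast hm hm2) (HR.isometryLast hn hn2)
      fun h _ i => HR.uconj_corner_absLast hn hn2 h i
  · intro hn2 R' T' HR' ι' I' e' he' puStar' HD' puStarI' hI
    have i : Isometry R e e'.1 := HR.isometryLast hn hn2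
    have hor : e * e'.1 = 0 := e'.2.1
    have hHD' : IsProjection I'.Double (HD'.absLast hn2) := HD'.absLast_proj hn2
    -- the absolute case
    have hVP : ∀ g ∈ U', U.inn g ∈ puFix e := fun g hg =>
      ((mem_blockU_iff_inn_mem he g).1 hg).2
    have hVW : ∀ g : blockU e he, g.1 ∈ U' → resU e he g ∈ (⊤ : Subgroup (U R')) :=
      fun g _ => Subgroup.mem_top _
    have hr : ∀ p : puFix e, resPU e he ⟨p.1, p.2⟩ ∈ puStar' := fun p =>
      toCorner_mem_homStar he he i i p.2
    have hlift : ∀ p : puFix e, ∀ k ∈ (⊤ : Subgroup (U R')), resPU e he ⟨p.1, p.2⟩ = U.inn k →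
        ∃ g : blockU e he, g.1 ∈ U' ∧ resU e he g = k ∧ U.inn g.1 = p.1 := fun p k _ h => by
      obtain ⟨g, h1, h2, -⟩ := exists_inn_eq he i hor p k h
      exact ⟨g, g.2, h1, h2⟩
    have hs := exists_resPU_eq_inn_mul he he' i
      (cond := HR.LambdaSrLE hn (n - 2)) fun h _ i => HR.uconj_corner_absLast hn hn2 h i
    have pu2 : CosetStability (puFix e) (U'.map U.inn) puStar' U.inn.range (resPU e he)
        (HR.LambdaSrLE hn (n - 2)) := by
      rw [MonoidHom.range_eq_map]
      exact cosetStability_resPU (hP := le_rfl) hVP hVW hr hlift (fun k _ => inn_mem_puStar he' k)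
        (fun _ _ _ _ => Subgroup.mem_top _) hs
    -- the relative case
    have hVPI : ∀ g ∈ UI', U.inn g ∈ puFixI := fun g hg => ((hIV g).1 hg).2
    have hVWI : ∀ g : blockU e he, g.1 ∈ UI' → resU e he g ∈ I'.unitary := fun g hg =>
      FreeHyperbolicFamily.resU_mem_unitary I he hg.2
    have hrI : ∀ p : puFixI, resPU e he ⟨p.1, hI p.2⟩ ∈ puStarI' := fun p =>
      HR.resPU_mem_relative I hn hn2 p.2
    have hliftI : ∀ p : puFixI, ∀ k ∈ I'.unitary, resPU e he ⟨p.1, hI p.2⟩ = U.inn k →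
        ∃ g : blockU e he, g.1 ∈ UI' ∧ resU e he g = k ∧ U.inn g.1 = p.1 := fun p k hk h => by
      obtain ⟨g, h1, h2, h3⟩ := exists_inn_eq he i hor ⟨p.1, hI p.2⟩ k h
      exact ⟨g, ⟨g.2, h3 I (I.relative_le_pu _ p.2) hk⟩, h1, h2⟩
    -- Transitivity in the double of the corner gives k in the relative unitary group. The extension
    -- of kσ stays congruent to the identity modulo (I, Γ), because it fixes the isometry used to
    -- build it.
    have hsI : HD.LambdaSrLE hn (n - 2) → ∀ σ ∈ puStarI', ∃ p : puFixI, ∃ k ∈ I'.unitary,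
        resPU e he ⟨p.1, hI p.2⟩ = U.inn k * σ := fun h σ hσ => by
      obtain ⟨k, hk, h1⟩ := I'.exists_inn_mul_mem_relative (HR'.map_diag_absLast I' hn2) hHD'
        (fun h _ i => HR.uconj_corner_double I hn hn2 h i) h σ hσ
      obtain ⟨h2, h3⟩ := (I'.mem_relative_puFix_iff _ _).1 h1
      obtain ⟨τ, hτ, hτI⟩ := exists_resPU_eq he (U.inn k * σ) i h3
      exact ⟨⟨τ.1, (I.mem_relative_puFix_iff _ _).2 ⟨hτI I h2, τ.2⟩⟩, k, hk, hτ⟩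
    have hWI : ∀ k ∈ I'.unitary, U.inn k ∈ puStarI' := fun k hk => I'.inn_mem_relative hHD' hk
    have hWnI : ∀ σ ∈ puStarI', ∀ k ∈ I'.unitary, σ.val.mapU k ∈ I'.unitary :=
      fun σ hσ g hg => I'.mapU_mem_unitary (I'.relative_le_pu _ hσ) hg
    have pu4 := cosetStability_resPU (hP := hI) hVPI hVWI hrI hliftI hWI hWnI hsI
    refine ⟨⟨pu2, ?_⟩, ⟨pu4, ?_⟩, fun h => ?_, fun h => ?_⟩
    · rw [MonoidHom.range_eq_map]
      exact cosetStability_resU (hP := le_rfl) hι i hor hVP hVW hr hlift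
        (fun k _ => inn_mem_puStar he' k) (fun _ _ _ _ => Subgroup.mem_top _) hs _
    · exact cosetStability_resU (hP := hI) hι i hor hVPI hVWI hrI hliftI hWI hWnI hsI _
    -- Under the bound n - 2 both maps out of PU_n modulo U' are bijective, the one to rank n by the
    -- detour through e_{|n-1|}.
    · exact pu2.exists_mulEquiv (pu1 fun h _ i => HR.uconj_absLast_of_sub_two hn hn2 h i) h h
    · exact pu4.exists_mulEquiv (pu3 fun h _ i => HD.uconj_absLast_of_sub_two hn hn2 h i) h h
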